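/- Manifolds are smooth, finite-dimensional, without boundary, Hausdorff and second countable. A VB-groupoid $\mathcal V\rightrightarrows E$ over a Lie groupoid $\mathcal G\rightrightarrows M$ is a Lie groupoid structure on the total spaces of vector bundles $\mathcal V\to\mathcal G$, $E\to M$ all of whose structure maps ($\tilde s,\tilde t,\tilde 1,\tilde i,\tilde m$) are vector bundle morphisms over those of $\mathcal G$. Its core is $C=\ker(\tilde s)|_M$. A multiplicative section is a section $V\in\Gamma(\mathcal V)$ which, together with a section $e\in\Gamma(E)$, is a morphism of Lie groupoids $\mathcal G\to\mathcal V$; these form a vector space $\Gamma_{mult}(\mathcal V)$. The complex $C^\bullet_{mult}(\mathcal V)$ is the 2-term complex $\delta:\Gamma(C)\to\Gamma_{mult}(\mathcal V)$ in degrees $0,1$, $\delta(c)=c^r-c^l$, where $c^r(g)=c(t(g))\cdot\tilde 0_g$ and $c^l(g)=-\tilde 0_g\cdot\tilde i(c(s(g)))$. A morphism of Lie groupoids from $\mathcal G_1\rightrightarrows M_1$ to $\mathcal G_2\rightrightarrows M_2$, given by $\varphi$ on arrows and $f:M_1\to M_2$ on objects, is a weak equivalence if $\mathcal G_2\times_{M_2}^{s,f}M_1\to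 M_2$, $(g,x)\mapsto t(g)$, is a surjective submersion and the square formed by $\varphi$, $(s,t)$ on both sides, and $f\times f$ is a good fibre product of manifolds (a fibre product of topological spaces whose square of tangent bundles is also a fibre product). A morphism of VB-groupoids $\Phi:\mathcal V\to\mathcal W$ (a morphism of Lie groupoids which is a vector bundle morphism over a morphism $\phi:\mathcal G\to\mathcal H$ of the bases) is a VB-Morita map if $\Phi$ is a weak equivalence. VB-groupoids $\mathcal V,\mathcal V'$ are Morita equivalent if there are a VB-groupoid $\mathcal W$ and VB-Morita maps $\mathcal W\to\mathcal V$ and $\mathcal W\to\mathcal V'$. **Theorem.** (1) Let $\Phi:\mathcal V\to\mathcal W$ be a VB-Morita map covering $\phi:\mathcal G\to\mathcal H$. Let $\phi^*\mathcal W$ be the pullback VB-groupoid over $\mathcal G$, let $\phi^*:C^\bullet_{mult}(\mathcal W)\to C^\bullet_{mult}(\phi^*\mathcal W)$ be the chain map that pulls back sections, and let $\bar\Phi:C^\bullet_{mult}(\mathcal V)\to C^\bullet_{mult}(\phi^*\mathcal W)$ be the chain map induced by the canonical morphism $\mathcal V\to\phi^*\mathcal W$. Then $\phi^*$ induces an isomorphism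 in cohomology, and $(\phi^*)^{-1}\circ\bar\Phi$ is an isomorphism of vector spaces $H^i(C^\bullet_{mult}(\mathcal V))\cong H^i(C^\bullet_{mult}(\mathcal W))$ for $i=0,1$. (2) If $\mathcal V$ and $\mathcal V'$ are Morita equivalent VB-groupoids, then $H^i(C^\bullet_{mult}(\mathcal V))\cong H^i(C^\bullet_{mult}(\mathcal V'))$ as vector spaces for $i=0,1$. -/

import Mathlib

open Bundle Set
open scoped Manifold ContDiff Topology

universe u

noncomputable section

/-! ### Lie groupoids -/

/-- A Lie groupoid with manifold of arrows `A` and manifold of objects `B`.  The multiplication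
`mul g h` (first `h`, then `g`) is meaningful when `src g = tgt h`; its values on other pairs are
irrelevant, all axioms, including smoothness, only concern composable pairs.  As `src` and `tgt`
are submersions, the composable pairs form an embedded submanifold of `A × A`, and `ContMDiffOn`
is smoothness on it. -/
structure LieGroupoid {EA HA EB HB : Type*}
    [NormedAddCommGroup EA] [NormedSpace ℝ EA] [TopologicalSpace HA]
    [NormedAddCommGroup EB] [NormedSpace ℝ EB] [TopologicalSpace HB]
    (I : ModelWithCorners ℝ EA HA) (J : ModelWithCorners ℝ EB HB)
    (A B : Type*) [TopologicalSpace A] [ChartedSpace HA A]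
    [TopologicalSpace B] [ChartedSpace HB B] where
  src : A → B
  tgt : A → B
  one : B → A
  inv : A → A
  mul : A → A → A
  src_one : ∀ x, src (one x) = x
  tgt_one : ∀ x, tgt (one x) = x
  src_inv : ∀ g, src (inv g) = tgt g
  tgt_inv : ∀ g, tgt (inv g) = src g
  src_mul : ∀ g h, src g = tgt h → src (mul g h) = src h
  tgt_mul : ∀ g h, src g = tgt h → tgt (mul g h) = tgt g
  mul_assoc : ∀ g h k, src g = tgt h → src h = tgt k → mul (mul g h) k = mul g (mul h k)
  one_mul : ∀ g, mul (one (tgt g)) g = g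
  mul_one : ∀ g, mul g (one (src g)) = g
  inv_mul : ∀ g, mul (inv g) g = one (src g)
  mul_inv : ∀ g, mul g (inv g) = one (tgt g)
  submersion_src : Manifold.IsSubmersion I J ∞ src
  submersion_tgt : Manifold.IsSubmersion I J ∞ tgt
  smooth_one : ContMDiff J I ∞ one
  smooth_inv : ContMDiff I I ∞ inv
  smooth_mul : ContMDiffOn (I.prod I) I ∞ (fun p : A × A => mul p.1 p.2)
    {p : A × A | src p.1 = tgt p.2}

section LieGroupoidHom

variable {EA HA EB HB EA' HA' EB' HB' EA'' HA'' EB'' HB'' : Type*}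
  [NormedAddCommGroup EA] [NormedSpace ℝ EA] [TopologicalSpace HA]
  [NormedAddCommGroup EB] [NormedSpace ℝ EB] [TopologicalSpace HB]
  [NormedAddCommGroup EA'] [NormedSpace ℝ EA'] [TopologicalSpace HA']
  [NormedAddCommGroup EB'] [NormedSpace ℝ EB'] [TopologicalSpace HB']
  [NormedAddCommGroup EA''] [NormedSpace ℝ EA''] [TopologicalSpace HA'']
  [NormedAddCommGroup EB''] [NormedSpace ℝ EB''] [TopologicalSpace HB'']
  {I : ModelWithCorners ℝ EA HA} {J : ModelWithCorners ℝ EB HB}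
  {I' : ModelWithCorners ℝ EA' HA'} {J' : ModelWithCorners ℝ EB' HB'}
  {I'' : ModelWithCorners ℝ EA'' HA''} {J'' : ModelWithCorners ℝ EB'' HB''}
  {A B A' B' A'' B'' : Type*} [TopologicalSpace A] [ChartedSpace HA A]
  [TopologicalSpace B] [ChartedSpace HB B]
  [TopologicalSpace A'] [ChartedSpace HA' A']
  [TopologicalSpace B'] [ChartedSpace HB' B']
  [TopologicalSpace A''] [ChartedSpace HA'' A'']
  [TopologicalSpace B''] [ChartedSpace HB'' B'']

/-- A morphism of Lie groupoids: a smooth functor. -/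
structure LieGroupoidHom (K : LieGroupoid I J A B) (K' : LieGroupoid I' J' A' B') where
  map : A → A'
  obj : B → B'
  smooth_map : ContMDiff I I' ∞ map
  smooth_obj : ContMDiff J J' ∞ obj
  src_map : ∀ g, K'.src (map g) = obj (K.src g)
  tgt_map : ∀ g, K'.tgt (map g) = obj (K.tgt g)
  map_one : ∀ x, map (K.one x) = K'.one (obj x)
  map_mul : ∀ g h, K.src g = K.tgt h → map (K.mul g h) = K'.mul (map g) (map h)

/-- The identity morphism. -/
def LieGroupoidHom.id (K : LieGroupoid I J A B) : LieGroupoidHom K K where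
  map := fun g => g
  obj := fun x => x
  smooth_map := contMDiff_id
  smooth_obj := contMDiff_id
  src_map := fun _ => rfl
  tgt_map := fun _ => rfl
  map_one := fun _ => rfl
  map_mul := fun _ _ _ => rfl

/-- Composition of morphisms: first `φ`, then `ψ`. -/
def LieGroupoidHom.comp {K : LieGroupoid I J A B} {K' : LieGroupoid I' J' A' B'}
    {K'' : LieGroupoid I'' J'' A'' B''} (ψ : LieGroupoidHom K' K'') (φ : LieGroupoidHom K K') :
    LieGroupoidHom K K'' where
  map := fun g => ψ.map (φ.map g)
  obj := fun x => ψ.obj (φ.obj x)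
  smooth_map := ψ.smooth_map.comp φ.smooth_map
  smooth_obj := ψ.smooth_obj.comp φ.smooth_obj
  src_map := fun g => by rw [ψ.src_map, φ.src_map]
  tgt_map := fun g => by rw [ψ.tgt_map, φ.tgt_map]
  map_one := fun x => by rw [φ.map_one, ψ.map_one]
  map_mul := fun g h hgh => by
    rw [φ.map_mul g h hgh, ψ.map_mul _ _ (by rw [φ.src_map, φ.tgt_map, hgh])]

theorem LieGroupoidHom.map_inv {K : LieGroupoid I J A B} {K' : LieGroupoid I' J' A' B'}
    (φ : LieGroupoidHom K K') (g : A) : φ.map (K.inv g) = K'.inv (φ.map g) := by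
  have h1 : K'.mul (φ.map (K.inv g)) (φ.map g) = K'.one (φ.obj (K.src g)) := by
    rw [← φ.map_mul _ _ (K.src_inv g), K.inv_mul, φ.map_one]
  have hs : K'.src (φ.map (K.inv g)) = K'.tgt (φ.map g) := by
    rw [φ.src_map, φ.tgt_map, K.src_inv]
  calc φ.map (K.inv g)
      = K'.mul (φ.map (K.inv g)) (K'.one (K'.src (φ.map (K.inv g)))) := (K'.mul_one _).symm
    _ = K'.mul (φ.map (K.inv g)) (K'.mul (φ.map g) (K'.inv (φ.map g))) := by
        rw [K'.mul_inv, hs]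
    _ = K'.mul (K'.mul (φ.map (K.inv g)) (φ.map g)) (K'.inv (φ.map g)) := by
        rw [K'.mul_assoc _ _ _ hs (K'.tgt_inv _).symm]
    _ = K'.mul (K'.one (K'.tgt (K'.inv (φ.map g)))) (K'.inv (φ.map g)) := by
        rw [h1, K'.tgt_inv, φ.src_map]
    _ = K'.inv (φ.map g) := K'.one_mul _

/-- Weak equivalences of Lie groupoids.

* `ess_surj`, `ess_submersion`: the map `(g, x) ↦ tgt g` on the manifold
  `{(g, x) | src g = φ x}` is a surjective submersion.  The tangent space of this manifold at
  `(g, x)` consists of the pairs of tangent vectors at `g` and `x` with the same image.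
* `ff_range`, `ff_embedding`, `ff_tangent`: the square formed by `φ` and the maps `(src, tgt)` is
  a good fibre product of manifolds, that is, it identifies the space of arrows of `K` with the
  fibre product as a topological subspace of the product, and the square of tangent bundles is
  again a fibre product. -/
structure LieGroupoidHom.IsWeakEquivalence {K : LieGroupoid I J A B}
    {K' : LieGroupoid I' J' A' B'} (φ : LieGroupoidHom K K') : Prop where
  ess_surj : ∀ y : B', ∃ (g : A') (x : B), K'.src g = φ.obj x ∧ K'.tgt g = y
  ess_submersion : ∀ (g : A') (x : B), K'.src g = φ.obj x →
    ∀ w : TangentSpace J' (K'.tgt g), ∃ (ξ : TangentSpace I' g) (v : TangentSpace J x),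
      tangentMap I' J' K'.src (⟨g, ξ⟩ : TangentBundle I' A') =
        tangentMap J J' φ.obj (⟨x, v⟩ : TangentBundle J B) ∧
      mfderiv I' J' K'.tgt g ξ = w
  ff_range : range (fun g : A => (φ.map g, K.src g, K.tgt g)) =
    {p : A' × B × B | K'.src p.1 = φ.obj p.2.1 ∧ K'.tgt p.1 = φ.obj p.2.2}
  ff_embedding : Topology.IsEmbedding (fun g : A => (φ.map g, K.src g, K.tgt g))
  ff_tangent : ∀ (ξ : TangentBundle I' A') (v w : TangentBundle J B),
    tangentMap I' J' K'.src ξ = tangentMap J J' φ.obj v →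
    tangentMap I' J' K'.tgt ξ = tangentMap J J' φ.obj w →
    ∃! η : TangentBundle I A, tangentMap I I' φ.map η = ξ ∧
      tangentMap I J K.src η = v ∧ tangentMap I J K.tgt η = w

end LieGroupoidHom

/-! ### Manifolds and vector bundles -/

/-- A smooth manifold: finite-dimensional, without boundary, Hausdorff, second countable. -/
structure SmoothMfd : Type (u + 1) where
  dim : ℕ
  carrier : Type u
  [top : TopologicalSpace carrier]
  [charted : ChartedSpace (EuclideanSpace ℝ (Fin dim)) carrier]
  [mfd : IsManifold (𝓡 dim) ∞ carrier]
  [t2 : T2Space carrier]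
  [sc : SecondCountableTopology carrier]

namespace SmoothMfd

instance : CoeSort SmoothMfd.{u} (Type u) := ⟨SmoothMfd.carrier⟩

attribute [instance] SmoothMfd.top SmoothMfd.charted SmoothMfd.mfd SmoothMfd.t2 SmoothMfd.sc

end SmoothMfd

/-- A smooth real vector bundle of finite rank over a manifold. -/
structure SmoothVB (B : SmoothMfd.{u}) : Type (u + 1) where
  rank : ℕ
  fiber : B → Type u
  [acg : ∀ b, AddCommGroup (fiber b)]
  [mod : ∀ b, Module ℝ (fiber b)]
  [topTot : TopologicalSpace (TotalSpace (EuclideanSpace ℝ (Fin rank)) fiber)]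
  [topFib : ∀ b, TopologicalSpace (fiber b)]
  [fb : FiberBundle (EuclideanSpace ℝ (Fin rank)) fiber]
  [vb : VectorBundle ℝ (EuclideanSpace ℝ (Fin rank)) fiber]
  [smooth : ContMDiffVectorBundle ∞ (EuclideanSpace ℝ (Fin rank)) fiber (𝓡 B.dim)]

namespace SmoothVB

attribute [instance] SmoothVB.acg SmoothVB.mod SmoothVB.topTot SmoothVB.topFib SmoothVB.fb
  SmoothVB.vb SmoothVB.smooth

variable {B : SmoothMfd.{u}}

/-- The total space of a vector bundle. -/
abbrev Tot (V : SmoothVB B) : Type u := TotalSpace (EuclideanSpace ℝ (Fin V.rank)) V.fiber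

/-- The model on which the total space of a vector bundle is a manifold. -/
abbrev model (V : SmoothVB B) := (𝓡 B.dim).prod 𝓘(ℝ, EuclideanSpace ℝ (Fin V.rank))

/-- The vector `v` in the fibre over `b` as a point of the total space. -/
abbrev pt (V : SmoothVB B) (b : B) (v : V.fiber b) : V.Tot := ⟨b, v⟩

/-- A point of the total space lying over `b`, as a vector in the fibre over `b`. -/
def toFiber (V : SmoothVB B) (p : V.Tot) (b : B) (h : p.proj = b) : V.fiber b :=
  cast (congrArg V.fiber h) p.snd

theorem pt_toFiber (V : SmoothVB B) (p : V.Tot) (b : B) (h : p.proj = b) :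
    V.pt b (V.toFiber p b h) = p := by
  subst h; rfl

theorem pt_inj (V : SmoothVB B) {b : B} {v w : V.fiber b} (h : V.pt b v = V.pt b w) : v = w := by
  simpa using h

theorem toFiber_pt (V : SmoothVB B) (b : B) (v : V.fiber b) (h : (V.pt b v).proj = b) :
    V.toFiber (V.pt b v) b h = v := rfl

end SmoothVB

/-- `f` maps each fibre linearly to the fibre prescribed by `f₀`. Together with smoothness of `f`
this says that `f` is a morphism of vector bundles covering `f₀`. -/
def IsFiberwiseLinear {B B' : SmoothMfd.{u}} {V : SmoothVB B} {V' : SmoothVB B'}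
    (f : V.Tot → V'.Tot) (f₀ : B → B') : Prop :=
  ∃ L : ∀ b, V.fiber b →ₗ[ℝ] V'.fiber (f₀ b), ∀ b v, f (V.pt b v) = V'.pt (f₀ b) (L b v)

/-! ### VB-groupoids -/

/-- A VB-groupoid `V ⇉ E` over a Lie groupoid `G ⇉ M`: a Lie groupoid structure on the total
spaces of vector bundles `V → G` and `E → M` all of whose structure maps are vector bundle morphisms
over the structure maps of `G ⇉ M`.  For the multiplication, the fibre of the bundle of composable
pairs over `(g, h)` is a linear subspace of `V_g × V_h`, and a map on a subspace is linear if and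
only if it is the restriction of a linear map on the whole space. -/
structure VBGroupoid : Type (u + 1) where
  G : SmoothMfd.{u}
  M : SmoothMfd.{u}
  V : SmoothVB G
  E : SmoothVB M
  base : LieGroupoid (𝓡 G.dim) (𝓡 M.dim) G M
  total : LieGroupoid V.model E.model V.Tot E.Tot
  src_lin : IsFiberwiseLinear total.src base.src
  tgt_lin : IsFiberwiseLinear total.tgt base.tgt
  one_lin : IsFiberwiseLinear total.one base.one
  inv_lin : IsFiberwiseLinear total.inv base.inv
  mul_lin : ∀ g h, base.src g = base.tgt h →
    ∃ L : (V.fiber g × V.fiber h) →ₗ[ℝ] V.fiber (base.mul g h),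
      ∀ v w, total.src (V.pt g v) = total.tgt (V.pt h w) →
        total.mul (V.pt g v) (V.pt h w) = V.pt (base.mul g h) (L (v, w))

/-- A morphism of VB-groupoids: a morphism `total` of Lie groupoids that is, on arrows and on
objects, a vector bundle morphism over a morphism `base` of the base groupoids. -/
structure VBGroupoidHom (𝒱 𝒲 : VBGroupoid.{u}) where
  base : LieGroupoidHom 𝒱.base 𝒲.base
  total : LieGroupoidHom 𝒱.total 𝒲.total
  map_lin : IsFiberwiseLinear total.map base.map
  obj_lin : IsFiberwiseLinear total.obj base.obj

/-- A VB-Morita map. -/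
def VBGroupoidHom.IsVBMorita {𝒱 𝒲 : VBGroupoid.{u}} (Φ : VBGroupoidHom 𝒱 𝒲) : Prop :=
  Φ.total.IsWeakEquivalence

/-- Morita equivalence of VB-groupoids. -/
def VBGroupoid.MoritaEquivalent (𝒱 𝒱' : VBGroupoid.{u}) : Prop :=
  ∃ (𝒲 : VBGroupoid.{u}) (Φ : VBGroupoidHom 𝒲 𝒱) (Φ' : VBGroupoidHom 𝒲 𝒱'),
    Φ.IsVBMorita ∧ Φ'.IsVBMorita

/-! ### 2-term complexes -/

/-- A cochain complex of real vector spaces concentrated in degrees `0` and `1`. -/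
structure TwoTermComplex : Type (u + 1) where
  X0 : Type u
  X1 : Type u
  [acg0 : AddCommGroup X0]
  [acg1 : AddCommGroup X1]
  [mod0 : Module ℝ X0]
  [mod1 : Module ℝ X1]
  d : X0 →ₗ[ℝ] X1

namespace TwoTermComplex

attribute [instance] TwoTermComplex.acg0 TwoTermComplex.acg1 TwoTermComplex.mod0
  TwoTermComplex.mod1

/-- Cohomology in degree `0`. -/
abbrev H0 (C : TwoTermComplex.{u}) : Type u := LinearMap.ker C.d

/-- Cohomology in degree `1`. -/
abbrev H1 (C : TwoTermComplex.{u}) : Type u := C.X1 ⧸ LinearMap.range C.d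

/-- Chain maps. -/
structure Hom (C D : TwoTermComplex.{u}) where
  f0 : C.X0 →ₗ[ℝ] D.X0
  f1 : C.X1 →ₗ[ℝ] D.X1
  comm : ∀ x, f1 (C.d x) = D.d (f0 x)

/-- The map induced in degree `0` cohomology. -/
def Hom.mapH0 {C D : TwoTermComplex.{u}} (f : Hom C D) : C.H0 →ₗ[ℝ] D.H0 :=
  f.f0.restrict (fun x hx => by
    rw [LinearMap.mem_ker] at hx ⊢
    rw [← f.comm, hx, map_zero])

/-- The map induced in degree `1` cohomology. -/
def Hom.mapH1 {C D : TwoTermComplex.{u}} (f : Hom C D) : C.H1 →ₗ[ℝ] D.H1 :=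
  Submodule.mapQ _ _ f.f1 (by
    rintro _ ⟨x, rfl⟩
    exact ⟨f.f0 x, (f.comm x).symm⟩)

end TwoTermComplex

/-! ### Multiplicative sections -/

section Interchange

/-- `r` is the sum of `p` and `q` in a common fibre. -/
def SmoothVB.IsSum {B : SmoothMfd.{u}} (V : SmoothVB B) (p q r : V.Tot) : Prop :=
  ∃ (b : B) (v w : V.fiber b), p = V.pt b v ∧ q = V.pt b w ∧ r = V.pt b (v + w)

theorem SmoothVB.IsSum.unique {B : SmoothMfd.{u}} {V : SmoothVB B} {p q r r' : V.Tot}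
    (h : V.IsSum p q r) (h' : V.IsSum p q r') : r = r' := by
  obtain ⟨b, v, w, rfl, rfl, rfl⟩ := h
  obtain ⟨b', v', w', h1, h2, rfl⟩ := h'
  obtain rfl : b = b' := congrArg TotalSpace.proj h1
  rw [V.pt_inj h1, V.pt_inj h2]

theorem IsFiberwiseLinear.proj {B B' : SmoothMfd.{u}} {V : SmoothVB B} {V' : SmoothVB B'}
    {f : V.Tot → V'.Tot} {f₀ : B → B'} (hf : IsFiberwiseLinear f f₀) (p : V.Tot) :
    (f p).proj = f₀ p.proj := by
  obtain ⟨L, hL⟩ := hf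
  rw [show p = V.pt p.proj p.snd from rfl, hL]

theorem IsFiberwiseLinear.map_zero {B B' : SmoothMfd.{u}} {V : SmoothVB B} {V' : SmoothVB B'}
    {f : V.Tot → V'.Tot} {f₀ : B → B'} (hf : IsFiberwiseLinear f f₀) (b : B) :
    f (V.pt b 0) = V'.pt (f₀ b) 0 := by
  obtain ⟨L, hL⟩ := hf
  rw [hL, _root_.map_zero]

theorem IsFiberwiseLinear.isSum {B B' : SmoothMfd.{u}} {V : SmoothVB B} {V' : SmoothVB B'}
    {f : V.Tot → V'.Tot} {f₀ : B → B'} (hf : IsFiberwiseLinear f f₀) {p q r : V.Tot}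
    (h : V.IsSum p q r) : V'.IsSum (f p) (f q) (f r) := by
  obtain ⟨L, hL⟩ := hf
  obtain ⟨b, v, w, rfl, rfl, rfl⟩ := h
  exact ⟨f₀ b, L b v, L b w, hL _ _, hL _ _, by rw [hL, map_add]⟩

theorem VBGroupoid.isSum_mul (𝒲 : VBGroupoid.{u}) {p q r p' q' r' : 𝒲.V.Tot}
    (h : 𝒲.V.IsSum p q r) (h' : 𝒲.V.IsSum p' q' r')
    (hp : 𝒲.total.src p = 𝒲.total.tgt p') (hq : 𝒲.total.src q = 𝒲.total.tgt q') :
    𝒲.V.IsSum (𝒲.total.mul p p') (𝒲.total.mul q q') (𝒲.total.mul r r') := by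
  have hr : 𝒲.total.src r = 𝒲.total.tgt r' := by
    have h1 := 𝒲.src_lin.isSum h
    have h2 := 𝒲.tgt_lin.isSum h'
    rw [hp, hq] at h1
    exact h1.unique h2
  obtain ⟨g, v, w, rfl, rfl, rfl⟩ := h
  obtain ⟨g', v', w', rfl, rfl, rfl⟩ := h'
  have hc : 𝒲.base.src g = 𝒲.base.tgt g' := by
    rw [← 𝒲.src_lin.proj (𝒲.V.pt g v), hp, 𝒲.tgt_lin.proj]
  obtain ⟨L, hL⟩ := 𝒲.mul_lin g g' hc
  refine ⟨_, L (v, v'), L (w, w'), hL _ _ hp, hL _ _ hq, ?_⟩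
  rw [hL _ _ hr, ← map_add]
  rfl

/-- `r` is the multiple of `p` by `a`. -/
def SmoothVB.IsSmul {B : SmoothMfd.{u}} (V : SmoothVB B) (a : ℝ) (p r : V.Tot) : Prop :=
  ∃ (b : B) (v : V.fiber b), p = V.pt b v ∧ r = V.pt b (a • v)

theorem SmoothVB.IsSmul.unique {B : SmoothMfd.{u}} {V : SmoothVB B} {a : ℝ} {p r r' : V.Tot}
    (h : V.IsSmul a p r) (h' : V.IsSmul a p r') : r = r' := by
  obtain ⟨b, v, rfl, rfl⟩ := h
  obtain ⟨b', v', h1, rfl⟩ := h'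
  obtain rfl : b = b' := congrArg TotalSpace.proj h1
  rw [V.pt_inj h1]

theorem IsFiberwiseLinear.isSmul {B B' : SmoothMfd.{u}} {V : SmoothVB B} {V' : SmoothVB B'}
    {f : V.Tot → V'.Tot} {f₀ : B → B'} (hf : IsFiberwiseLinear f f₀) {a : ℝ} {p r : V.Tot}
    (h : V.IsSmul a p r) : V'.IsSmul a (f p) (f r) := by
  obtain ⟨L, hL⟩ := hf
  obtain ⟨b, v, rfl, rfl⟩ := h
  exact ⟨f₀ b, L b v, hL _ _, by rw [hL, map_smul]⟩

theorem VBGroupoid.isSmul_mul (𝒲 : VBGroupoid.{u}) {a : ℝ} {p r p' r' : 𝒲.V.Tot}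
    (h : 𝒲.V.IsSmul a p r) (h' : 𝒲.V.IsSmul a p' r')
    (hp : 𝒲.total.src p = 𝒲.total.tgt p') :
    𝒲.V.IsSmul a (𝒲.total.mul p p') (𝒲.total.mul r r') := by
  have hr : 𝒲.total.src r = 𝒲.total.tgt r' := by
    have h1 := 𝒲.src_lin.isSmul h
    rw [hp] at h1
    exact h1.unique (𝒲.tgt_lin.isSmul h')
  obtain ⟨g, v, rfl, rfl⟩ := h
  obtain ⟨g', v', rfl, rfl⟩ := h'
  have hc : 𝒲.base.src g = 𝒲.base.tgt g' := by
    rw [← 𝒲.src_lin.proj (𝒲.V.pt g v), hp, 𝒲.tgt_lin.proj]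
  obtain ⟨L, hL⟩ := 𝒲.mul_lin g g' hc
  refine ⟨_, L (v, v'), hL _ _ hp, ?_⟩
  rw [hL _ _ hr, ← map_smul]
  rfl

theorem VBGroupoid.comp_proj (𝒲 : VBGroupoid.{u}) {p q : 𝒲.V.Tot}
    (h : 𝒲.total.src p = 𝒲.total.tgt q) : 𝒲.base.src p.proj = 𝒲.base.tgt q.proj := by
  rw [← 𝒲.src_lin.proj, h, 𝒲.tgt_lin.proj]

theorem VBGroupoid.mul_proj (𝒲 : VBGroupoid.{u}) {p q : 𝒲.V.Tot}
    (h : 𝒲.total.src p = 𝒲.total.tgt q) :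
    (𝒲.total.mul p q).proj = 𝒲.base.mul p.proj q.proj := by
  obtain ⟨L, hL⟩ := 𝒲.mul_lin p.proj q.proj (𝒲.comp_proj h)
  have := hL p.snd q.snd h
  exact congrArg TotalSpace.proj this

theorem VBGroupoid.mul_zero (𝒲 : VBGroupoid.{u}) {g h : 𝒲.G}
    (hc : 𝒲.base.src g = 𝒲.base.tgt h) :
    𝒲.total.mul (𝒲.V.pt g 0) (𝒲.V.pt h 0) = 𝒲.V.pt (𝒲.base.mul g h) 0 := by
  obtain ⟨L, hL⟩ := 𝒲.mul_lin g h hc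
  rw [hL 0 0 (by rw [𝒲.src_lin.map_zero, 𝒲.tgt_lin.map_zero, hc])]
  rw [show ((0, 0) : 𝒲.V.fiber g × 𝒲.V.fiber h) = 0 from rfl, _root_.map_zero]

section Smooth

variable {EP HP P : Type*} [NormedAddCommGroup EP] [NormedSpace ℝ EP] [TopologicalSpace HP]
  {IP : ModelWithCorners ℝ EP HP} [TopologicalSpace P] [ChartedSpace HP P]
  {B : SmoothMfd.{u}} (V : SmoothVB B) {f : P → B} {s t : ∀ x, V.fiber (f x)}

theorem SmoothVB.smooth_add
    (hs : ContMDiff IP V.model ∞ (fun x => V.pt (f x) (s x)))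
    (ht : ContMDiff IP V.model ∞ (fun x => V.pt (f x) (t x))) :
    ContMDiff IP V.model ∞ (fun x => V.pt (f x) (s x + t x)) := by
  intro x₀
  have h1 := hs x₀
  have h2 := ht x₀
  rw [contMDiffAt_totalSpace] at h1 h2 ⊢
  refine ⟨h1.1, (h1.2.add h2.2).congr_of_eventuallyEq ?_⟩
  have hU := h1.1.continuousAt.preimage_mem_nhds
    ((trivializationAt (EuclideanSpace ℝ (Fin V.rank)) V.fiber (f x₀)).open_baseSet.mem_nhds
      (mem_baseSet_trivializationAt _ V.fiber (f x₀)))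
  filter_upwards [hU] with x hx
  exact ((trivializationAt (EuclideanSpace ℝ (Fin V.rank)) V.fiber (f x₀)).linear ℝ hx).1 _ _

theorem SmoothVB.smooth_smul (a : ℝ)
    (hs : ContMDiff IP V.model ∞ (fun x => V.pt (f x) (s x))) :
    ContMDiff IP V.model ∞ (fun x => V.pt (f x) (a • s x)) := by
  intro x₀
  have h1 := hs x₀
  rw [contMDiffAt_totalSpace] at h1 ⊢
  refine ⟨h1.1, (((a • ContinuousLinearMap.id ℝ _ :
    EuclideanSpace ℝ (Fin V.rank) →L[ℝ] EuclideanSpace ℝ (Fin V.rank)).contMDiff.contMDiffAt).comp x₀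
      h1.2).congr_of_eventuallyEq ?_⟩
  have hU := h1.1.continuousAt.preimage_mem_nhds
    ((trivializationAt (EuclideanSpace ℝ (Fin V.rank)) V.fiber (f x₀)).open_baseSet.mem_nhds
      (mem_baseSet_trivializationAt _ V.fiber (f x₀)))
  filter_upwards [hU] with x hx
  exact ((trivializationAt (EuclideanSpace ℝ (Fin V.rank)) V.fiber (f x₀)).linear ℝ hx).2 _ _

theorem SmoothVB.smooth_zero (hf : ContMDiff IP (𝓡 B.dim) ∞ f) :
    ContMDiff IP V.model ∞ (fun x => V.pt (f x) 0) :=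
  (contMDiff_zeroSection ℝ V.fiber).comp hf

end Smooth

end Interchange

/-! In this section `φ : K → 𝒲.base` is a morphism of Lie groupoids. The pullback VB-groupoid
`φ^*𝒲` over `K` is the strict fibre product of `K` and the total groupoid of `𝒲` over the base
of `𝒲`.  A section of the vector bundle `φ^*𝒲` is a section of `𝒲` along `φ`, that is, a map `σ`
from the arrows of `K` to the total space with `σ(g)` in the fibre over `φ(g)`, and the section is
multiplicative when `σ` is a morphism of Lie groupoids.  The core of `φ^*𝒲` is the pullback of
the core of `𝒲` along the map `φ` on objects.  For `φ` the identity one gets the sections and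
multiplicative sections of `𝒲` itself. -/

section Along

variable {A B : SmoothMfd.{u}} {K : LieGroupoid (𝓡 A.dim) (𝓡 B.dim) A B} (𝒲 : VBGroupoid.{u})
  (φ : LieGroupoidHom K 𝒲.base)

/-- Smooth sections of the core of `φ^*𝒲`.  The core of `𝒲` is the restriction to the units of
the kernel of the source map, so its fibre at `y` consists of the vectors `c` over the unit at `y`
whose source is the zero vector over `y`. -/
def VBGroupoid.coreSections : Submodule ℝ (∀ x : B, 𝒲.V.fiber (𝒲.base.one (φ.obj x))) where
  carrier := {c |
    ContMDiff (𝓡 B.dim) 𝒲.V.model ∞ (fun x : B => 𝒲.V.pt (𝒲.base.one (φ.obj x)) (c x)) ∧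
    ∀ x, 𝒲.total.src (𝒲.V.pt (𝒲.base.one (φ.obj x)) (c x)) = 𝒲.E.pt (φ.obj x) 0}
  add_mem' := by
    rintro c d ⟨hc, hc'⟩ ⟨hd, hd'⟩
    refine ⟨𝒲.V.smooth_add hc hd, fun x => ?_⟩
    have h := 𝒲.src_lin.isSum ⟨_, c x, d x, rfl, rfl, rfl⟩
    rw [hc', hd'] at h
    exact h.unique ⟨_, 0, 0, rfl, rfl, by rw [add_zero]⟩
  zero_mem' := by
    refine ⟨𝒲.V.smooth_zero (𝒲.base.smooth_one.comp φ.smooth_obj), fun x => ?_⟩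
    rw [Pi.zero_apply, 𝒲.src_lin.map_zero, 𝒲.base.src_one]
  smul_mem' := by
    rintro a c ⟨hc, hc'⟩
    refine ⟨𝒲.V.smooth_smul a hc, fun x => ?_⟩
    have h := 𝒲.src_lin.isSmul (a := a) ⟨_, c x, rfl, rfl⟩
    rw [hc'] at h
    exact h.unique ⟨_, 0, rfl, by rw [smul_zero]⟩

theorem LieGroupoid.eq_one_of_mul_self {EA HA EB HB A B : Type*}
    [NormedAddCommGroup EA] [NormedSpace ℝ EA] [TopologicalSpace HA]
    [NormedAddCommGroup EB] [NormedSpace ℝ EB] [TopologicalSpace HB]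
    {I : ModelWithCorners ℝ EA HA} {J : ModelWithCorners ℝ EB HB}
    [TopologicalSpace A] [ChartedSpace HA A] [TopologicalSpace B] [ChartedSpace HB B]
    (K : LieGroupoid I J A B) (g : A) (hg : K.src g = K.tgt g) (h : K.mul g g = g) :
    g = K.one (K.src g) :=
  calc g = K.mul (K.one (K.tgt g)) g := (K.one_mul g).symm
    _ = K.mul (K.mul (K.inv g) g) g := by rw [K.inv_mul, hg]
    _ = K.mul (K.inv g) (K.mul g g) := K.mul_assoc _ _ _ (K.src_inv g) hg
    _ = K.one (K.src g) := by rw [h, K.inv_mul]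

theorem VBGroupoid.exists_hom (σ : ∀ g : A, 𝒲.V.fiber (φ.map g)) (e : B → 𝒲.E.Tot)
    (hσ : ContMDiff (𝓡 A.dim) 𝒲.V.model ∞ (fun g : A => 𝒲.V.pt (φ.map g) (σ g)))
    (hs : ∀ g, 𝒲.total.src (𝒲.V.pt (φ.map g) (σ g)) = e (K.src g))
    (ht : ∀ g, 𝒲.total.tgt (𝒲.V.pt (φ.map g) (σ g)) = e (K.tgt g))
    (hm : ∀ g h, K.src g = K.tgt h → 𝒲.V.pt (φ.map (K.mul g h)) (σ (K.mul g h)) =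
      𝒲.total.mul (𝒲.V.pt (φ.map g) (σ g)) (𝒲.V.pt (φ.map h) (σ h))) :
    ∃ F : LieGroupoidHom K 𝒲.total, ∀ g, F.map g = 𝒲.V.pt (φ.map g) (σ g) := by
  have he : e = fun x => 𝒲.total.src (𝒲.V.pt (φ.map (K.one x)) (σ (K.one x))) := by
    funext x
    rw [hs, K.src_one]
  refine ⟨⟨fun g => 𝒲.V.pt (φ.map g) (σ g), e, hσ, ?_, hs, ht, fun x => ?_, hm⟩, fun _ => rfl⟩
  · rw [he]
    exact 𝒲.total.submersion_src.contMDiff.comp (hσ.comp K.smooth_one)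
  · have h1 : K.mul (K.one x) (K.one x) = K.one x := by
      conv_lhs => rw [← K.tgt_one x, K.tgt_one, ← K.src_one x]
      simpa [K.src_one] using K.mul_one (K.one x)
    have h2 := hm (K.one x) (K.one x) (by rw [K.src_one, K.tgt_one])
    rw [h1] at h2
    have h3 := 𝒲.total.eq_one_of_mul_self _ (by rw [hs, ht, K.src_one, K.tgt_one]) h2.symm
    rw [hs, K.src_one] at h3
    exact h3

/-- Multiplicative sections of `φ^*𝒲`: the (smooth) sections that are the map on arrows of a
morphism of Lie groupoids to the total groupoid of `𝒲`.  The map on objects of this morphism is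
then a smooth section of the pullback of the bundle of objects. -/
def VBGroupoid.multSections : Submodule ℝ (∀ g : A, 𝒲.V.fiber (φ.map g)) where
  carrier := {σ | ∃ F : LieGroupoidHom K 𝒲.total, ∀ g, F.map g = 𝒲.V.pt (φ.map g) (σ g)}
  add_mem' := by
    rintro σ τ ⟨F, hF⟩ ⟨F', hF'⟩
    have hsum : ∀ g, 𝒲.V.IsSum (F.map g) (F'.map g) (𝒲.V.pt (φ.map g) ((σ + τ) g)) :=
      fun g => ⟨_, σ g, τ g, hF g, hF' g, rfl⟩
    refine 𝒲.exists_hom φ (σ + τ)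
      (fun x => 𝒲.total.src (𝒲.V.pt (φ.map (K.one x)) ((σ + τ) (K.one x)))) ?_ ?_ ?_ ?_
    · refine 𝒲.V.smooth_add ?_ ?_
      · exact F.smooth_map.congr fun g => (hF g).symm
      · exact F'.smooth_map.congr fun g => (hF' g).symm
    · intro g
      have h1 := 𝒲.src_lin.isSum (hsum g)
      have h2 := 𝒲.src_lin.isSum (hsum (K.one (K.src g)))
      rw [F.src_map, F'.src_map] at h1 h2
      rw [K.src_one] at h2
      exact h1.unique h2
    · intro g
      have h1 := 𝒲.tgt_lin.isSum (hsum g)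
      have h2 := 𝒲.src_lin.isSum (hsum (K.one (K.tgt g)))
      rw [F.tgt_map, F'.tgt_map] at h1
      rw [F.src_map, F'.src_map, K.src_one] at h2
      exact h1.unique h2
    · intro g h hgh
      have h1 := hsum (K.mul g h)
      have h2 := 𝒲.isSum_mul (hsum g) (hsum h) (by rw [F.src_map, F.tgt_map, hgh])
        (by rw [F'.src_map, F'.tgt_map, hgh])
      rw [F.map_mul _ _ hgh, F'.map_mul _ _ hgh] at h1
      exact h1.unique h2
  zero_mem' := by
    refine 𝒲.exists_hom φ 0 (fun x => 𝒲.E.pt (φ.obj x) 0) ?_ ?_ ?_ ?_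
    · exact 𝒲.V.smooth_zero φ.smooth_map
    · intro g
      rw [Pi.zero_apply, 𝒲.src_lin.map_zero, φ.src_map]
    · intro g
      rw [Pi.zero_apply, 𝒲.tgt_lin.map_zero, φ.tgt_map]
    · intro g h hgh
      rw [Pi.zero_apply, Pi.zero_apply, Pi.zero_apply,
        𝒲.mul_zero (by rw [φ.src_map, φ.tgt_map, hgh]), φ.map_mul g h hgh]
  smul_mem' := by
    rintro a σ ⟨F, hF⟩
    have hsm : ∀ g, 𝒲.V.IsSmul a (F.map g) (𝒲.V.pt (φ.map g) ((a • σ) g)) :=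
      fun g => ⟨_, σ g, hF g, rfl⟩
    refine 𝒲.exists_hom φ (a • σ)
      (fun x => 𝒲.total.src (𝒲.V.pt (φ.map (K.one x)) ((a • σ) (K.one x)))) ?_ ?_ ?_ ?_
    · exact 𝒲.V.smooth_smul a (F.smooth_map.congr fun g => (hF g).symm)
    · intro g
      have h1 := 𝒲.src_lin.isSmul (hsm g)
      have h2 := 𝒲.src_lin.isSmul (hsm (K.one (K.src g)))
      rw [F.src_map] at h1 h2
      rw [K.src_one] at h2
      exact h1.unique h2
    · intro g
      have h1 := 𝒲.tgt_lin.isSmul (hsm g)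
      have h2 := 𝒲.src_lin.isSmul (hsm (K.one (K.tgt g)))
      rw [F.tgt_map] at h1
      rw [F.src_map, K.src_one] at h2
      exact h1.unique h2
    · intro g h hgh
      have h1 := hsm (K.mul g h)
      have h2 := 𝒲.isSmul_mul (hsm g) (hsm h) (by rw [F.src_map, F.tgt_map, hgh])
      rw [F.map_mul _ _ hgh] at h1
      exact h1.unique h2

variable {𝒲 φ}

theorem VBGroupoid.right_comp (c : 𝒲.coreSections φ) (g : A) :
    𝒲.total.src (𝒲.V.pt (𝒲.base.one (φ.obj (K.tgt g))) (c.1 (K.tgt g))) =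
      𝒲.total.tgt (𝒲.V.pt (φ.map g) 0) := by
  rw [c.2.2, 𝒲.tgt_lin.map_zero, φ.tgt_map]

theorem VBGroupoid.left_comp (c : 𝒲.coreSections φ) (g : A) :
    𝒲.total.src (𝒲.V.pt (φ.map g) 0) =
      𝒲.total.tgt (𝒲.total.inv (𝒲.V.pt (𝒲.base.one (φ.obj (K.src g))) (c.1 (K.src g)))) := by
  rw [𝒲.total.tgt_inv, c.2.2, 𝒲.src_lin.map_zero, φ.src_map]

theorem VBGroupoid.right_proj (c : 𝒲.coreSections φ) (g : A) :
    (𝒲.total.mul (𝒲.V.pt (𝒲.base.one (φ.obj (K.tgt g))) (c.1 (K.tgt g)))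
      (𝒲.V.pt (φ.map g) 0)).proj = φ.map g := by
  rw [𝒲.mul_proj (VBGroupoid.right_comp c g)]
  change 𝒲.base.mul (𝒲.base.one (φ.obj (K.tgt g))) (φ.map g) = φ.map g
  rw [← φ.tgt_map, 𝒲.base.one_mul]

theorem LieGroupoid.inv_one {EA HA EB HB A B : Type*}
    [NormedAddCommGroup EA] [NormedSpace ℝ EA] [TopologicalSpace HA]
    [NormedAddCommGroup EB] [NormedSpace ℝ EB] [TopologicalSpace HB]
    {I : ModelWithCorners ℝ EA HA} {J : ModelWithCorners ℝ EB HB}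
    [TopologicalSpace A] [ChartedSpace HA A] [TopologicalSpace B] [ChartedSpace HB B]
    (K : LieGroupoid I J A B) (x : B) : K.inv (K.one x) = K.one x := by
  have h1 := K.mul_inv (K.one x)
  have h2 := K.one_mul (K.inv (K.one x))
  rw [K.tgt_inv, K.src_one] at h2
  rw [h2, K.tgt_one] at h1
  exact h1

theorem VBGroupoid.left_proj (c : 𝒲.coreSections φ) (g : A) :
    (𝒲.total.mul (𝒲.V.pt (φ.map g) 0) (𝒲.total.inv
      (𝒲.V.pt (𝒲.base.one (φ.obj (K.src g))) (c.1 (K.src g))))).proj = φ.map g := by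
  rw [𝒲.mul_proj (VBGroupoid.left_comp c g), 𝒲.inv_lin.proj]
  change 𝒲.base.mul (φ.map g) (𝒲.base.inv (𝒲.base.one (φ.obj (K.src g)))) = φ.map g
  rw [𝒲.base.inv_one, ← φ.src_map, 𝒲.base.mul_one]

/-- The right invariant section `c^r(g) = c(tgt g) ⬝ 0_g` determined by a core section `c`. -/
def VBGroupoid.rightInv (c : 𝒲.coreSections φ) (g : A) : 𝒲.V.fiber (φ.map g) :=
  𝒲.V.toFiber (𝒲.total.mul (𝒲.V.pt (𝒲.base.one (φ.obj (K.tgt g))) (c.1 (K.tgt g)))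
    (𝒲.V.pt (φ.map g) 0)) (φ.map g) (VBGroupoid.right_proj c g)

/-- The left invariant section `c^l(g) = - 0_g ⬝ (c(src g))⁻¹` determined by a core section `c`,
where the inverse is that of the total groupoid. -/
def VBGroupoid.leftInv (c : 𝒲.coreSections φ) (g : A) : 𝒲.V.fiber (φ.map g) :=
  - 𝒲.V.toFiber (𝒲.total.mul (𝒲.V.pt (φ.map g) 0) (𝒲.total.inv
    (𝒲.V.pt (𝒲.base.one (φ.obj (K.src g))) (c.1 (K.src g))))) (φ.map g)
    (VBGroupoid.left_proj c g)

theorem VBGroupoid.pt_rightInv (c : 𝒲.coreSections φ) (g : A) :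
    𝒲.V.pt (φ.map g) (VBGroupoid.rightInv c g) =
      𝒲.total.mul (𝒲.V.pt (𝒲.base.one (φ.obj (K.tgt g))) (c.1 (K.tgt g)))
        (𝒲.V.pt (φ.map g) 0) :=
  𝒲.V.pt_toFiber _ _ _

theorem VBGroupoid.pt_neg_leftInv (c : 𝒲.coreSections φ) (g : A) :
    𝒲.V.pt (φ.map g) (- VBGroupoid.leftInv c g) =
      𝒲.total.mul (𝒲.V.pt (φ.map g) 0) (𝒲.total.inv
        (𝒲.V.pt (𝒲.base.one (φ.obj (K.src g))) (c.1 (K.src g)))) := by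
  rw [VBGroupoid.leftInv, neg_neg]
  exact 𝒲.V.pt_toFiber _ _ _

theorem VBGroupoid.isSum_delta (c : 𝒲.coreSections φ) (g : A) :
    𝒲.V.IsSum
      (𝒲.total.mul (𝒲.V.pt (𝒲.base.one (φ.obj (K.tgt g))) (c.1 (K.tgt g)))
        (𝒲.V.pt (φ.map g) 0))
      (𝒲.total.mul (𝒲.V.pt (φ.map g) 0) (𝒲.total.inv
        (𝒲.V.pt (𝒲.base.one (φ.obj (K.src g))) (c.1 (K.src g)))))
      (𝒲.V.pt (φ.map g) (VBGroupoid.rightInv c g - VBGroupoid.leftInv c g)) :=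
  ⟨_, _, _, (VBGroupoid.pt_rightInv c g).symm, (VBGroupoid.pt_neg_leftInv c g).symm,
    by rw [sub_eq_add_neg]⟩

theorem SmoothVB.isSum_zero_left {B : SmoothMfd.{u}} {V : SmoothVB B} (p : V.Tot) (b : B)
    (h : p.proj = b) : V.IsSum (V.pt b 0) p p := by
  subst h
  exact ⟨p.proj, 0, p.snd, rfl, rfl, by rw [zero_add]⟩

theorem SmoothVB.isSum_zero_right {B : SmoothMfd.{u}} {V : SmoothVB B} (p : V.Tot) (b : B)
    (h : p.proj = b) : V.IsSum p (V.pt b 0) p := by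
  subst h
  exact ⟨p.proj, p.snd, 0, rfl, rfl, by rw [add_zero]⟩

theorem VBGroupoid.delta_src (c : 𝒲.coreSections φ) (g : A) :
    𝒲.total.src (𝒲.V.pt (φ.map g) (VBGroupoid.rightInv c g - VBGroupoid.leftInv c g)) =
      𝒲.total.tgt (𝒲.V.pt (𝒲.base.one (φ.obj (K.src g))) (c.1 (K.src g))) := by
  have h := 𝒲.src_lin.isSum (VBGroupoid.isSum_delta c g)
  rw [𝒲.total.src_mul _ _ (VBGroupoid.right_comp c g),
    𝒲.total.src_mul _ _ (VBGroupoid.left_comp c g), 𝒲.total.src_inv,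
    𝒲.src_lin.map_zero] at h
  refine h.unique (SmoothVB.isSum_zero_left _ _ ?_)
  rw [𝒲.tgt_lin.proj]
  exact (𝒲.base.tgt_one _).trans (φ.src_map g).symm

theorem VBGroupoid.delta_tgt (c : 𝒲.coreSections φ) (g : A) :
    𝒲.total.tgt (𝒲.V.pt (φ.map g) (VBGroupoid.rightInv c g - VBGroupoid.leftInv c g)) =
      𝒲.total.tgt (𝒲.V.pt (𝒲.base.one (φ.obj (K.tgt g))) (c.1 (K.tgt g))) := by
  have h := 𝒲.tgt_lin.isSum (VBGroupoid.isSum_delta c g)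
  rw [𝒲.total.tgt_mul _ _ (VBGroupoid.right_comp c g),
    𝒲.total.tgt_mul _ _ (VBGroupoid.left_comp c g), 𝒲.tgt_lin.map_zero (φ.map g)] at h
  refine h.unique (SmoothVB.isSum_zero_right _ _ ?_)
  rw [𝒲.tgt_lin.proj]
  exact (𝒲.base.tgt_one _).trans (φ.tgt_map g).symm

theorem VBGroupoid.delta_mul (C : B → 𝒲.V.Tot) (Z D : A → 𝒲.V.Tot)
    (hC : ∀ x, 𝒲.total.src (C x) = 𝒲.E.pt (φ.obj x) 0)
    (hC1 : ∀ x, (C x).proj = 𝒲.base.one (φ.obj x))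
    (hZ : ∀ g, Z g = 𝒲.V.pt (φ.map g) 0)
    (hD : ∀ g, 𝒲.V.IsSum (𝒲.total.mul (C (K.tgt g)) (Z g))
      (𝒲.total.mul (Z g) (𝒲.total.inv (C (K.src g)))) (D g))
    (ht : ∀ g, 𝒲.total.tgt (D g) = 𝒲.total.tgt (C (K.tgt g)))
    (g h : A) (hgh : K.src g = K.tgt h) : D (K.mul g h) = 𝒲.total.mul (D g) (D h) := by
  have hb : 𝒲.base.src (φ.map g) = 𝒲.base.tgt (φ.map h) := by rw [φ.src_map, φ.tgt_map, hgh]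
  have hZs : ∀ g, 𝒲.total.src (Z g) = 𝒲.E.pt (φ.obj (K.src g)) 0 := fun g => by
    rw [hZ, 𝒲.src_lin.map_zero, φ.src_map]
  have hZt : ∀ g, 𝒲.total.tgt (Z g) = 𝒲.E.pt (φ.obj (K.tgt g)) 0 := fun g => by
    rw [hZ, 𝒲.tgt_lin.map_zero, φ.tgt_map]
  have hZm : 𝒲.total.mul (Z g) (Z h) = Z (K.mul g h) := by
    rw [hZ, hZ, hZ, 𝒲.mul_zero hb, φ.map_mul g h hgh]
  have hR : ∀ g, 𝒲.total.src (C (K.tgt g)) = 𝒲.total.tgt (Z g) := fun g => by rw [hC, hZt]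
  have hL : ∀ g, 𝒲.total.src (Z g) = 𝒲.total.tgt (𝒲.total.inv (C (K.src g))) := fun g => by
    rw [𝒲.total.tgt_inv, hC, hZs]
  have hZZ : 𝒲.total.src (Z g) = 𝒲.total.tgt (Z h) := by rw [hZs, hZt, hgh]
  have hDp : ∀ g, (D g).proj = φ.map g := fun g => by
    obtain ⟨b, v, w, h1, h2, h3⟩ := hD g
    have h4 := congrArg TotalSpace.proj h1
    rw [𝒲.mul_proj (hR g), hC1, hZ] at h4
    rw [h3]
    change b = _
    rw [← φ.tgt_map] at h4
    exact h4.symm.trans (𝒲.base.one_mul _)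
  have hLp : ∀ g, (𝒲.total.mul (Z g) (𝒲.total.inv (C (K.src g)))).proj = φ.map g := fun g => by
    obtain ⟨b, v, w, h1, h2, h3⟩ := hD g
    rw [h2]
    have := hDp g
    rw [h3] at this
    exact this
  -- the product of the left invariant part at `g` with the right invariant part at `h`
  have hLR : 𝒲.total.mul (𝒲.total.mul (Z g) (𝒲.total.inv (C (K.src g))))
      (𝒲.total.mul (C (K.tgt h)) (Z h)) = 𝒲.total.mul (Z g) (Z h) := by
    have e1 : 𝒲.total.src (𝒲.total.inv (C (K.tgt h))) = 𝒲.total.tgt (C (K.tgt h)) :=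
      𝒲.total.src_inv _
    have hLg := hL g
    rw [hgh] at hLg
    rw [hgh, 𝒲.total.mul_assoc _ _ _ hLg
      (by rw [e1, 𝒲.total.tgt_mul _ _ (hR h)]), ← 𝒲.total.mul_assoc _ _ _ e1 (hR h),
      𝒲.total.inv_mul, hR, 𝒲.total.one_mul]
  -- the product of the left invariant part at `g` with `D h`
  have hLD : 𝒲.total.mul (𝒲.total.mul (Z g) (𝒲.total.inv (C (K.src g)))) (D h) =
      𝒲.total.mul (Z g) (𝒲.total.mul (Z h) (𝒲.total.inv (C (K.src h)))) := by
    have a1 := 𝒲.isSum_mul (SmoothVB.isSum_zero_right _ _ (hLp g)) (hD h)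
      (by rw [𝒲.total.src_mul _ _ (hL g), 𝒲.total.src_inv, hgh, 𝒲.total.tgt_mul _ _ (hR h)])
      (by rw [← hZ, 𝒲.total.tgt_mul _ _ (hL h), hZZ])
    rw [hLR, hZm] at a1
    refine a1.unique ?_
    rw [← hZ, ← 𝒲.total.mul_assoc _ _ _ hZZ (hL h), hZm]
    have key := SmoothVB.isSum_zero_left (𝒲.total.mul (Z (K.mul g h)) (𝒲.total.inv (C (K.src h))))
      (φ.map (K.mul g h)) (by
        have := hLp (K.mul g h)
        rwa [K.src_mul g h hgh] at this)
    rwa [← hZ] at key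
  have a2 := 𝒲.isSum_mul (hD g) (SmoothVB.isSum_zero_left _ _ (hDp h))
    (by rw [← hZ, 𝒲.total.src_mul _ _ (hR g), hZZ])
    (by rw [𝒲.total.src_mul _ _ (hL g), 𝒲.total.src_inv, ht, hgh])
  rw [hLD, ← hZ, 𝒲.total.mul_assoc _ _ _ (hR g) hZZ,
    ← 𝒲.total.mul_assoc _ _ _ hZZ (hL h), hZm] at a2
  have a3 := hD (K.mul g h)
  rw [K.tgt_mul g h hgh, K.src_mul g h hgh] at a3
  exact a3.unique a2

theorem VBGroupoid.delta_mem (c : 𝒲.coreSections φ) :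
    (fun g => VBGroupoid.rightInv c g - VBGroupoid.leftInv c g) ∈ 𝒲.multSections φ := by
  refine 𝒲.exists_hom φ _
    (fun x => 𝒲.total.tgt (𝒲.V.pt (𝒲.base.one (φ.obj x)) (c.1 x))) ?_
    (VBGroupoid.delta_src c) (VBGroupoid.delta_tgt c) ?_
  · have hz := 𝒲.V.smooth_zero φ.smooth_map
    have hR : ContMDiff (𝓡 A.dim) 𝒲.V.model ∞
        (fun g => 𝒲.V.pt (φ.map g) (VBGroupoid.rightInv c g)) := by
      have h1 := c.2.1.comp K.submersion_tgt.contMDiff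
      refine ((𝒲.total.smooth_mul.comp_contMDiff (h1.prodMk hz)
        (VBGroupoid.right_comp c))).congr fun g => ?_
      exact VBGroupoid.pt_rightInv c g
    have hL : ContMDiff (𝓡 A.dim) 𝒲.V.model ∞
        (fun g => 𝒲.V.pt (φ.map g) (- VBGroupoid.leftInv c g)) := by
      have h1 := 𝒲.total.smooth_inv.comp (c.2.1.comp K.submersion_src.contMDiff)
      refine ((𝒲.total.smooth_mul.comp_contMDiff (hz.prodMk h1)
        (VBGroupoid.left_comp c))).congr fun g => ?_
      exact VBGroupoid.pt_neg_leftInv c g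
    have := 𝒲.V.smooth_add hR hL
    simpa only [sub_eq_add_neg] using this
  · exact VBGroupoid.delta_mul (φ := φ) (fun x => 𝒲.V.pt (𝒲.base.one (φ.obj x)) (c.1 x))
      (fun g => 𝒲.V.pt (φ.map g) 0)
      (fun g => 𝒲.V.pt (φ.map g) (VBGroupoid.rightInv c g - VBGroupoid.leftInv c g))
      c.2.2 (fun _ => rfl) (fun _ => rfl) (VBGroupoid.isSum_delta c)
      (VBGroupoid.delta_tgt c)

theorem VBGroupoid.rightInv_add (c d : 𝒲.coreSections φ) (g : A) :
    VBGroupoid.rightInv (c + d) g = VBGroupoid.rightInv c g + VBGroupoid.rightInv d g := by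
  have h := 𝒲.isSum_mul ⟨_, c.1 (K.tgt g), d.1 (K.tgt g), rfl, rfl, rfl⟩
    (SmoothVB.isSum_zero_left (𝒲.V.pt (φ.map g) 0) _ rfl)
    (VBGroupoid.right_comp c g) (VBGroupoid.right_comp d g)
  rw [← VBGroupoid.pt_rightInv, ← VBGroupoid.pt_rightInv] at h
  exact 𝒲.V.pt_inj ((VBGroupoid.pt_rightInv (c + d) g).trans (h.unique ⟨_, _, _, rfl, rfl, rfl⟩))

theorem VBGroupoid.rightInv_smul (a : ℝ) (c : 𝒲.coreSections φ) (g : A) :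
    VBGroupoid.rightInv (a • c) g = a • VBGroupoid.rightInv c g := by
  have h := 𝒲.isSmul_mul (a := a) (p' := 𝒲.V.pt (φ.map g) 0) (r' := 𝒲.V.pt (φ.map g) 0)
    ⟨_, c.1 (K.tgt g), rfl, rfl⟩ ⟨_, 0, rfl, by rw [smul_zero]⟩ (VBGroupoid.right_comp c g)
  rw [← VBGroupoid.pt_rightInv] at h
  exact 𝒲.V.pt_inj ((VBGroupoid.pt_rightInv (a • c) g).trans (h.unique ⟨_, _, rfl, rfl⟩))

theorem VBGroupoid.leftInv_add (c d : 𝒲.coreSections φ) (g : A) :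
    VBGroupoid.leftInv (c + d) g = VBGroupoid.leftInv c g + VBGroupoid.leftInv d g := by
  have h := 𝒲.isSum_mul (SmoothVB.isSum_zero_left (𝒲.V.pt (φ.map g) 0) _ rfl)
    (𝒲.inv_lin.isSum ⟨_, c.1 (K.src g), d.1 (K.src g), rfl, rfl, rfl⟩)
    (VBGroupoid.left_comp c g) (VBGroupoid.left_comp d g)
  rw [← VBGroupoid.pt_neg_leftInv, ← VBGroupoid.pt_neg_leftInv] at h
  have := 𝒲.V.pt_inj
    ((VBGroupoid.pt_neg_leftInv (c + d) g).trans (h.unique ⟨_, _, _, rfl, rfl, rfl⟩))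
  rw [← neg_add, neg_inj] at this
  exact this

theorem VBGroupoid.leftInv_smul (a : ℝ) (c : 𝒲.coreSections φ) (g : A) :
    VBGroupoid.leftInv (a • c) g = a • VBGroupoid.leftInv c g := by
  have h := 𝒲.isSmul_mul (a := a) (p := 𝒲.V.pt (φ.map g) 0) (r := 𝒲.V.pt (φ.map g) 0)
    ⟨_, 0, rfl, by rw [smul_zero]⟩ (𝒲.inv_lin.isSmul ⟨_, c.1 (K.src g), rfl, rfl⟩)
    (VBGroupoid.left_comp c g)
  rw [← VBGroupoid.pt_neg_leftInv] at h
  have := 𝒲.V.pt_inj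
    ((VBGroupoid.pt_neg_leftInv (a • c) g).trans (h.unique ⟨_, _, rfl, rfl⟩))
  rw [smul_neg, neg_inj] at this
  exact this

variable (𝒲 φ)

/-- The complex of multiplicative sections of `φ^*𝒲`: core sections in degree `0`, multiplicative
sections in degree `1`, and `δ c = c^r - c^l`. -/
def VBGroupoid.multComplexAlong : TwoTermComplex.{u} where
  X0 := 𝒲.coreSections φ
  X1 := 𝒲.multSections φ
  d :=
    { toFun := fun c => ⟨fun g => VBGroupoid.rightInv c g - VBGroupoid.leftInv c g,
        VBGroupoid.delta_mem c⟩
      map_add' := fun c d => by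
        ext g
        change _ = (VBGroupoid.rightInv c g - VBGroupoid.leftInv c g) +
          (VBGroupoid.rightInv d g - VBGroupoid.leftInv d g)
        simp only [VBGroupoid.rightInv_add, VBGroupoid.leftInv_add]
        abel
      map_smul' := fun a c => by
        ext g
        change _ = a • (VBGroupoid.rightInv c g - VBGroupoid.leftInv c g)
        simp only [VBGroupoid.rightInv_smul, VBGroupoid.leftInv_smul, smul_sub] }

end Along

/-- The complex of multiplicative sections of a VB-groupoid. -/
def VBGroupoid.multComplex (𝒱 : VBGroupoid.{u}) : TwoTermComplex.{u} :=
  𝒱.multComplexAlong (LieGroupoidHom.id 𝒱.base)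

section ChainMaps

variable {A B : SmoothMfd.{u}} {K : LieGroupoid (𝓡 A.dim) (𝓡 B.dim) A B} (𝒲 : VBGroupoid.{u})
  (φ : LieGroupoidHom K 𝒲.base)

/-- Pullback of core sections. -/
def VBGroupoid.pullCore :
    𝒲.coreSections (LieGroupoidHom.id 𝒲.base) →ₗ[ℝ] 𝒲.coreSections φ where
  toFun d := ⟨fun x => d.1 (φ.obj x), d.2.1.comp φ.smooth_obj, fun x => d.2.2 (φ.obj x)⟩
  map_add' _ _ := rfl
  map_smul' _ _ := rfl

/-- Pullback of multiplicative sections. -/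
def VBGroupoid.pullMult :
    𝒲.multSections (LieGroupoidHom.id 𝒲.base) →ₗ[ℝ] 𝒲.multSections φ where
  toFun σ := ⟨fun g => σ.1 (φ.map g), by
    obtain ⟨F, hF⟩ := σ.2
    exact ⟨F.comp φ, fun g => hF (φ.map g)⟩⟩
  map_add' _ _ := rfl
  map_smul' _ _ := rfl

/-- The chain map `φ^*` from the complex of `𝒲` to the complex of `φ^*𝒲` which pulls back
sections along `φ`. -/
def VBGroupoid.pull : (𝒲.multComplex).Hom (𝒲.multComplexAlong φ) where
  f0 := 𝒲.pullCore φ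
  f1 := 𝒲.pullMult φ
  comm := fun (d : 𝒲.coreSections (LieGroupoidHom.id 𝒲.base)) => by
    have key : ∀ x y, x = y → 𝒲.V.pt (𝒲.base.one x) (d.1 x) = 𝒲.V.pt (𝒲.base.one y) (d.1 y) := by
      rintro x _ rfl
      rfl
    refine Subtype.ext (funext fun g => 𝒲.V.pt_inj (b := φ.map g) ?_)
    have h1 := VBGroupoid.isSum_delta d (φ.map g)
    have h2 := VBGroupoid.isSum_delta (𝒲.pullCore φ d) g
    have e1 : 𝒲.V.pt (𝒲.base.one (𝒲.base.tgt (φ.map g))) (d.1 (𝒲.base.tgt (φ.map g))) =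
        𝒲.V.pt (𝒲.base.one (φ.obj (K.tgt g))) ((𝒲.pullCore φ d).1 (K.tgt g)) :=
      key _ _ (φ.tgt_map g)
    have e2 : 𝒲.V.pt (𝒲.base.one (𝒲.base.src (φ.map g))) (d.1 (𝒲.base.src (φ.map g))) =
        𝒲.V.pt (𝒲.base.one (φ.obj (K.src g))) ((𝒲.pullCore φ d).1 (K.src g)) :=
      key _ _ (φ.src_map g)
    rw [← e1, ← e2] at h2
    exact h1.unique h2

end ChainMaps

section Push

variable {𝒱 𝒲 : VBGroupoid.{u}} (Φ : VBGroupoidHom 𝒱 𝒲)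

theorem VBGroupoidHom.pushCore_proj (x : 𝒱.M) (c : 𝒱.V.fiber (𝒱.base.one x)) :
    (Φ.total.map (𝒱.V.pt (𝒱.base.one x) c)).proj = 𝒲.base.one (Φ.base.obj x) := by
  rw [Φ.map_lin.proj]
  exact Φ.base.map_one x

/-- Composition of core sections with `Φ`. -/
def VBGroupoidHom.pushCore :
    𝒱.coreSections (LieGroupoidHom.id 𝒱.base) →ₗ[ℝ] 𝒲.coreSections Φ.base where
  toFun c := ⟨fun x => 𝒲.V.toFiber (Φ.total.map (𝒱.V.pt (𝒱.base.one x) (c.1 x)))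
      (𝒲.base.one (Φ.base.obj x)) (Φ.pushCore_proj x (c.1 x)), by
    refine ⟨(Φ.total.smooth_map.comp c.2.1).congr fun x => 𝒲.V.pt_toFiber _ _ _, fun x => ?_⟩
    rw [𝒲.V.pt_toFiber, Φ.total.src_map]
    exact (congrArg Φ.total.obj (c.2.2 x)).trans (Φ.obj_lin.map_zero x)⟩
  map_add' c d := by
    refine Subtype.ext (funext fun x => 𝒲.V.pt_inj ((𝒲.V.pt_toFiber _ _ (Φ.pushCore_proj x _)).trans ?_))
    have h := Φ.map_lin.isSum ⟨_, c.1 x, d.1 x, rfl, rfl, rfl⟩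
    exact h.unique ⟨_, _, _, (𝒲.V.pt_toFiber _ _ (Φ.pushCore_proj x (c.1 x))).symm,
      (𝒲.V.pt_toFiber _ _ (Φ.pushCore_proj x (d.1 x))).symm, rfl⟩
  map_smul' a c := by
    refine Subtype.ext (funext fun x => 𝒲.V.pt_inj ((𝒲.V.pt_toFiber _ _ (Φ.pushCore_proj x _)).trans ?_))
    have h := Φ.map_lin.isSmul (a := a) ⟨_, c.1 x, rfl, rfl⟩
    exact h.unique ⟨_, _, (𝒲.V.pt_toFiber _ _ (Φ.pushCore_proj x (c.1 x))).symm, rfl⟩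

/-- Composition of multiplicative sections with `Φ`. -/
def VBGroupoidHom.pushMult :
    𝒱.multSections (LieGroupoidHom.id 𝒱.base) →ₗ[ℝ] 𝒲.multSections Φ.base where
  toFun σ := ⟨fun g => 𝒲.V.toFiber (Φ.total.map (𝒱.V.pt g (σ.1 g))) (Φ.base.map g)
      (Φ.map_lin.proj _), by
    obtain ⟨F, hF⟩ := σ.2
    refine ⟨Φ.total.comp F, fun g => ?_⟩
    rw [𝒲.V.pt_toFiber]
    exact congrArg Φ.total.map (hF g)⟩
  map_add' σ τ := by
    refine Subtype.ext (funext fun g => 𝒲.V.pt_inj ((𝒲.V.pt_toFiber _ _ (Φ.map_lin.proj (𝒱.V.pt g _))).trans ?_))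
    have h := Φ.map_lin.isSum ⟨g, σ.1 g, τ.1 g, rfl, rfl, rfl⟩
    exact h.unique ⟨_, _, _, (𝒲.V.pt_toFiber _ _ (Φ.map_lin.proj (𝒱.V.pt g (σ.1 g)))).symm,
      (𝒲.V.pt_toFiber _ _ (Φ.map_lin.proj (𝒱.V.pt g (τ.1 g)))).symm, rfl⟩
  map_smul' a σ := by
    refine Subtype.ext (funext fun g => 𝒲.V.pt_inj ((𝒲.V.pt_toFiber _ _ (Φ.map_lin.proj (𝒱.V.pt g _))).trans ?_))
    have h := Φ.map_lin.isSmul (a := a) ⟨g, σ.1 g, rfl, rfl⟩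
    exact h.unique ⟨_, _, (𝒲.V.pt_toFiber _ _ (Φ.map_lin.proj (𝒱.V.pt g (σ.1 g)))).symm, rfl⟩

/-- The chain map from the complex of `𝒱` to the complex of `φ^*𝒲`, where `φ` is the map of base
groupoids underlying `Φ`, induced by the canonical morphism `𝒱 → φ^*𝒲`. -/
def VBGroupoidHom.push : (𝒱.multComplex).Hom (𝒲.multComplexAlong Φ.base) where
  f0 := Φ.pushCore
  f1 := Φ.pushMult
  comm := fun (c : 𝒱.coreSections (LieGroupoidHom.id 𝒱.base)) => by
    refine Subtype.ext (funext fun g => 𝒲.V.pt_inj (b := Φ.base.map g) ?_)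
    refine (𝒲.V.pt_toFiber _ _ (Φ.map_lin.proj (𝒱.V.pt g _))).trans ?_
    have h1 := Φ.map_lin.isSum (VBGroupoid.isSum_delta c g)
    have h2 := VBGroupoid.isSum_delta (Φ.pushCore c) g
    have hc : ∀ x, 𝒲.V.pt (𝒲.base.one (Φ.base.obj x)) ((Φ.pushCore c).1 x) =
        Φ.total.map (𝒱.V.pt (𝒱.base.one x) (c.1 x)) := fun x =>
      𝒲.V.pt_toFiber _ _ (Φ.pushCore_proj x (c.1 x))
    rw [Φ.total.map_mul _ _ (VBGroupoid.right_comp c g),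
      Φ.total.map_mul _ _ (VBGroupoid.left_comp c g), Φ.total.map_inv,
      Φ.map_lin.map_zero] at h1
    rw [hc, hc] at h2
    exact h1.unique h2

end Push

end

/-! A weak equivalence enters only through its consequences for smooth families of arrows, collected
in `LieGroupoidHom.IsSmoothEquivalence`.  The inverse function theorem turns the surjectivity of the
differential in essential surjectivity into smooth local sections `y ↦ (γ y : φ (ξ y) → y)`, and the
injectivity of the differential of `g ↦ (φ g, src g, tgt g)`, together with this map being an
embedding, into the fact that an arrow depends smoothly on parameters as soon as its image and its
endpoints do.  These properties pass from a VB-Morita map to its base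
(`VBGroupoidHom.isSmoothEquivalence_base`).

A multiplicative section is a functor, and a core section `c` is a family of arrows `c x : 0 → ∂ c x`
over units.  In these terms `δ c` is the zero section conjugated by `c`
(`VBGroupoid.pt_delta`), and, by linearity, conjugating a multiplicative section by the arrows
`1 + c x` adds `δ c` to it (`VBGroupoid.eq_add_delta`).  So degree one cohomology classifies functors
up to natural isomorphism over the identity, and degree zero consists of natural automorphisms of the
zero functor; what has to be shown is that composing with an equivalence on either side does not
change functors up to isomorphism.

Both chain maps, `push` from the complex of `𝒱` and `pull` from the complex of `𝒲` to the complex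
along `φ`, are treated in the same way: it is enough that their mapping cones are exact
(`TwoTermComplex.Hom.bijective_of_exact_cone`).

* For `push`, full faithfulness of `Φ` lifts core sections and functors
  (`VBGroupoidHom.push_exact_left`).  For surjectivity, a functor `τ` has to be made isomorphic to one
  whose objects are in the image of `Φ`.  The isomorphisms exist locally by essential surjectivity and
  are glued by a partition of unity, which is possible as all conditions on them are linear
  (`VBGroupoidHom.exists_arrow`, `VBGroupoidHom.push_exact_right`).
* For `pull`, core sections descend because an arrow `φ x → y` is unique up to arrows of `𝒱`
  (`VBGroupoid.pull_exact_left`).  For surjectivity, a functor `τ` along `φ` has to be extended over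
  the target of `φ`.  One needs vectors `Ω k x` over the arrows `k` with source `φ x`, equivariant for
  the right translation by `τ`.  Locally they are obtained by lifting vectors through the source map,
  which is surjective on fibres (`VBGroupoid.exists_lift`), and again a partition of unity glues them
  (`VBGroupoid.exists_equivariant`).  Then `h ↦ Ω (h k) x · (Ω k x)⁻¹` is the extension, up to
  conjugation by the arrows `Ω 1 x` (`VBGroupoid.pull_exact_right`). -/

noncomputable section

/-! ### Consequences of the inverse function theorem -/

/-- A smooth map with surjective differential at `x₀` has a smooth local right inverse through
`x₀`. -/
theorem exists_smooth_rightInverse {E F : Type*} [NormedAddCommGroup E] [NormedSpace ℝ E]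
    [NormedAddCommGroup F] [NormedSpace ℝ F] [FiniteDimensional ℝ F] {f : E → F} {x₀ : E}
    (hf : ∀ᶠ x in 𝓝 x₀, ContDiffAt ℝ ∞ f x)
    (hs : Function.Surjective (fderiv ℝ f x₀)) :
    ∃ r : F → E, r (f x₀) = x₀ ∧ ∀ᶠ y in 𝓝 (f x₀), ContDiffAt ℝ ∞ r y ∧ f (r y) = y := by
  have : CompleteSpace F := FiniteDimensional.complete ℝ F
  obtain ⟨A₀, hA₀⟩ := (fderiv ℝ f x₀ : E →ₗ[ℝ] F).exists_rightInverse_of_surjective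
    (LinearMap.range_eq_top.2 hs)
  set A : F →L[ℝ] E := LinearMap.toContinuousLinearMap A₀ with hA
  have hDA : (fderiv ℝ f x₀).comp A = ContinuousLinearMap.id ℝ F := by
    ext v
    exact LinearMap.congr_fun hA₀ v
  set g : F → E := fun v => x₀ + A v with hg
  have hgs : ∀ v, ContDiffAt ℝ ∞ g v := fun v => (contDiff_const.add A.contDiff).contDiffAt
  have hg0 : g 0 = x₀ := by simp [hg]
  have hgt : Filter.Tendsto g (𝓝 0) (𝓝 x₀) := by
    have := (hgs 0).continuousAt.tendsto
    rwa [hg0] at this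
  have hFs : ∀ᶠ v in 𝓝 (0 : F), ContDiffAt ℝ ∞ (f ∘ g) v :=
    (hgt.eventually hf).mono fun v hv => hv.comp v (hgs v)
  have hF0 : ContDiffAt ℝ ∞ (f ∘ g) 0 := hFs.self_of_nhds
  have hgd : HasFDerivAt g A 0 := by
    simpa [hg] using (A.hasFDerivAt (x := (0 : F))).const_add x₀
  have hFd : HasFDerivAt (f ∘ g) ((ContinuousLinearEquiv.refl ℝ F : F ≃L[ℝ] F) : F →L[ℝ] F) 0 := by
    have hfd : HasFDerivAt f (fderiv ℝ f x₀) (g 0) := by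
      rw [hg0]
      exact (hf.self_of_nhds.differentiableAt (by simp)).hasFDerivAt
    have := hfd.comp 0 hgd
    rw [hDA] at this
    exact this
  have hn : (∞ : WithTop ℕ∞) ≠ 0 := by simp
  set e := hF0.toOpenPartialHomeomorph (f ∘ g) hFd hn with he
  have hec : (e : F → F) = f ∘ g := rfl
  have h0 : (0 : F) ∈ e.source := hF0.mem_toOpenPartialHomeomorph_source hFd hn
  have hex : e 0 = f x₀ := by rw [hec, Function.comp_apply, hg0]
  have ht : f x₀ ∈ e.target := hex ▸ e.map_source h0
  have hinv : ∀ᶠ v in 𝓝 (0 : F), fderiv ℝ (f ∘ g) v ∈ range ((↑) : (F ≃L[ℝ] F) → F →L[ℝ] F) := by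
    have hc : ContinuousAt (fderiv ℝ (f ∘ g)) 0 :=
      (hF0.fderiv_right (m := 0) (by simp)).continuousAt
    refine hc.eventually ?_
    rw [hFd.fderiv]
    exact ContinuousLinearEquiv.nhds _
  have hsymm : Filter.Tendsto e.symm (𝓝 (f x₀)) (𝓝 0) := by
    have h1 := (e.continuousAt_symm ht).tendsto
    have h2 : e.symm (f x₀) = 0 := by rw [← hex, e.left_inv h0]
    rwa [h2] at h1
  refine ⟨fun y => g (e.symm y), ?_, ?_⟩
  · change g (e.symm (f x₀)) = x₀
    rw [← hex, e.left_inv h0, hg0]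
  · filter_upwards [e.open_target.mem_nhds ht, hsymm.eventually hinv, hsymm.eventually hFs]
      with y hy ⟨B, hB⟩ hy'
    refine ⟨(hgs _).comp y (e.contDiffAt_symm hy (f₀' := B) ?_ hy'), e.right_inv hy⟩
    rw [hB]
    exact (hy'.differentiableAt (by simp)).hasFDerivAt

/-- A smooth map with injective differential at `x₀` has a local left inverse that is smooth at
`f x₀`. -/
theorem exists_smooth_leftInverse {E F : Type*} [NormedAddCommGroup E] [NormedSpace ℝ E]
    [FiniteDimensional ℝ E] [NormedAddCommGroup F] [NormedSpace ℝ F] [FiniteDimensional ℝ F]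
    {f : E → F} {x₀ : E} (hf : ContDiffAt ℝ ∞ f x₀)
    (hi : Function.Injective (fderiv ℝ f x₀)) :
    ∃ r : F → E, ContDiffAt ℝ ∞ r (f x₀) ∧ ∀ᶠ x in 𝓝 x₀, r (f x) = x := by
  have : CompleteSpace E := FiniteDimensional.complete ℝ E
  obtain ⟨B₀, hB₀⟩ := (fderiv ℝ f x₀ : E →ₗ[ℝ] F).exists_leftInverse_of_injective
    (LinearMap.ker_eq_bot.2 hi)
  set B : F →L[ℝ] E := LinearMap.toContinuousLinearMap B₀ with hB
  have hBD : B.comp (fderiv ℝ f x₀) = ContinuousLinearMap.id ℝ E := by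
    ext v
    exact LinearMap.congr_fun hB₀ v
  have hF : ContDiffAt ℝ ∞ (B ∘ f) x₀ := B.contDiff.contDiffAt.comp x₀ hf
  have hn : (∞ : WithTop ℕ∞) ≠ 0 := by simp
  have hFd : HasFDerivAt (B ∘ f) ((ContinuousLinearEquiv.refl ℝ E : E ≃L[ℝ] E) : E →L[ℝ] E) x₀ := by
    have := B.hasFDerivAt.comp x₀ (hf.differentiableAt hn).hasFDerivAt
    rw [hBD] at this
    exact this
  refine ⟨hF.localInverse hFd hn ∘ B,
    ContDiffAt.comp (f x₀) (hF.to_localInverse hFd hn) B.contDiff.contDiffAt, ?_⟩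
  have h0 := hF.mem_toOpenPartialHomeomorph_source hFd hn
  filter_upwards [(hF.toOpenPartialHomeomorph (B ∘ f) hFd hn).open_source.mem_nhds h0] with x hx
  exact (hF.toOpenPartialHomeomorph (B ∘ f) hFd hn).left_inv hx

section Manifold

variable {EX HX X EY HY Y : Type*}
  [NormedAddCommGroup EX] [NormedSpace ℝ EX] [TopologicalSpace HX]
  [NormedAddCommGroup EY] [NormedSpace ℝ EY] [TopologicalSpace HY]
  {I : ModelWithCorners ℝ EX HX} {J : ModelWithCorners ℝ EY HY}
  [TopologicalSpace X] [ChartedSpace HX X] [TopologicalSpace Y] [ChartedSpace HY Y]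

theorem ModelWithCorners.fderiv_eq (I : ModelWithCorners ℝ EX HX) [I.Boundaryless] {F : EX → EY}
    {D : EX →L[ℝ] EY} {z : EX} (h : HasFDerivWithinAt F D (range I) z) : fderiv ℝ F z = D := by
  rw [I.range_eq_univ, hasFDerivWithinAt_univ] at h
  exact h.fderiv

/-- A smooth map of manifolds with surjective differential at `x₀` has a smooth local right
inverse through `x₀`. -/
theorem exists_contMDiff_rightInverse [I.Boundaryless] [J.Boundaryless]
    [IsManifold I ∞ X] [IsManifold J ∞ Y] [FiniteDimensional ℝ EY] {f : X → Y} {x₀ : X}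
    (hf : ∀ᶠ x in 𝓝 x₀, ContMDiffAt I J ∞ f x)
    (hs : Function.Surjective (mfderiv I J f x₀)) :
    ∃ r : Y → X, r (f x₀) = x₀ ∧ ∀ᶠ y in 𝓝 (f x₀), ContMDiffAt J I ∞ r y ∧ f (r y) = y := by
  set F := writtenInExtChartAt I J x₀ f with hF
  have hf0 := hf.self_of_nhds
  have hsymm : Filter.Tendsto (extChartAt I x₀).symm (𝓝 (extChartAt I x₀ x₀)) (𝓝 x₀) := by
    have := (continuousAt_extChartAt_symm (I := I) x₀).tendsto
    rwa [extChartAt_to_inv] at this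
  have hYn : ∀ᶠ x in 𝓝 x₀, f x ∈ (extChartAt J (f x₀)).source :=
    hf0.continuousAt.eventually (extChartAt_source_mem_nhds (I := J) (f x₀))
  have hFs : ∀ᶠ z in 𝓝 (extChartAt I x₀ x₀), ContDiffAt ℝ ∞ F z := by
    filter_upwards [hsymm.eventually hf, hsymm.eventually hYn,
      extChartAt_target_mem_nhds (I := I) x₀]
      with z h1 h2 h3
    rw [← contMDiffAt_iff_contDiffAt]
    refine ContMDiffAt.comp z (contMDiffAt_extChartAt' (by simpa using h2)) ?_
    exact h1.comp z ((contMDiffOn_extChartAt_symm x₀).contMDiffAt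
      ((isOpen_extChartAt_target x₀).mem_nhds h3))
  have hFd : fderiv ℝ F (extChartAt I x₀ x₀) = mfderiv I J f x₀ :=
    I.fderiv_eq (hf0.mdifferentiableAt (by simp)).hasMFDerivAt.2
  have hF0 : F (extChartAt I x₀ x₀) = extChartAt J (f x₀) (f x₀) := by
    simp [hF, writtenInExtChartAt]
  obtain ⟨r, hr0, hr⟩ := exists_smooth_rightInverse hFs (by rw [hFd]; exact hs)
  rw [hF0] at hr0 hr
  have hrc : Filter.Tendsto r (𝓝 (extChartAt J (f x₀) (f x₀))) (𝓝 (extChartAt I x₀ x₀)) := by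
    have := hr.self_of_nhds.1.continuousAt.tendsto
    rwa [hr0] at this
  have hch : Filter.Tendsto (extChartAt J (f x₀)) (𝓝 (f x₀)) (𝓝 (extChartAt J (f x₀) (f x₀))) :=
    (continuousAt_extChartAt (I := J) (f x₀)).tendsto
  refine ⟨fun y => (extChartAt I x₀).symm (r (extChartAt J (f x₀) y)), ?_, ?_⟩
  · simp only [hr0, extChartAt_to_inv]
  · filter_upwards [hch.eventually hr,
      (hrc.comp hch).eventually (extChartAt_target_mem_nhds (I := I) x₀),
      (hsymm.comp (hrc.comp hch)).eventually hYn, extChartAt_source_mem_nhds (I := J) (f x₀)]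
      with y h1 h2 h3 h4
    refine ⟨?_, ?_⟩
    · refine ContMDiffAt.comp y ((contMDiffOn_extChartAt_symm x₀).contMDiffAt
        ((isOpen_extChartAt_target x₀).mem_nhds h2)) ?_
      exact (contMDiffAt_iff_contDiffAt.2 h1.1).comp y (contMDiffAt_extChartAt' (by simpa using h4))
    · exact (extChartAt J (f x₀)).injOn h3 h4 h1.2

/-- A smooth map of manifolds with injective differential at `x₀` has a local left inverse that is
smooth at `f x₀`. -/
theorem exists_contMDiff_leftInverse [I.Boundaryless] [J.Boundaryless]
    [IsManifold I ∞ X] [IsManifold J ∞ Y] [FiniteDimensional ℝ EX] [FiniteDimensional ℝ EY]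
    {f : X → Y} {x₀ : X} (hf : ContMDiffAt I J ∞ f x₀)
    (hi : Function.Injective (mfderiv I J f x₀)) :
    ∃ r : Y → X, ContMDiffAt J I ∞ r (f x₀) ∧ ∀ᶠ x in 𝓝 x₀, r (f x) = x := by
  set F := writtenInExtChartAt I J x₀ f with hF
  have hFs : ContDiffAt ℝ ∞ F (extChartAt I x₀ x₀) := by
    have := (contMDiffAt_iff.1 hf).2
    rwa [I.range_eq_univ, contDiffWithinAt_univ] at this
  have hFd : fderiv ℝ F (extChartAt I x₀ x₀) = mfderiv I J f x₀ :=
    I.fderiv_eq (hf.mdifferentiableAt (by simp)).hasMFDerivAt.2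
  have hF0 : F (extChartAt I x₀ x₀) = extChartAt J (f x₀) (f x₀) := by
    simp [hF, writtenInExtChartAt]
  obtain ⟨r, hr1, hr2⟩ := exists_smooth_leftInverse hFs (by rw [hFd]; exact hi)
  rw [hF0] at hr1
  have hr0 : r (extChartAt J (f x₀) (f x₀)) = extChartAt I x₀ x₀ := by
    rw [← hF0]
    exact hr2.self_of_nhds
  refine ⟨fun y => (extChartAt I x₀).symm (r (extChartAt J (f x₀) y)), ?_, ?_⟩
  · refine ContMDiffAt.comp (f x₀) ((contMDiffOn_extChartAt_symm x₀).contMDiffAt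
        ((isOpen_extChartAt_target x₀).mem_nhds ?_)) ?_
    · rw [hr0]
      exact mem_extChartAt_target x₀
    · exact (contMDiffAt_iff_contDiffAt.2 hr1).comp _ contMDiffAt_extChartAt
  · filter_upwards [(continuousAt_extChartAt (I := I) x₀).eventually hr2,
      extChartAt_source_mem_nhds (I := I) x₀] with x h1 h2
    rw [hF, writtenInExtChartAt] at h1
    simp only [Function.comp_apply, (extChartAt I x₀).left_inv h2] at h1
    rw [h1, (extChartAt I x₀).left_inv h2]

/-- Near any point `x₀`, a submersion `f` admits a smooth family of local sections: `R (x, y)` lies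
over `y`, and the section `R (x, ·)` passes through `x`. -/
theorem Manifold.IsSubmersion.exists_sections [I.Boundaryless] [J.Boundaryless]
    [IsManifold I ∞ X] [IsManifold J ∞ Y] {f : X → Y}
    (hf : Manifold.IsSubmersion I J ∞ f) (x₀ : X) :
    ∃ R : X × Y → X, ∀ᶠ p in 𝓝 (x₀, f x₀), ContMDiffAt (I.prod J) I ∞ R p ∧
      f (R p) = p.2 ∧ (f p.1 = p.2 → R p = p.1) := by
  have hsm := hf.contMDiff
  obtain ⟨C, _, _, hf⟩ := hf.isSubmersionAt x₀
  set a := hf.domChart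
  set b := hf.codChart
  set e := hf.equiv
  have ha : x₀ ∈ a.source := hf.mem_domChart_source
  have hb : f x₀ ∈ b.source := hf.mem_codChart_source
  have hw : ∀ z ∈ (a.extend I).target, b.extend J (f ((a.extend I).symm z)) = (e z).1 :=
    fun z hz => hf.writtenInCharts hz
  have hpoint : ∀ x ∈ a.source, b.extend J (f x) = (e (a.extend I x)).1 := fun x hx => by
    have := hw (a.extend I x) ((a.extend I).map_source (by rwa [a.extend_source]))
    rwa [(a.extend I).left_inv (by rwa [a.extend_source])] at this
  set Z : X × Y → EX := fun p => e.symm (b.extend J p.2, (e (a.extend I p.1)).2) with hZ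
  have hZ0 : ∀ p : X × Y, p.1 ∈ a.source → f p.1 = p.2 → Z p = a.extend I p.1 := fun p h1 h2 => by
    rw [hZ]
    simp only
    rw [← h2, hpoint _ h1, Prod.mk.eta, e.symm_apply_apply]
  have hopen : IsOpen (a.extend I).target := a.isOpen_extend_target
  have hZs : ∀ p : X × Y, p.1 ∈ a.source → p.2 ∈ b.source →
      ContMDiffAt (I.prod J) 𝓘(ℝ, EX) ∞ Z p := fun p h1 h2 => by
    have h3 : ContMDiffAt (I.prod J) 𝓘(ℝ, EX) ∞ (fun p : X × Y => a.extend I p.1) p :=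
      ContMDiffAt.comp p (a.contMDiffAt_extend hf.domChart_mem_maximalAtlas h1) contMDiffAt_fst
    have h4 : ContMDiffAt (I.prod J) 𝓘(ℝ, EY) ∞ (fun p : X × Y => b.extend J p.2) p :=
      ContMDiffAt.comp p (b.contMDiffAt_extend hf.codChart_mem_maximalAtlas h2) contMDiffAt_snd
    have h5 : ContMDiffAt (I.prod J) 𝓘(ℝ, C) ∞ (fun p : X × Y => (e (a.extend I p.1)).2) p :=
      ((ContinuousLinearMap.snd ℝ EY C).comp (e : EX →L[ℝ] EY × C)).contMDiff.contMDiffAt.comp p h3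
    exact (e.symm : EY × C →L[ℝ] EX).contMDiff.contMDiffAt.comp p (h4.prodMk_space h5)
  refine ⟨fun p => (a.extend I).symm (Z p), ?_⟩
  have e1 : ∀ᶠ p : X × Y in 𝓝 (x₀, f x₀), p.1 ∈ a.source :=
    continuousAt_fst.eventually (a.open_source.mem_nhds ha)
  have e2 : ∀ᶠ p : X × Y in 𝓝 (x₀, f x₀), p.2 ∈ b.source :=
    continuousAt_snd.eventually (b.open_source.mem_nhds hb)
  have e3 : ∀ᶠ p : X × Y in 𝓝 (x₀, f x₀), Z p ∈ (a.extend I).target := by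
    refine (hZs (x₀, f x₀) ha hb).continuousAt.eventually (hopen.mem_nhds ?_)
    rw [hZ0 _ ha rfl]
    exact (a.extend I).map_source (by rwa [a.extend_source])
  filter_upwards [e1, e2, e3] with p h1 h2 h3
  refine ⟨?_, ?_, fun h4 => ?_⟩
  · exact ContMDiffAt.comp p ((contMDiffOn_extend_symm hf.domChart_mem_maximalAtlas).contMDiffAt
      (by rw [← a.extend_target']; exact hopen.mem_nhds h3)) (hZs p h1 h2)
  · have h5 := hw _ h3
    have h6 : (e (Z p)).1 = b.extend J p.2 := by rw [hZ]; simp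
    rw [h6] at h5
    refine (b.extend J).injOn ?_ (by rwa [b.extend_source]) h5
    rw [b.extend_source]
    refine hf.source_subset_preimage_source ?_
    have := (a.extend I).map_target h3
    rwa [a.extend_source] at this
  · rw [hZ0 p h1 h4, (a.extend I).left_inv (by rwa [a.extend_source])]

end Manifold

/-! ### Calculus of arrows in a Lie groupoid -/

section Algebra

variable {EA HA EB HB A B : Type*}
  [NormedAddCommGroup EA] [NormedSpace ℝ EA] [TopologicalSpace HA]
  [NormedAddCommGroup EB] [NormedSpace ℝ EB] [TopologicalSpace HB]
  {I : ModelWithCorners ℝ EA HA} {J : ModelWithCorners ℝ EB HB}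
  [TopologicalSpace A] [ChartedSpace HA A] [TopologicalSpace B] [ChartedSpace HB B]
  (K : LieGroupoid I J A B)

namespace LieGroupoid

theorem inv_mul_cancel_left {g h : A} (hgh : K.src g = K.tgt h) :
    K.mul (K.inv g) (K.mul g h) = h := by
  rw [← K.mul_assoc _ _ _ (K.src_inv g) hgh, K.inv_mul, hgh, K.one_mul]

theorem mul_inv_cancel_right {g h : A} (hgh : K.src g = K.tgt h) :
    K.mul (K.mul g h) (K.inv h) = g := by
  rw [K.mul_assoc _ _ _ hgh (K.tgt_inv h).symm, K.mul_inv, ← hgh, K.mul_one]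

theorem mul_inv_cancel_left {g h : A} (hgh : K.tgt g = K.tgt h) :
    K.mul g (K.mul (K.inv g) h) = h := by
  rw [← K.mul_assoc _ _ _ (K.tgt_inv g).symm ((K.src_inv g).trans hgh), K.mul_inv, hgh, K.one_mul]

theorem inv_mul_cancel_right {g h : A} (hgh : K.src g = K.src h) :
    K.mul (K.mul g (K.inv h)) h = g := by
  rw [K.mul_assoc _ _ _ (hgh.trans (K.tgt_inv h).symm) (K.src_inv h), K.inv_mul, ← hgh, K.mul_one]

theorem mul_left_cancel {g h k : A} (h1 : K.src g = K.tgt h) (h2 : K.src g = K.tgt k)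
    (e : K.mul g h = K.mul g k) : h = k := by
  rw [← K.inv_mul_cancel_left h1, e, K.inv_mul_cancel_left h2]

theorem eq_inv_of_mul {g h : A} (hgh : K.src g = K.tgt h) (e : K.mul g h = K.one (K.src h)) :
    g = K.inv h := by
  rw [← K.mul_inv_cancel_right hgh, e, ← K.tgt_inv, K.one_mul]

theorem mul_inv_rev {g h : A} (hgh : K.src g = K.tgt h) :
    K.inv (K.mul g h) = K.mul (K.inv h) (K.inv g) := by
  have h1 : K.src (K.inv h) = K.tgt (K.inv g) := by rw [K.src_inv, K.tgt_inv, hgh]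
  refine (K.eq_inv_of_mul ?_ ?_).symm
  · rw [K.src_mul _ _ h1, K.src_inv, K.tgt_mul _ _ hgh]
  · rw [K.mul_assoc _ _ _ h1 (by rw [K.src_inv, K.tgt_mul _ _ hgh]), K.inv_mul_cancel_left hgh,
      K.inv_mul, K.src_mul _ _ hgh]

theorem one_mul' {x : B} {g : A} (h : K.tgt g = x) : K.mul (K.one x) g = g := by
  rw [← h, K.one_mul]

theorem mul_one' {x : B} {g : A} (h : K.src g = x) : K.mul g (K.one x) = g := by
  rw [← h, K.mul_one]

variable {EP HP P : Type*} [NormedAddCommGroup EP] [NormedSpace ℝ EP] [TopologicalSpace HP]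
  {IP : ModelWithCorners ℝ EP HP} [TopologicalSpace P] [ChartedSpace HP P]

theorem contMDiffAt_mul {f g : P → A} {p : P} (hf : ContMDiffAt IP I ∞ f p)
    (hg : ContMDiffAt IP I ∞ g p) (h : ∀ᶠ q in 𝓝 p, K.src (f q) = K.tgt (g q)) :
    ContMDiffAt IP I ∞ (fun q => K.mul (f q) (g q)) p := by
  have h1 : ContMDiffWithinAt IP (I.prod I) ∞ (fun q => (f q, g q))
      {q | K.src (f q) = K.tgt (g q)} p := (hf.prodMk hg).contMDiffWithinAt
  have h2 := (K.smooth_mul (f p, g p) h.self_of_nhds).comp p h1 (fun q hq => hq)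
  exact h2.contMDiffAt h

theorem contMDiffAt_inv {f : P → A} {p : P} (hf : ContMDiffAt IP I ∞ f p) :
    ContMDiffAt IP I ∞ (fun q => K.inv (f q)) p :=
  (K.smooth_inv _).comp p hf

theorem contMDiffAt_src {f : P → A} {p : P} (hf : ContMDiffAt IP I ∞ f p) :
    ContMDiffAt IP J ∞ (fun q => K.src (f q)) p :=
  (K.submersion_src.contMDiff _).comp p hf

theorem contMDiffAt_tgt {f : P → A} {p : P} (hf : ContMDiffAt IP I ∞ f p) :
    ContMDiffAt IP J ∞ (fun q => K.tgt (f q)) p :=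
  (K.submersion_tgt.contMDiff _).comp p hf

theorem contMDiffAt_one {f : P → B} {p : P} (hf : ContMDiffAt IP J ∞ f p) :
    ContMDiffAt IP I ∞ (fun q => K.one (f q)) p :=
  (K.smooth_one _).comp p hf

end LieGroupoid

end Algebra

/-! ### Weak equivalences and smooth families of arrows -/

section Equivalence

variable {EA HA EB HB EA' HA' EB' HB' : Type*}
  [NormedAddCommGroup EA] [NormedSpace ℝ EA] [TopologicalSpace HA]
  [NormedAddCommGroup EB] [NormedSpace ℝ EB] [TopologicalSpace HB]
  [NormedAddCommGroup EA'] [NormedSpace ℝ EA'] [TopologicalSpace HA']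
  [NormedAddCommGroup EB'] [NormedSpace ℝ EB'] [TopologicalSpace HB']
  {I : ModelWithCorners ℝ EA HA} {J : ModelWithCorners ℝ EB HB}
  {I' : ModelWithCorners ℝ EA' HA'} {J' : ModelWithCorners ℝ EB' HB'}
  {A B A' B' : Type*} [TopologicalSpace A] [ChartedSpace HA A]
  [TopologicalSpace B] [ChartedSpace HB B]
  [TopologicalSpace A'] [ChartedSpace HA' A']
  [TopologicalSpace B'] [ChartedSpace HB' B']
  {K : LieGroupoid I J A B} {K' : LieGroupoid I' J' A' B'}

/-- The consequences of being a weak equivalence in terms of smooth maps only: `φ` is essentially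
surjective by means of smooth local sections `y ↦ (γ y, ξ y)`, where `γ y` is an arrow from
`φ (ξ y)` to `y`; it is fully faithful; and an arrow of `K` depends smoothly on parameters as soon
as its image, its source and its target do. -/
structure LieGroupoidHom.IsSmoothEquivalence (φ : LieGroupoidHom K K') : Prop where
  local_section : ∀ y₀ : B', ∃ (γ : B' → A') (ξ : B' → B), ∀ᶠ y in 𝓝 y₀,
    ContMDiffAt J' I' ∞ γ y ∧ ContMDiffAt J' J ∞ ξ y ∧
      K'.src (γ y) = φ.obj (ξ y) ∧ K'.tgt (γ y) = y
  full : ∀ (h : A') (x y : B), K'.src h = φ.obj x → K'.tgt h = φ.obj y →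
    ∃ g : A, φ.map g = h ∧ K.src g = x ∧ K.tgt g = y
  faithful : ∀ g g' : A, φ.map g = φ.map g' → K.src g = K.src g' → K.tgt g = K.tgt g' → g = g'
  contMDiffAt_of_comp : ∀ (P : SmoothMfd.{u}) (g : P → A) (p : P),
    ContMDiffAt (𝓡 P.dim) I' ∞ (fun q => φ.map (g q)) p →
    ContMDiffAt (𝓡 P.dim) J ∞ (fun q => K.src (g q)) p →
    ContMDiffAt (𝓡 P.dim) J ∞ (fun q => K.tgt (g q)) p → ContMDiffAt (𝓡 P.dim) I ∞ g p

/-- The pairs `(h, x)` with `src h = φ x` are parametrized, near one of them, by arbitrary pairs,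
with the help of local sections of `src`.  So the condition that `(h, x) ↦ tgt h` is a submersion
becomes one on a map defined on an open subset of the product. -/
theorem LieGroupoidHom.IsWeakEquivalence.exists_local_section
    [J.Boundaryless] [I'.Boundaryless] [J'.Boundaryless]
    [IsManifold J ∞ B] [IsManifold I' ∞ A'] [IsManifold J' ∞ B'] [FiniteDimensional ℝ EB']
    {φ : LieGroupoidHom K K'} (hφ : φ.IsWeakEquivalence) (y₀ : B') :
    ∃ (γ : B' → A') (ξ : B' → B), ∀ᶠ y in 𝓝 y₀,
    ContMDiffAt J' I' ∞ γ y ∧ ContMDiffAt J' J ∞ ξ y ∧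
      K'.src (γ y) = φ.obj (ξ y) ∧ K'.tgt (γ y) = y := by
  obtain ⟨h₀, x₀, hs, rfl⟩ := hφ.ess_surj y₀
  obtain ⟨R, hR⟩ := K'.submersion_src.exists_sections h₀
  -- `Q` replaces an arbitrary pair `(h, x)` near `(h₀, x₀)` by an arrow with source `φ x`
  set Q : A' × B → A' := fun p => R (p.1, φ.obj p.2) with hQ
  have hin : ∀ p, ContMDiffAt (I'.prod J) (I'.prod J') ∞
      (fun p : A' × B => (p.1, φ.obj p.2)) p := fun p =>
    contMDiffAt_fst.prodMk ((φ.smooth_obj _).comp p contMDiffAt_snd)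
  have hev : ∀ᶠ p in 𝓝 (h₀, x₀), ContMDiffAt (I'.prod J') I' ∞ R (p.1, φ.obj p.2) ∧
      K'.src (Q p) = φ.obj p.2 := by
    have h1 := (hin (h₀, x₀)).continuousAt
    have h2 : ∀ᶠ p in 𝓝 (h₀, φ.obj x₀), ContMDiffAt (I'.prod J') I' ∞ R p ∧
      K'.src (R p) = p.2 := by
      rw [← hs]
      exact hR.mono fun p hp => ⟨hp.1, hp.2.1⟩
    exact h1.eventually h2
  have hQs : ∀ᶠ p in 𝓝 (h₀, x₀), ContMDiffAt (I'.prod J) I' ∞ Q p :=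
    hev.mono fun p hp => hp.1.comp p (hin p)
  have hQ0 : Q (h₀, x₀) = h₀ := by
    have := hR.self_of_nhds.2.2 rfl
    rw [hQ]
    simpa [hs] using this
  have hT : ∀ᶠ p in 𝓝 (h₀, x₀), ContMDiffAt (I'.prod J) J' ∞ (fun p => K'.tgt (Q p)) p :=
    hQs.mono fun p hp => K'.contMDiffAt_tgt hp
  have hsurj : Function.Surjective
      (mfderiv (I'.prod J) J' (fun p => K'.tgt (Q p)) (h₀, x₀)) := by
    obtain ⟨DR, hDR⟩ : ∃ D : EA' × EB' →L[ℝ] EA',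
        HasMFDerivAt (I'.prod J') I' R (h₀, K'.src h₀) D :=
      ⟨_, (hR.self_of_nhds.1.mdifferentiableAt (by simp)).hasMFDerivAt⟩
    obtain ⟨Ds, hDs⟩ : ∃ D : EA' →L[ℝ] EB', D = mfderiv I' J' K'.src h₀ := ⟨_, rfl⟩
    obtain ⟨Dt, hDt⟩ : ∃ D : EA' →L[ℝ] EB', D = mfderiv I' J' K'.tgt h₀ := ⟨_, rfl⟩
    obtain ⟨Do, hDo⟩ : ∃ D : EB →L[ℝ] EB', D = mfderiv J J' φ.obj x₀ := ⟨_, rfl⟩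
    have hs' : HasMFDerivAt I' J' K'.src h₀ Ds := by
      rw [hDs]
      exact ((K'.submersion_src.contMDiff h₀).mdifferentiableAt (by simp)).hasMFDerivAt
    have ht' : HasMFDerivAt I' J' K'.tgt h₀ Dt := by
      rw [hDt]
      exact ((K'.submersion_tgt.contMDiff h₀).mdifferentiableAt (by simp)).hasMFDerivAt
    have ho' : HasMFDerivAt J J' φ.obj x₀ Do := by
      rw [hDo]
      exact ((φ.smooth_obj x₀).mdifferentiableAt (by simp)).hasMFDerivAt
    -- `R (h, src h) = h` determines `DR` on the graph of the differential of `src`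
    have hid : ∀ ξ : EA', DR (ξ, Ds ξ) = ξ := by
      have h1 : HasMFDerivAt I' I' (R ∘ fun h => (h, K'.src h)) h₀
          (DR.comp ((ContinuousLinearMap.id ℝ EA').prod Ds)) :=
        HasMFDerivAt.comp h₀ hDR ((hasMFDerivAt_id h₀).prodMk hs')
      have h2 : (R ∘ fun h => (h, K'.src h)) =ᶠ[𝓝 h₀] _root_.id := by
        have h3 : ContinuousAt (fun h => (h, K'.src h)) h₀ :=
          continuousAt_id.prodMk (K'.submersion_src.contMDiff h₀).continuousAt
        exact (h3.eventually hR).mono fun h hh => hh.2.2 rfl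
      have h4 := hasMFDerivAt_unique (h1.congr_of_eventuallyEq h2.symm) (hasMFDerivAt_id h₀)
      intro ξ
      exact DFunLike.congr_fun h4 ξ
    have hDR' : HasMFDerivAt (I'.prod J') I' R (h₀, φ.obj x₀) DR := hs ▸ hDR
    have hQ1 : HasMFDerivAt (I'.prod J) I' Q (h₀, x₀)
        (DR.comp ((ContinuousLinearMap.fst ℝ EA' EB).prod
          (Do.comp (ContinuousLinearMap.snd ℝ EA' EB)))) :=
      HasMFDerivAt.comp (h₀, x₀) hDR' ((hasMFDerivAt_fst (h₀, x₀)).prodMk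
        (HasMFDerivAt.comp (h₀, x₀) ho' (hasMFDerivAt_snd (h₀, x₀))))
    have ht'' : HasMFDerivAt I' J' K'.tgt (Q (h₀, x₀)) Dt := hQ0.symm ▸ ht'
    have hT1 := (HasMFDerivAt.comp (h₀, x₀) ht'' hQ1).mfderiv
    intro w
    obtain ⟨ξ, v, h1, h2⟩ := hφ.ess_submersion h₀ x₀ hs (w : EB')
    have h3 : mfderiv I' J' K'.src h₀ ξ = (mfderiv J J' φ.obj x₀ v : EB') :=
      congrArg (fun p : TangentBundle J' B' => (p.2 : EB')) h1
    have h4 : Ds ξ = Do v := by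
      rw [hDs, hDo]
      exact h3
    have h5 : Dt ξ = (w : EB') := by
      rw [hDt]
      exact h2
    have h6 : Dt (DR (ξ, Do v)) = (w : EB') :=
      (congrArg Dt ((congrArg (fun b => DR ((ξ : EA'), b)) h4.symm).trans (hid ξ))).trans h5
    exact ⟨((ξ, v) : EA' × EB), (DFunLike.congr_fun hT1 ((ξ, v) : EA' × EB)).trans h6⟩
  obtain ⟨r, hr0, hr⟩ := exists_contMDiff_rightInverse hT hsurj
  simp only [hQ0] at hr0 hr
  have hrt : Filter.Tendsto r (𝓝 (K'.tgt h₀)) (𝓝 (h₀, x₀)) := by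
    have := hr.self_of_nhds.1.continuousAt.tendsto
    rwa [hr0] at this
  refine ⟨fun y => Q (r y), fun y => (r y).2, ?_⟩
  filter_upwards [hr, hrt.eventually hQs, hrt.eventually hev] with y h1 h2 h3
  exact ⟨h2.comp y h1.1, contMDiffAt_snd.comp y h1.1, h3.2, h1.2⟩

theorem LieGroupoidHom.IsWeakEquivalence.contMDiffAt_of_comp
    [I.Boundaryless] [J.Boundaryless] [I'.Boundaryless]
    [IsManifold I ∞ A] [IsManifold J ∞ B] [IsManifold I' ∞ A']
    [FiniteDimensional ℝ EA] [FiniteDimensional ℝ EB] [FiniteDimensional ℝ EA']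
    {φ : LieGroupoidHom K K'} (hφ : φ.IsWeakEquivalence) {EP HP P : Type*}
    [NormedAddCommGroup EP] [NormedSpace ℝ EP] [TopologicalSpace HP]
    {IP : ModelWithCorners ℝ EP HP} [TopologicalSpace P] [ChartedSpace HP P]
    {g : P → A} {p : P} (h1 : ContMDiffAt IP I' ∞ (fun q => φ.map (g q)) p)
    (h2 : ContMDiffAt IP J ∞ (fun q => K.src (g q)) p)
    (h3 : ContMDiffAt IP J ∞ (fun q => K.tgt (g q)) p) : ContMDiffAt IP I ∞ g p := by
  set j : A → A' × B × B := fun a => (φ.map a, K.src a, K.tgt a) with hj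
  have hjs : ∀ a, ContMDiffAt I (I'.prod (J.prod J)) ∞ j a := fun a =>
    (φ.smooth_map a).prodMk ((K.submersion_src.contMDiff a).prodMk (K.submersion_tgt.contMDiff a))
  have hjg : ContMDiffAt IP (I'.prod (J.prod J)) ∞ (j ∘ g) p := h1.prodMk (h2.prodMk h3)
  have hgc : ContinuousAt g p := hφ.ff_embedding.continuousAt_iff.2 hjg.continuousAt
  have hinj : Function.Injective (mfderiv I (I'.prod (J.prod J)) j (g p)) := by
    have c1 := ((φ.smooth_map (g p)).mdifferentiableAt (by simp)).hasMFDerivAt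
    have c2 := ((K.submersion_src.contMDiff (g p)).mdifferentiableAt (by simp)).hasMFDerivAt
    have c3 := ((K.submersion_tgt.contMDiff (g p)).mdifferentiableAt (by simp)).hasMFDerivAt
    have hd := (c1.prodMk (c2.prodMk c3)).mfderiv
    intro η η' he
    have e0 := (DFunLike.congr_fun hd η).symm.trans
      (he.trans (DFunLike.congr_fun hd η'))
    have e1 : mfderiv I I' φ.map (g p) η = mfderiv I I' φ.map (g p) η' :=
      congrArg (fun q : EA' × EB × EB => q.1) e0
    have e2 : mfderiv I J K.src (g p) η = mfderiv I J K.src (g p) η' :=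
      congrArg (fun q : EA' × EB × EB => q.2.1) e0
    have e3 : mfderiv I J K.tgt (g p) η = mfderiv I J K.tgt (g p) η' :=
      congrArg (fun q : EA' × EB × EB => q.2.2) e0
    have s1 : ∀ ζ : TangentBundle I A, tangentMap I' J' K'.src (tangentMap I I' φ.map ζ) =
        tangentMap J J' φ.obj (tangentMap I J K.src ζ) := fun ζ => by
      rw [← tangentMap_comp_at ζ ((K'.submersion_src.contMDiff _).mdifferentiableAt (by simp))
        ((φ.smooth_map _).mdifferentiableAt (by simp)),
        ← tangentMap_comp_at ζ ((φ.smooth_obj _).mdifferentiableAt (by simp))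
        ((K.submersion_src.contMDiff _).mdifferentiableAt (by simp))]
      exact congrArg (fun f => tangentMap I J' f ζ) (funext φ.src_map)
    have s2 : ∀ ζ : TangentBundle I A, tangentMap I' J' K'.tgt (tangentMap I I' φ.map ζ) =
        tangentMap J J' φ.obj (tangentMap I J K.tgt ζ) := fun ζ => by
      rw [← tangentMap_comp_at ζ ((K'.submersion_tgt.contMDiff _).mdifferentiableAt (by simp))
        ((φ.smooth_map _).mdifferentiableAt (by simp)),
        ← tangentMap_comp_at ζ ((φ.smooth_obj _).mdifferentiableAt (by simp))
        ((K.submersion_tgt.contMDiff _).mdifferentiableAt (by simp))]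
      exact congrArg (fun f => tangentMap I J' f ζ) (funext φ.tgt_map)
    have hu := (hφ.ff_tangent _ _ _ (s1 ⟨g p, η⟩) (s2 ⟨g p, η⟩)).unique (y₁ := ⟨g p, η⟩)
      (y₂ := ⟨g p, η'⟩) ⟨rfl, rfl, rfl⟩
      ⟨by simp only [tangentMap, e1], by simp only [tangentMap, e2], by simp only [tangentMap, e3]⟩
    exact congrArg (fun q : TangentBundle I A => (q.2 : EA)) hu
  obtain ⟨r, hr1, hr2⟩ := exists_contMDiff_leftInverse (hjs (g p)) hinj
  exact (ContMDiffAt.comp p hr1 hjg).congr_of_eventuallyEq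
    ((hgc.eventually hr2).mono fun q hq => hq.symm)

theorem LieGroupoidHom.IsWeakEquivalence.isSmoothEquivalence
    [I.Boundaryless] [J.Boundaryless] [I'.Boundaryless] [J'.Boundaryless]
    [IsManifold I ∞ A] [IsManifold J ∞ B] [IsManifold I' ∞ A'] [IsManifold J' ∞ B']
    [FiniteDimensional ℝ EA] [FiniteDimensional ℝ EB]
    [FiniteDimensional ℝ EA'] [FiniteDimensional ℝ EB']
    {φ : LieGroupoidHom K K'} (hφ : φ.IsWeakEquivalence) : φ.IsSmoothEquivalence.{u} where
  local_section := hφ.exists_local_section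
  full h x y hx hy := by
    have : (h, x, y) ∈ range (fun g : A => (φ.map g, K.src g, K.tgt g)) := by
      rw [hφ.ff_range]
      exact ⟨hx, hy⟩
    obtain ⟨g, hg⟩ := this
    simp only [Prod.mk.injEq] at hg
    exact ⟨g, hg⟩
  faithful g g' h1 h2 h3 := hφ.ff_embedding.injective (by simp only [h1, h2, h3])
  contMDiffAt_of_comp _ _ _ h1 h2 h3 := hφ.contMDiffAt_of_comp h1 h2 h3

end Equivalence

/-! ### Smooth sections along maps -/

namespace SmoothVB

variable {EP HP P : Type*} [NormedAddCommGroup EP] [NormedSpace ℝ EP] [TopologicalSpace HP]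
  {IP : ModelWithCorners ℝ EP HP} [TopologicalSpace P] [ChartedSpace HP P]
  {B : SmoothMfd.{u}} (V : SmoothVB B)

theorem contMDiffAt_proj {f : P → V.Tot} {p : P} (hf : ContMDiffAt IP V.model ∞ f p) :
    ContMDiffAt IP (𝓡 B.dim) ∞ (fun x => (f x).proj) p :=
  (Bundle.contMDiff_proj V.fiber _).comp p hf

theorem contMDiffAt_zero {f : P → B} {p : P} (hf : ContMDiffAt IP (𝓡 B.dim) ∞ f p) :
    ContMDiffAt IP V.model ∞ (fun x => V.pt (f x) 0) p :=
  (contMDiff_zeroSection ℝ V.fiber _).comp p hf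

variable {f : P → B} {s t : ∀ x, V.fiber (f x)} {p : P}

theorem contMDiffAt_add
    (hs : ContMDiffAt IP V.model ∞ (fun x => V.pt (f x) (s x)) p)
    (ht : ContMDiffAt IP V.model ∞ (fun x => V.pt (f x) (t x)) p) :
    ContMDiffAt IP V.model ∞ (fun x => V.pt (f x) (s x + t x)) p := by
  rw [contMDiffAt_totalSpace] at hs ht ⊢
  refine ⟨hs.1, (hs.2.add ht.2).congr_of_eventuallyEq ?_⟩
  have hU := hs.1.continuousAt.preimage_mem_nhds
    ((trivializationAt (EuclideanSpace ℝ (Fin V.rank)) V.fiber (f p)).open_baseSet.mem_nhds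
      (mem_baseSet_trivializationAt _ V.fiber (f p)))
  filter_upwards [hU] with x hx
  exact ((trivializationAt (EuclideanSpace ℝ (Fin V.rank)) V.fiber (f p)).linear ℝ hx).1 _ _

theorem contMDiffAt_smul {a : P → ℝ} (ha : ContMDiffAt IP 𝓘(ℝ, ℝ) ∞ a p)
    (hs : ContMDiffAt IP V.model ∞ (fun x => V.pt (f x) (s x)) p) :
    ContMDiffAt IP V.model ∞ (fun x => V.pt (f x) (a x • s x)) p := by
  rw [contMDiffAt_totalSpace] at hs ⊢
  refine ⟨hs.1, (ha.smul hs.2).congr_of_eventuallyEq ?_⟩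
  have hU := hs.1.continuousAt.preimage_mem_nhds
    ((trivializationAt (EuclideanSpace ℝ (Fin V.rank)) V.fiber (f p)).open_baseSet.mem_nhds
      (mem_baseSet_trivializationAt _ V.fiber (f p)))
  filter_upwards [hU] with x hx
  exact ((trivializationAt (EuclideanSpace ℝ (Fin V.rank)) V.fiber (f p)).linear ℝ hx).2 _ _

theorem contMDiffAt_sum {ι : Type*} (F : Finset ι) {s : ι → ∀ x, V.fiber (f x)}
    (hf : ContMDiffAt IP (𝓡 B.dim) ∞ f p)
    (hs : ∀ i ∈ F, ContMDiffAt IP V.model ∞ (fun x => V.pt (f x) (s i x)) p) :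
    ContMDiffAt IP V.model ∞ (fun x => V.pt (f x) (∑ i ∈ F, s i x)) p := by
  classical
  induction F using Finset.induction_on with
  | empty => simpa using V.contMDiffAt_zero hf
  | insert i F hi ih =>
    simp only [Finset.sum_insert hi]
    exact V.contMDiffAt_add (hs i (Finset.mem_insert_self i F))
      (ih fun j hj => hs j (Finset.mem_insert_of_mem hj))

/-- Local sections along `f`, each needed to be smooth only where its weight does not vanish, glue
to a smooth section along `f` by means of a partition of unity, pulled back along `q`. -/
theorem contMDiffAt_finsum {N : SmoothMfd.{u}} {ι : Type*}
    (ρ : SmoothPartitionOfUnity ι (𝓡 N.dim) N univ) {q : P → N} {s : ι → ∀ x, V.fiber (f x)}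
    (hf : ContMDiffAt IP (𝓡 B.dim) ∞ f p) (hq : ContMDiffAt IP (𝓡 N.dim) ∞ q p)
    (hs : ∀ i, q p ∈ tsupport (ρ i) → ContMDiffAt IP V.model ∞ (fun x => V.pt (f x) (s i x)) p) :
    ContMDiffAt IP V.model ∞ (fun x => V.pt (f x) (∑ᶠ i, ρ i (q x) • s i x)) p := by
  have h1 := V.contMDiffAt_sum (p := p) (ρ.fintsupport (q p)) (s := fun i x => ρ i (q x) • s i x) hf
    fun i hi => V.contMDiffAt_smul (((ρ i).contMDiff _).comp p hq)
      (hs i ((ρ.mem_fintsupport_iff (q p) i).1 hi))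
  refine h1.congr_of_eventuallyEq ?_
  filter_upwards [hq.continuousAt.eventually (ρ.eventually_finsupport_subset (q p))] with x hx
  rw [finsum_eq_sum_of_support_subset]
  intro i hi
  refine hx ((ρ.mem_finsupport (q x)).2 ?_)
  intro h
  exact hi (by simp only [h, zero_smul])

instance : T2Space V.Tot := by
  rw [t2_iff_nhds]
  intro x y hxy
  have hx : Filter.Tendsto (fun z : V.Tot => z.proj) (𝓝 x ⊓ 𝓝 y) (𝓝 x.proj) :=
    (FiberBundle.continuous_proj _ V.fiber).continuousAt.tendsto.mono_left inf_le_left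
  have hy : Filter.Tendsto (fun z : V.Tot => z.proj) (𝓝 x ⊓ 𝓝 y) (𝓝 y.proj) :=
    (FiberBundle.continuous_proj _ V.fiber).continuousAt.tendsto.mono_left inf_le_right
  have h := tendsto_nhds_unique hx hy
  set T := trivializationAt (EuclideanSpace ℝ (Fin V.rank)) V.fiber x.proj
  have mx : x ∈ T.source := FiberBundle.mem_trivializationAt_proj_source
  have my : y ∈ T.source := by
    rw [T.mem_source, ← h]
    exact mem_baseSet_trivializationAt _ V.fiber _
  exact T.injOn mx my (tendsto_nhds_unique
    ((T.continuousAt mx).tendsto.mono_left inf_le_left)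
    ((T.continuousAt my).tendsto.mono_left inf_le_right))

open Classical in
/-- The vector `p` in the fibre over `b`, with the junk value `0` if `p` does not lie over `b`. -/
def fib (V : SmoothVB B) (p : V.Tot) (b : B) : V.fiber b :=
  if h : p.proj = b then V.toFiber p b h else 0

theorem pt_fib {p : V.Tot} {b : B} (h : p.proj = b) : V.pt b (V.fib p b) = p := by
  rw [fib, dif_pos h, pt_toFiber]

end SmoothVB

/-! ### Equivalences of VB-groupoids -/

theorem VBGroupoidHom.IsVBMorita.isSmoothEquivalence {𝒱 𝒲 : VBGroupoid.{u}}
    {Φ : VBGroupoidHom 𝒱 𝒲} (hΦ : Φ.IsVBMorita) : Φ.total.IsSmoothEquivalence.{u} :=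
  LieGroupoidHom.IsWeakEquivalence.isSmoothEquivalence hΦ

/-- The base of a VB-groupoid sits inside it as the zero vectors, and is a quotient of it by the
bundle projection.  This transfers the properties of an equivalence to the base. -/
theorem VBGroupoidHom.isSmoothEquivalence_base {𝒱 𝒲 : VBGroupoid.{u}} {Φ : VBGroupoidHom 𝒱 𝒲}
    (hΦ : Φ.total.IsSmoothEquivalence.{u}) : Φ.base.IsSmoothEquivalence.{u} where
  local_section y₀ := by
    obtain ⟨γ, ξ, h⟩ := hΦ.local_section (𝒲.E.pt y₀ 0)
    have hz : ∀ y, ContMDiffAt (𝓡 𝒲.M.dim) 𝒲.E.model ∞ (fun y => 𝒲.E.pt y 0) y := fun y =>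
      𝒲.E.contMDiffAt_zero contMDiffAt_id
    refine ⟨fun y => (γ (𝒲.E.pt y 0)).proj, fun y => (ξ (𝒲.E.pt y 0)).proj, ?_⟩
    filter_upwards [(hz y₀).continuousAt.eventually h] with y hy
    refine ⟨𝒲.V.contMDiffAt_proj (hy.1.comp y (hz y)), 𝒱.E.contMDiffAt_proj (hy.2.1.comp y (hz y)),
      ?_, ?_⟩
    · rw [← 𝒲.src_lin.proj, hy.2.2.1, Φ.obj_lin.proj]
    · rw [← 𝒲.tgt_lin.proj, hy.2.2.2]
  full h x y hx hy := by
    obtain ⟨g, h1, h2, h3⟩ := hΦ.full (𝒲.V.pt h 0) (𝒱.E.pt x 0) (𝒱.E.pt y 0)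
      (by rw [𝒲.src_lin.map_zero, Φ.obj_lin.map_zero, hx])
      (by rw [𝒲.tgt_lin.map_zero, Φ.obj_lin.map_zero, hy])
    refine ⟨g.proj, ?_, ?_, ?_⟩
    · rw [← Φ.map_lin.proj, h1]
    · rw [← 𝒱.src_lin.proj, h2]
    · rw [← 𝒱.tgt_lin.proj, h3]
  faithful g g' h1 h2 h3 := by
    refine congrArg TotalSpace.proj (hΦ.faithful (𝒱.V.pt g 0) (𝒱.V.pt g' 0) ?_ ?_ ?_)
    · rw [Φ.map_lin.map_zero, Φ.map_lin.map_zero, h1]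
    · rw [𝒱.src_lin.map_zero, 𝒱.src_lin.map_zero, h2]
    · rw [𝒱.tgt_lin.map_zero, 𝒱.tgt_lin.map_zero, h3]
  contMDiffAt_of_comp P g p h1 h2 h3 := by
    have := hΦ.contMDiffAt_of_comp P (fun q => 𝒱.V.pt (g q) 0) p
      (by simp only [Φ.map_lin.map_zero]; exact 𝒲.V.contMDiffAt_zero h1)
      (by simp only [𝒱.src_lin.map_zero]; exact 𝒱.E.contMDiffAt_zero h2)
      (by simp only [𝒱.tgt_lin.map_zero]; exact 𝒱.E.contMDiffAt_zero h3)
    exact 𝒱.V.contMDiffAt_proj this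

/-! ### Lifting vectors through the source map -/

/-- In a VB-groupoid a vector at the source of an arrow lifts to the fibre over this arrow, smoothly
in parameters.  If `R (0_g, ·)` are local sections of the source map through the zero vectors `0_g`,
then the derivative at `ε = 0` of the curve `R (0_g, ε v)`, which starts at `0_g`, is a lift of `v`:
it is the limit of the vectors `ε⁻¹ R (0_g, ε v)`, whose source is `v`. -/
theorem VBGroupoid.exists_lift (𝒲 : VBGroupoid.{u}) {EP HP P : Type*} [NormedAddCommGroup EP]
    [NormedSpace ℝ EP] [TopologicalSpace HP] {IP : ModelWithCorners ℝ EP HP} [TopologicalSpace P]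
    [ChartedSpace HP P] [IsManifold IP ∞ P] {γ : P → 𝒲.G} {v : P → 𝒲.E.Tot} {p₀ : P}
    (hγ : ∀ᶠ p in 𝓝 p₀, ContMDiffAt IP (𝓡 𝒲.G.dim) ∞ γ p)
    (hv : ∀ᶠ p in 𝓝 p₀, ContMDiffAt IP 𝒲.E.model ∞ v p)
    (h : ∀ᶠ p in 𝓝 p₀, 𝒲.base.src (γ p) = (v p).proj) :
    ∃ ν : P → 𝒲.V.Tot, ∀ᶠ p in 𝓝 p₀, ContMDiffAt IP 𝒲.V.model ∞ ν p ∧ (ν p).proj = γ p ∧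
      𝒲.total.src (ν p) = v p := by
  obtain ⟨R, hR⟩ := 𝒲.total.submersion_src.exists_sections (𝒲.V.pt (γ p₀) 0)
  set ev : P × ℝ → 𝒲.E.Tot := fun z => 𝒲.E.pt (v z.1).proj (z.2 • (v z.1).snd) with hev
  set a : P × ℝ → 𝒲.V.Tot × 𝒲.E.Tot := fun z => (𝒲.V.pt (γ z.1) 0, ev z) with ha
  have hfst : Filter.Tendsto (Prod.fst : P × ℝ → P) (𝓝 (p₀, 0)) (𝓝 p₀) := continuousAt_fst
  have has : ∀ᶠ z : P × ℝ in 𝓝 (p₀, 0),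
      ContMDiffAt (IP.prod 𝓘(ℝ, ℝ)) (𝒲.V.model.prod 𝒲.E.model) ∞ a z := by
    filter_upwards [hfst.eventually hγ, hfst.eventually hv] with z h1 h2
    refine (𝒲.V.contMDiffAt_zero (h1.comp z contMDiffAt_fst)).prodMk ?_
    exact 𝒲.E.contMDiffAt_smul (f := fun z : P × ℝ => (v z.1).proj) (s := fun z => (v z.1).snd)
      contMDiffAt_snd (h2.comp z contMDiffAt_fst)
  have ha0 : a (p₀, 0) = (𝒲.V.pt (γ p₀) 0, 𝒲.total.src (𝒲.V.pt (γ p₀) 0)) := by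
    rw [𝒲.src_lin.map_zero, h.self_of_nhds]
    simp [ha, hev]
  rw [← ha0] at hR
  have hRa := has.self_of_nhds.continuousAt.eventually hR
  set c : P × ℝ → 𝒲.V.Tot := fun z => R (a z) with hc
  have hcs : ∀ᶠ z : P × ℝ in 𝓝 (p₀, 0), ContMDiffAt (IP.prod 𝓘(ℝ, ℝ)) 𝒲.V.model ∞ c z := by
    filter_upwards [has, hRa] with z h1 h2
    exact h2.1.comp z h1
  have hin : Filter.Tendsto (fun p : P => (p, (0 : ℝ))) (𝓝 p₀) (𝓝 (p₀, 0)) :=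
    (continuousAt_id.prodMk continuousAt_const)
  have hc0 : ∀ᶠ p in 𝓝 p₀, c (p, 0) = 𝒲.V.pt (γ p) 0 := by
    filter_upwards [hin.eventually hRa, h] with p h1 h2
    refine h1.2.2 ?_
    change 𝒲.total.src (𝒲.V.pt (γ p) 0) = 𝒲.E.pt (v p).proj ((0 : ℝ) • (v p).snd)
    rw [𝒲.src_lin.map_zero, h2, zero_smul]
  set T := trivializationAt (EuclideanSpace ℝ (Fin 𝒲.V.rank)) 𝒲.V.fiber (γ p₀) with hT
  have hγT : ∀ᶠ p in 𝓝 p₀, γ p ∈ T.baseSet := hγ.self_of_nhds.continuousAt.eventually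
    (T.open_baseSet.mem_nhds (mem_baseSet_trivializationAt _ 𝒲.V.fiber _))
  set l : P → ℝ → EuclideanSpace ℝ (Fin 𝒲.V.rank) := fun p ε => (T (c (p, ε))).2 with hl
  have hls : ∀ᶠ p in 𝓝 p₀, ContMDiffAt (IP.prod 𝓘(ℝ, ℝ)) 𝓘(ℝ, EuclideanSpace ℝ (Fin 𝒲.V.rank)) ∞
      (Function.uncurry l) (p, 0) := by
    filter_upwards [hin.eventually hcs, hc0, hγT] with p h1 h2 h3
    exact ((T.contMDiffAt_iff (by rw [T.mem_source, h2]; exact h3)).1 h1).2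
  have hl0 : ∀ᶠ p in 𝓝 p₀, l p 0 = 0 := by
    filter_upwards [hc0, hγT] with p h1 h2
    simp only [hl, h1]
    exact (T.linear ℝ h2).map_zero
  set D : P → EuclideanSpace ℝ (Fin 𝒲.V.rank) := fun p => deriv (l p) 0 with hD
  have hDs : ∀ᶠ p in 𝓝 p₀, ContMDiffAt IP 𝓘(ℝ, EuclideanSpace ℝ (Fin 𝒲.V.rank)) ∞ D p := by
    filter_upwards [hls] with p h1
    have h2 := ContMDiffAt.mfderiv (m := ∞) l (fun _ => (0 : ℝ)) h1 contMDiffAt_const (by simp)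
    have h3 : ContMDiffAt IP 𝓘(ℝ, ℝ →L[ℝ] EuclideanSpace ℝ (Fin 𝒲.V.rank)) ∞
        (fun x => fderiv ℝ (l x) 0) p := by
      have e : (fun x => mfderiv 𝓘(ℝ, ℝ) 𝓘(ℝ, EuclideanSpace ℝ (Fin 𝒲.V.rank)) (l x) 0) =
          fun x => fderiv ℝ (l x) 0 := funext fun x => mfderiv_eq_fderiv
      rw [← inTangentCoordinates_model_space (fun _ => (0 : ℝ)) (fun x => l x 0)
        (fun x => fderiv ℝ (l x) 0) p]
      exact e ▸ h2
    exact h3.clm_apply contMDiffAt_const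
  refine ⟨fun p => 𝒲.V.pt (γ p) (T.symm (γ p) (D p)), ?_⟩
  filter_upwards [hγ, hDs, hγT.eventually_nhds, hls, hl0, hin.eventually hcs, hc0,
    hin.eventually hRa.eventually_nhds] with p h1 h2 h3 h4 h5 h6 h7 h8
  have hb := h3.self_of_nhds
  have hTs : 𝒲.V.pt (γ p) (T.symm (γ p) (D p)) ∈ T.source := by rw [T.mem_source]; exact hb
  refine ⟨(T.contMDiffAt_iff (f := fun p => 𝒲.V.pt (γ p) (T.symm (γ p) (D p))) hTs).2
    ⟨h1, h2.congr_of_eventuallyEq (h3.mono fun x hx => ?_)⟩, rfl, ?_⟩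
  · simp only [T.apply_mk_symm hx]
  have hε : Filter.Tendsto (fun ε : ℝ => (p, ε)) (𝓝[≠] 0) (𝓝 (p, 0)) :=
    ContinuousAt.tendsto (f := fun ε : ℝ => (p, ε))
      (continuousAt_const.prodMk continuousAt_id) |>.mono_left nhdsWithin_le_nhds
  have hcp : Filter.Tendsto (fun ε : ℝ => (c (p, ε)).proj) (𝓝[≠] 0) (𝓝 (γ p)) := by
    have := ((FiberBundle.continuous_proj _ 𝒲.V.fiber).continuousAt.tendsto.comp
      h6.continuousAt.tendsto).comp hε
    rw [h7] at this
    exact this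
  have hlp : HasDerivAt (l p) (D p) 0 := by
    have h9 : ContMDiffAt 𝓘(ℝ, ℝ) 𝓘(ℝ, EuclideanSpace ℝ (Fin 𝒲.V.rank)) ∞ (l p) 0 :=
      ContMDiffAt.comp (f := fun ε : ℝ => (p, ε)) (g := Function.uncurry l) (0 : ℝ) h4
        (contMDiffAt_const.prodMk contMDiffAt_id)
    exact ((contMDiffAt_iff_contDiffAt.1 h9).differentiableAt (by simp)).hasDerivAt
  have hm : Filter.Tendsto
      (fun ε : ℝ => 𝒲.V.pt (c (p, ε)).proj (ε⁻¹ • (c (p, ε)).snd)) (𝓝[≠] 0)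
      (𝓝 (𝒲.V.pt (γ p) (T.symm (γ p) (D p)))) := by
    rw [T.tendsto_nhds_iff hTs]
    refine ⟨hcp, ?_⟩
    rw [T.apply_mk_symm hb]
    refine (hasDerivAt_iff_tendsto_slope_zero.1 hlp).congr' ?_
    filter_upwards [hcp.eventually (T.open_baseSet.mem_nhds hb)] with ε hε'
    rw [h5, sub_zero, zero_add]
    exact ((T.linear ℝ hε').map_smul _ _).symm
  have hsm := (𝒲.total.submersion_src.contMDiff.continuous.tendsto _).comp hm
  refine tendsto_nhds_unique hsm (tendsto_const_nhds.congr' ?_)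
  filter_upwards [hε.eventually h8, self_mem_nhdsWithin] with ε h9 h10
  have h11 : 𝒲.E.IsSmul ε⁻¹ (ev (p, ε))
      (𝒲.total.src (𝒲.V.pt (c (p, ε)).proj (ε⁻¹ • (c (p, ε)).snd))) := by
    have := 𝒲.src_lin.isSmul (a := ε⁻¹) ⟨(c (p, ε)).proj, (c (p, ε)).snd, rfl, rfl⟩
    rwa [show 𝒲.V.pt (c (p, ε)).proj (c (p, ε)).snd = c (p, ε) from rfl, h9.2.1] at this
  refine SmoothVB.IsSmul.unique ⟨(v p).proj, ε • (v p).snd, rfl, ?_⟩ h11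
  rw [smul_smul, inv_mul_cancel₀ h10, one_smul]

/-! ### Quasi-isomorphisms of 2-term complexes -/

/-- The two hypotheses say that the mapping cone `C⁰ → C¹ ⊕ D⁰ → D¹` of `f` is exact. -/
theorem TwoTermComplex.Hom.bijective_of_exact_cone {C D : TwoTermComplex.{u}} (f : C.Hom D)
    (h1 : ∀ (σ : C.X1) (c' : D.X0), f.f1 σ = D.d c' → ∃! c : C.X0, C.d c = σ ∧ f.f0 c = c')
    (h2 : ∀ τ : D.X1, ∃ (σ : C.X1) (c' : D.X0), f.f1 σ = τ + D.d c') :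
    Function.Bijective f.mapH0 ∧ Function.Bijective f.mapH1 := by
  refine ⟨⟨?_, ?_⟩, ?_, ?_⟩
  · rw [injective_iff_map_eq_zero]
    rintro ⟨c, hc⟩ h
    have hc' : f.f0 c = 0 := congrArg Subtype.val h
    refine Subtype.ext ((h1 0 0 (by rw [map_zero, map_zero])).unique ⟨hc, hc'⟩ ?_)
    exact ⟨map_zero _, map_zero _⟩
  · rintro ⟨c', hc'⟩
    rw [LinearMap.mem_ker] at hc'
    obtain ⟨c, ⟨hc, hcc⟩, -⟩ := h1 0 c' (by rw [map_zero, hc'])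
    exact ⟨⟨c, hc⟩, Subtype.ext hcc⟩
  · rw [injective_iff_map_eq_zero]
    intro a ha
    obtain ⟨σ, rfl⟩ := Submodule.Quotient.mk_surjective _ a
    have ha' : (Submodule.Quotient.mk (f.f1 σ) : D.H1) = 0 := ha
    rw [Submodule.Quotient.mk_eq_zero] at ha' ⊢
    obtain ⟨c', hc'⟩ := ha'
    obtain ⟨c, ⟨hc, -⟩, -⟩ := h1 σ c' hc'.symm
    exact ⟨c, hc⟩
  · intro b
    obtain ⟨τ, rfl⟩ := Submodule.Quotient.mk_surjective _ b
    obtain ⟨σ, c', h⟩ := h2 τ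
    refine ⟨Submodule.Quotient.mk σ, ?_⟩
    change (Submodule.Quotient.mk (f.f1 σ) : D.H1) = _
    rw [Submodule.Quotient.eq]
    exact ⟨c', by rw [h, add_sub_cancel_left]⟩

/-! ### Multiplicative sections and core sections as maps to the total space -/

namespace VBGroupoid

section Along

variable {A B : SmoothMfd.{u}} {K : LieGroupoid (𝓡 A.dim) (𝓡 B.dim) A B} {𝒲 : VBGroupoid.{u}}
  {φ : LieGroupoidHom K 𝒲.base}

theorem exists_multSection (S : A → 𝒲.V.Tot) (e : B → 𝒲.E.Tot) (hp : ∀ g, (S g).proj = φ.map g)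
    (hS : ∀ g, ContMDiffAt (𝓡 A.dim) 𝒲.V.model ∞ S g)
    (hs : ∀ g, 𝒲.total.src (S g) = e (K.src g)) (ht : ∀ g, 𝒲.total.tgt (S g) = e (K.tgt g))
    (hm : ∀ g h, K.src g = K.tgt h → S (K.mul g h) = 𝒲.total.mul (S g) (S h)) :
    ∃ σ : 𝒲.multSections φ, ∀ g, 𝒲.V.pt (φ.map g) (σ.1 g) = S g := by
  have hpt : ∀ g, 𝒲.V.pt (φ.map g) (𝒲.V.toFiber (S g) (φ.map g) (hp g)) = S g := fun g =>
    𝒲.V.pt_toFiber _ _ _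
  refine ⟨⟨fun g => 𝒲.V.toFiber (S g) (φ.map g) (hp g), 𝒲.exists_hom φ _ e ?_ ?_ ?_ ?_⟩, hpt⟩
  · simp only [hpt]
    exact hS
  · simpa only [hpt] using hs
  · simpa only [hpt] using ht
  · simpa only [hpt] using hm

theorem exists_coreSection (C : B → 𝒲.V.Tot) (hp : ∀ x, (C x).proj = 𝒲.base.one (φ.obj x))
    (hC : ∀ x, ContMDiffAt (𝓡 B.dim) 𝒲.V.model ∞ C x)
    (hs : ∀ x, 𝒲.total.src (C x) = 𝒲.E.pt (φ.obj x) 0) :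
    ∃ c : 𝒲.coreSections φ, ∀ x, 𝒲.V.pt (𝒲.base.one (φ.obj x)) (c.1 x) = C x := by
  have hpt : ∀ x, 𝒲.V.pt (𝒲.base.one (φ.obj x)) (𝒲.V.toFiber (C x) _ (hp x)) = C x := fun g =>
    𝒲.V.pt_toFiber _ _ _
  refine ⟨⟨fun x => 𝒲.V.toFiber (C x) _ (hp x), ?_, ?_⟩, hpt⟩
  · simp only [hpt]
    exact hC
  · simpa only [hpt] using hs

/-- A core section `c` is a family of arrows `c x : 0 → ∂ c x` over units, and conjugating the zero
section with them gives `δ c`. -/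
theorem pt_delta (c : 𝒲.coreSections φ) (g : A) :
    𝒲.V.pt (φ.map g) (rightInv c g - leftInv c g) =
      𝒲.total.mul (𝒲.total.mul (𝒲.V.pt (𝒲.base.one (φ.obj (K.tgt g))) (c.1 (K.tgt g)))
        (𝒲.V.pt (φ.map g) 0))
        (𝒲.total.inv (𝒲.V.pt (𝒲.base.one (φ.obj (K.src g))) (c.1 (K.src g)))) := by
  have hone : 𝒲.V.pt (𝒲.base.one (φ.obj (K.src g))) 0 =
      𝒲.total.one (𝒲.E.pt (φ.obj (K.src g)) 0) := (𝒲.one_lin.map_zero _).symm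
  have hsr : 𝒲.total.src (𝒲.total.mul
      (𝒲.V.pt (𝒲.base.one (φ.obj (K.tgt g))) (c.1 (K.tgt g))) (𝒲.V.pt (φ.map g) 0)) =
      𝒲.E.pt (φ.obj (K.src g)) 0 := by
    rw [𝒲.total.src_mul _ _ (right_comp c g), 𝒲.src_lin.map_zero, φ.src_map]
  have h := 𝒲.isSum_mul
    (SmoothVB.isSum_zero_right (𝒲.total.mul
      (𝒲.V.pt (𝒲.base.one (φ.obj (K.tgt g))) (c.1 (K.tgt g))) (𝒲.V.pt (φ.map g) 0)) (φ.map g)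
      (right_proj c g))
    (SmoothVB.isSum_zero_left
      (𝒲.total.inv (𝒲.V.pt (𝒲.base.one (φ.obj (K.src g))) (c.1 (K.src g))))
      (𝒲.base.one (φ.obj (K.src g))) (by rw [𝒲.inv_lin.proj]; exact 𝒲.base.inv_one _))
    (by rw [hsr, hone, 𝒲.total.tgt_one]) (left_comp c g)
  rw [hone, 𝒲.total.mul_one' hsr] at h
  exact (isSum_delta c g).unique h

/-- If `u x = 1 + c x` for a core section `c`, then conjugating the multiplicative section `θ`
with the arrows `u x` amounts to adding `δ c`. -/
theorem eq_add_delta {σ θ : 𝒲.multSections φ} {c : 𝒲.coreSections φ} {u : B → 𝒲.V.Tot}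
    {f : B → 𝒲.E.Tot}
    (hs : ∀ g, 𝒲.total.src (𝒲.V.pt (φ.map g) (θ.1 g)) = f (K.src g))
    (ht : ∀ g, 𝒲.total.tgt (𝒲.V.pt (φ.map g) (θ.1 g)) = f (K.tgt g))
    (hu : ∀ x, 𝒲.V.IsSum (𝒲.total.one (f x)) (𝒲.V.pt (𝒲.base.one (φ.obj x)) (c.1 x)) (u x))
    (h : ∀ g, 𝒲.V.pt (φ.map g) (σ.1 g) =
      𝒲.total.mul (𝒲.total.mul (u (K.tgt g)) (𝒲.V.pt (φ.map g) (θ.1 g)))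
        (𝒲.total.inv (u (K.src g)))) :
    σ = @HAdd.hAdd (𝒲.multSections φ) (𝒲.multSections φ) (𝒲.multSections φ) _ θ
      ((𝒲.multComplexAlong φ).d c) := by
  refine Subtype.ext (funext fun g => 𝒲.V.pt_inj (b := φ.map g) ?_)
  have h1 : 𝒲.total.src (𝒲.total.one (f (K.tgt g))) =
      𝒲.total.tgt (𝒲.V.pt (φ.map g) (θ.1 g)) := by rw [𝒲.total.src_one, ht]
  have h2 := 𝒲.isSum_mul (hu (K.tgt g))
    (SmoothVB.isSum_zero_right (𝒲.V.pt (φ.map g) (θ.1 g)) (φ.map g) rfl) h1 (right_comp c g)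
  have h3 := 𝒲.isSum_mul h2 (𝒲.inv_lin.isSum (hu (K.src g)))
    (by rw [𝒲.total.src_mul _ _ h1, hs, 𝒲.total.tgt_inv, 𝒲.total.src_one])
    (by rw [𝒲.total.src_mul _ _ (right_comp c g), 𝒲.total.tgt_inv, c.2.2,
      𝒲.src_lin.map_zero, φ.src_map])
  rw [← pt_delta, ← h, 𝒲.total.one_mul' (ht g), 𝒲.total.inv_one, 𝒲.total.mul_one' (hs g)] at h3
  exact h3.unique ⟨_, _, _, rfl, rfl, rfl⟩

theorem d_eq_iff {σ : 𝒲.multSections φ} {c : 𝒲.coreSections φ} :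
    (𝒲.multComplexAlong φ).d c = σ ↔ ∀ g, 𝒲.V.pt (φ.map g) (σ.1 g) =
      𝒲.total.mul (𝒲.total.mul (𝒲.V.pt (𝒲.base.one (φ.obj (K.tgt g))) (c.1 (K.tgt g)))
        (𝒲.V.pt (φ.map g) 0))
        (𝒲.total.inv (𝒲.V.pt (𝒲.base.one (φ.obj (K.src g))) (c.1 (K.src g)))) := by
  constructor
  · rintro rfl g
    exact pt_delta c g
  · intro h
    exact Subtype.ext (funext fun g => 𝒲.V.pt_inj (b := φ.map g) ((pt_delta c g).trans (h g).symm))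

end Along

end VBGroupoid

/-! ### Weighted sums of vectors -/

section Comb

variable {N : SmoothMfd.{u}} {ι : Type*} (ρ : SmoothPartitionOfUnity ι (𝓡 N.dim) N univ)

theorem SmoothPartitionOfUnity.map_finsum {X Y : Type*} [AddCommGroup X] [Module ℝ X]
    [AddCommGroup Y] [Module ℝ Y] (L : X →ₗ[ℝ] Y) (y : N) (v : ι → X) :
    L (∑ᶠ i, ρ i y • v i) = ∑ᶠ i, ρ i y • L (v i) := by
  refine (L.toAddMonoidHom.map_finsum ?_).trans (finsum_congr fun i => L.map_smul _ _)
  · exact (ρ.locallyFinite.point_finite y).subset fun i hi => by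
      intro h
      exact hi (by simp only [h, zero_smul])

theorem SmoothPartitionOfUnity.finsum_smul_eq {X : Type*} [AddCommGroup X] [Module ℝ X] (y : N)
    {v : ι → X} {e : X} (h : ∀ i, ρ i y ≠ 0 → v i = e) : ∑ᶠ i, ρ i y • v i = e := by
  have h1 : ∀ i, ρ i y • v i = ρ i y • e := fun i => by
    by_cases hi : ρ i y = 0
    · rw [hi, zero_smul, zero_smul]
    · rw [h i hi]
  rw [finsum_congr h1, ← finsum_smul, ρ.sum_eq_one (mem_univ y), one_smul]

namespace SmoothVB

variable {M : SmoothMfd.{u}} (V : SmoothVB M)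

/-- The sum of the vectors `p i` in the fibre over `b`, weighted by the values at `y` of a partition
of unity.  Only the vectors with nonzero weight have to lie over `b`. -/
def comb (y : N) (p : ι → V.Tot) (b : M) : V.Tot := V.pt b (∑ᶠ i, ρ i y • V.fib (p i) b)

variable {V} {ρ} {y : N}

theorem comb_congr {p q : ι → V.Tot} (h : ∀ i, ρ i y ≠ 0 → p i = q i) (b : M) :
    V.comb ρ y p b = V.comb ρ y q b := by
  unfold comb
  congr 1
  refine finsum_congr fun i => ?_
  by_cases hi : ρ i y = 0
  · rw [hi, zero_smul, zero_smul]
  · rw [h i hi]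

theorem comb_eq {p : ι → V.Tot} {q : V.Tot} (h : ∀ i, ρ i y ≠ 0 → p i = q) {b : M}
    (hb : q.proj = b) : V.comb ρ y p b = q := by
  rw [comb, ρ.finsum_smul_eq y (e := V.fib q b) fun i hi => by rw [h i hi], V.pt_fib hb]

theorem map_comb {M' : SmoothMfd.{u}} {V' : SmoothVB M'} {f : V.Tot → V'.Tot} {f₀ : M → M'}
    (hf : IsFiberwiseLinear f f₀) {p : ι → V.Tot} {b : M} (hp : ∀ i, ρ i y ≠ 0 → (p i).proj = b) :
    f (V.comb ρ y p b) = V'.comb ρ y (fun i => f (p i)) (f₀ b) := by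
  obtain ⟨L, hL⟩ := hf
  rw [comb, hL, ρ.map_finsum, comb]
  congr 1
  refine finsum_congr fun i => ?_
  by_cases hi : ρ i y = 0
  · rw [hi, zero_smul, zero_smul]
  · have h1 := hL b (V.fib (p i) b)
    rw [V.pt_fib (hp i hi)] at h1
    congr 1
    refine V'.pt_inj ?_
    rw [← h1, V'.pt_fib (by rw [h1])]

theorem mul_comb {𝒲 : VBGroupoid.{u}} {p q : ι → 𝒲.V.Tot} {g h : 𝒲.G}
    (hp : ∀ i, ρ i y ≠ 0 → (p i).proj = g) (hq : ∀ i, ρ i y ≠ 0 → (q i).proj = h)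
    (hgh : 𝒲.base.src g = 𝒲.base.tgt h)
    (hpq : ∀ i, ρ i y ≠ 0 → 𝒲.total.src (p i) = 𝒲.total.tgt (q i)) :
    𝒲.total.mul (𝒲.V.comb ρ y p g) (𝒲.V.comb ρ y q h) =
      𝒲.V.comb ρ y (fun i => 𝒲.total.mul (p i) (q i)) (𝒲.base.mul g h) := by
  have hst : 𝒲.total.src (𝒲.V.comb ρ y p g) = 𝒲.total.tgt (𝒲.V.comb ρ y q h) := by
    rw [map_comb 𝒲.src_lin hp, map_comb 𝒲.tgt_lin hq, hgh]
    exact comb_congr hpq _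
  obtain ⟨L, hL⟩ := 𝒲.mul_lin g h hgh
  rw [comb, comb] at hst ⊢
  have hz : (∑ᶠ i, ρ i y • 𝒲.V.fib (p i) g, ∑ᶠ i, ρ i y • 𝒲.V.fib (q i) h) =
      ∑ᶠ i, ρ i y • ((𝒲.V.fib (p i) g, 𝒲.V.fib (q i) h) : 𝒲.V.fiber g × 𝒲.V.fiber h) :=
    Prod.ext (ρ.map_finsum (LinearMap.fst ℝ (𝒲.V.fiber g) (𝒲.V.fiber h)) y
        fun i => (𝒲.V.fib (p i) g, 𝒲.V.fib (q i) h)).symm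
      (ρ.map_finsum (LinearMap.snd ℝ (𝒲.V.fiber g) (𝒲.V.fiber h)) y
        fun i => (𝒲.V.fib (p i) g, 𝒲.V.fib (q i) h)).symm
  rw [hL _ _ hst, hz, ρ.map_finsum, comb]
  congr 1
  refine finsum_congr fun i => ?_
  by_cases hi : ρ i y = 0
  · rw [hi, zero_smul, zero_smul]
  · have h1 := hL (𝒲.V.fib (p i) g) (𝒲.V.fib (q i) h)
    rw [𝒲.V.pt_fib (hp i hi), 𝒲.V.pt_fib (hq i hi)] at h1
    congr 1
    refine 𝒲.V.pt_inj ?_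
    rw [← h1 (hpq i hi), 𝒲.V.pt_fib (by rw [h1 (hpq i hi)])]

theorem contMDiffAt_comb {EP HP P : Type*} [NormedAddCommGroup EP] [NormedSpace ℝ EP]
    [TopologicalSpace HP] {IP : ModelWithCorners ℝ EP HP} [TopologicalSpace P] [ChartedSpace HP P]
    {q : P → N} {p : ι → P → V.Tot} {b : P → M} {z : P}
    (hb : ContMDiffAt IP (𝓡 M.dim) ∞ b z) (hq : ContMDiffAt IP (𝓡 N.dim) ∞ q z)
    (hp : ∀ i, q z ∈ tsupport (ρ i) → ContMDiffAt IP V.model ∞ (p i) z ∧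
      ∀ᶠ x in 𝓝 z, (p i x).proj = b x) :
    ContMDiffAt IP V.model ∞ (fun x => V.comb ρ (q x) (fun i => p i x) (b x)) z := by
  refine V.contMDiffAt_finsum ρ hb hq fun i hi => ?_
  obtain ⟨h1, h2⟩ := hp i hi
  exact h1.congr_of_eventuallyEq (h2.mono fun x hx => V.pt_fib hx)

end SmoothVB

end Comb

/-! ### Lifting arrows along an equivalence -/

section Lift

variable {EA HA EB HB EA' HA' EB' HB' : Type*}
  [NormedAddCommGroup EA] [NormedSpace ℝ EA] [TopologicalSpace HA]
  [NormedAddCommGroup EB] [NormedSpace ℝ EB] [TopologicalSpace HB]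
  [NormedAddCommGroup EA'] [NormedSpace ℝ EA'] [TopologicalSpace HA']
  [NormedAddCommGroup EB'] [NormedSpace ℝ EB'] [TopologicalSpace HB']
  {I : ModelWithCorners ℝ EA HA} {J : ModelWithCorners ℝ EB HB}
  {I' : ModelWithCorners ℝ EA' HA'} {J' : ModelWithCorners ℝ EB' HB'}
  {A B A' B' : Type*} [TopologicalSpace A] [ChartedSpace HA A]
  [TopologicalSpace B] [ChartedSpace HB B]
  [TopologicalSpace A'] [ChartedSpace HA' A']
  [TopologicalSpace B'] [ChartedSpace HB' B']
  {K : LieGroupoid I J A B} {K' : LieGroupoid I' J' A' B'} {φ : LieGroupoidHom K K'}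

/-- A choice of the arrows of `K` with given image, source and target. -/
theorem LieGroupoidHom.IsSmoothEquivalence.exists_lift (hφ : φ.IsSmoothEquivalence.{u}) :
    ∃ l : A' → B → B → A, ∀ h x y, K'.src h = φ.obj x → K'.tgt h = φ.obj y →
      φ.map (l h x y) = h ∧ K.src (l h x y) = x ∧ K.tgt (l h x y) = y := by
  have : ∀ (h : A') (x y : B), ∃ g : A, K'.src h = φ.obj x → K'.tgt h = φ.obj y →
      φ.map g = h ∧ K.src g = x ∧ K.tgt g = y := fun h x y => by
    by_cases h1 : K'.src h = φ.obj x
    · by_cases h2 : K'.tgt h = φ.obj y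
      · obtain ⟨g, hg⟩ := hφ.full h x y h1 h2
        exact ⟨g, fun _ _ => hg⟩
      · exact ⟨K.one x, fun _ h3 => absurd h3 h2⟩
    · exact ⟨K.one x, fun h3 => absurd h3 h1⟩
  choose l hl using this
  exact ⟨l, hl⟩

/-- The lifts of `exists_lift` depend smoothly on parameters. -/
theorem LieGroupoidHom.IsSmoothEquivalence.contMDiffAt_of_eq (hφ : φ.IsSmoothEquivalence.{u})
    {P : SmoothMfd.{u}} {g : P → A} {h : P → A'} {x y : P → B} {p : P}
    (hh : ContMDiffAt (𝓡 P.dim) I' ∞ h p) (hx : ContMDiffAt (𝓡 P.dim) J ∞ x p)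
    (hy : ContMDiffAt (𝓡 P.dim) J ∞ y p)
    (he : ∀ᶠ q in 𝓝 p, φ.map (g q) = h q ∧ K.src (g q) = x q ∧ K.tgt (g q) = y q) :
    ContMDiffAt (𝓡 P.dim) I ∞ g p :=
  hφ.contMDiffAt_of_comp P g p (hh.congr_of_eventuallyEq (he.mono fun _ h => h.1))
    (hx.congr_of_eventuallyEq (he.mono fun _ h => h.2.1))
    (hy.congr_of_eventuallyEq (he.mono fun _ h => h.2.2))

end Lift

/-! ### Partitions of unity and core sections -/

/-- A partition of unity subordinate to given neighbourhoods of the points of a manifold. -/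
theorem SmoothMfd.exists_partition (N : SmoothMfd.{u}) {p : N → N → Prop}
    (h : ∀ y₀, ∀ᶠ y in 𝓝 y₀, p y₀ y) :
    ∃ ρ : SmoothPartitionOfUnity N (𝓡 N.dim) N univ,
      (∀ i y, y ∈ tsupport (ρ i) → ∀ᶠ z in 𝓝 y, p i z) ∧ ∀ i y, ρ i y ≠ 0 → p i y := by
  have : LocallyCompactSpace N :=
    ChartedSpace.locallyCompactSpace (EuclideanSpace ℝ (Fin N.dim)) N
  choose U hU hUo hUm using fun y₀ => eventually_nhds_iff.1 (h y₀)
  obtain ⟨ρ, hρ⟩ := SmoothPartitionOfUnity.exists_isSubordinate (𝓡 N.dim) isClosed_univ U hUo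
    (fun y _ => mem_iUnion.2 ⟨y, hUm y⟩)
  exact ⟨ρ, fun i y hy => Filter.mem_of_superset ((hUo i).mem_nhds (hρ i hy)) (hU i),
    fun i y hy => hU i y (hρ i (subset_tsupport _ hy))⟩

namespace VBGroupoid

variable {A B : SmoothMfd.{u}} {K : LieGroupoid (𝓡 A.dim) (𝓡 B.dim) A B} {𝒲 : VBGroupoid.{u}}
  {φ : LieGroupoidHom K 𝒲.base}

/-- Arrows `u x` over units, starting at `f x`, are of the form `1 + c x` for a core section `c`. -/
theorem exists_core_of_arrows (u : B → 𝒲.V.Tot) (f : B → 𝒲.E.Tot)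
    (hu : ∀ x, ContMDiffAt (𝓡 B.dim) 𝒲.V.model ∞ u x)
    (hup : ∀ x, (u x).proj = 𝒲.base.one (φ.obj x)) (hus : ∀ x, 𝒲.total.src (u x) = f x) :
    ∃ c : 𝒲.coreSections φ, ∀ x,
      𝒲.V.IsSum (𝒲.total.one (f x)) (𝒲.V.pt (𝒲.base.one (φ.obj x)) (c.1 x)) (u x) := by
  have hfp : ∀ x, (f x).proj = φ.obj x := fun x => by
    rw [← hus, 𝒲.src_lin.proj, hup, 𝒲.base.src_one]
  have hop : ∀ x, (𝒲.total.one (f x)).proj = 𝒲.base.one (φ.obj x) := fun x => by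
    rw [𝒲.one_lin.proj, hfp]
  have e1 := fun x => 𝒲.V.pt_fib (hup x)
  have e2 := fun x => 𝒲.V.pt_fib (hop x)
  have hs1 : ∀ x, ContMDiffAt (𝓡 B.dim) 𝒲.V.model ∞ (fun x => 𝒲.total.one (f x)) x := fun x =>
    𝒲.total.contMDiffAt_one ((𝒲.total.contMDiffAt_src (hu x)).congr_of_eventuallyEq
      (Filter.Eventually.of_forall fun x => (hus x).symm))
  obtain ⟨c, hc⟩ := exists_coreSection (φ := φ) (fun x => 𝒲.V.pt (𝒲.base.one (φ.obj x))
    (𝒲.V.fib (u x) (𝒲.base.one (φ.obj x)) +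
      (-1 : ℝ) • 𝒲.V.fib (𝒲.total.one (f x)) (𝒲.base.one (φ.obj x)))) (fun _ => rfl)
    (fun x => 𝒲.V.contMDiffAt_add (by simp only [e1]; exact hu x)
      (𝒲.V.contMDiffAt_smul contMDiffAt_const (by simp only [e2]; exact hs1 x))) (fun x => by
      obtain ⟨L, hL⟩ := 𝒲.src_lin
      have h1 := hL (𝒲.base.one (φ.obj x)) (𝒲.V.fib (u x) (𝒲.base.one (φ.obj x)))
      have h2 := hL (𝒲.base.one (φ.obj x)) (𝒲.V.fib (𝒲.total.one (f x)) (𝒲.base.one (φ.obj x)))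
      rw [e1, hus] at h1
      rw [e2, 𝒲.total.src_one] at h2
      rw [hL, map_add, map_smul, 𝒲.E.pt_inj (h1.symm.trans h2), neg_one_smul,
        add_neg_cancel, 𝒲.base.src_one])
  refine ⟨c, fun x => ⟨_, _, c.1 x, (e2 x).symm, rfl, ?_⟩⟩
  have h3 := 𝒲.V.pt_inj (hc x)
  rw [h3, neg_one_smul, add_comm, neg_add_cancel_right, e1]

end VBGroupoid

/-! ### Pushing forward along an equivalence -/

namespace VBGroupoidHom

variable {𝒱 𝒲 : VBGroupoid.{u}} (Φ : VBGroupoidHom 𝒱 𝒲)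

theorem pt_pushMult (σ : 𝒱.multSections (LieGroupoidHom.id 𝒱.base)) (g : 𝒱.G) :
    𝒲.V.pt (Φ.base.map g) ((Φ.pushMult σ).1 g) = Φ.total.map (𝒱.V.pt g (σ.1 g)) :=
  𝒲.V.pt_toFiber (Φ.total.map (𝒱.V.pt g (σ.1 g))) (Φ.base.map g) (Φ.map_lin.proj _)

theorem pt_pushCore (c : 𝒱.coreSections (LieGroupoidHom.id 𝒱.base)) (x : 𝒱.M) :
    𝒲.V.pt (𝒲.base.one (Φ.base.obj x)) ((Φ.pushCore c).1 x) =
      Φ.total.map (𝒱.V.pt (𝒱.base.one x) (c.1 x)) :=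
  𝒲.V.pt_toFiber _ _ (Φ.pushCore_proj x _)

variable {Φ}

/-- A core section `c'` along the base map, being a family of arrows from `0` to vectors in the image
of `Φ`, lifts uniquely by full faithfulness. -/
theorem push_exact_left (hΦ : Φ.total.IsSmoothEquivalence.{u})
    (σ : 𝒱.multSections (LieGroupoidHom.id 𝒱.base)) (c' : 𝒲.coreSections Φ.base)
    (h : Φ.pushMult σ = (𝒲.multComplexAlong Φ.base).d c') :
    ∃! c : 𝒱.coreSections (LieGroupoidHom.id 𝒱.base),
      𝒱.multComplex.d c = σ ∧ Φ.pushCore c = c' := by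
  have hφ := isSmoothEquivalence_base hΦ
  obtain ⟨F, hF⟩ := σ.2
  have hd := VBGroupoid.d_eq_iff.1 h.symm
  simp only [pt_pushMult] at hd
  set C' : 𝒱.M → 𝒲.V.Tot := fun x => 𝒲.V.pt (𝒲.base.one (Φ.base.obj x)) (c'.1 x) with hC'
  have hC't : ∀ x, 𝒲.total.tgt (C' x) = Φ.total.obj (F.obj x) := fun x => by
    have h1 := VBGroupoid.delta_tgt c' (𝒱.base.one x)
    have h2 := Φ.pt_pushMult σ (𝒱.base.one x)
    rw [h] at h2
    rw [𝒱.base.tgt_one] at h1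
    refine h1.symm.trans ((congrArg 𝒲.total.tgt h2).trans ?_)
    rw [Φ.total.tgt_map]
    refine congrArg Φ.total.obj ((congrArg 𝒱.total.tgt (hF (𝒱.base.one x)).symm).trans ?_)
    rw [F.tgt_map, 𝒱.base.tgt_one]
  have hC's : ∀ x, 𝒲.total.src (C' x) = Φ.total.obj (𝒱.E.pt x 0) := fun x => by
    rw [Φ.obj_lin.map_zero]
    exact c'.2.2 x
  have hep : ∀ x, (F.obj x).proj = x := fun x => by
    have h1 := F.tgt_map (𝒱.base.one x)
    rw [𝒱.base.tgt_one] at h1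
    rw [← h1, hF, 𝒱.tgt_lin.proj]
    exact 𝒱.base.tgt_one x
  obtain ⟨l, hl⟩ := hΦ.exists_lift
  set C : 𝒱.M → 𝒱.V.Tot := fun x => l (C' x) (𝒱.E.pt x 0) (F.obj x) with hC
  have hCl : ∀ x, Φ.total.map (C x) = C' x ∧ 𝒱.total.src (C x) = 𝒱.E.pt x 0 ∧
      𝒱.total.tgt (C x) = F.obj x := fun x => hl _ _ _ (hC's x) (hC't x)
  have hCp : ∀ x, (C x).proj = 𝒱.base.one x := fun x => by
    refine hφ.faithful _ _ ?_ ?_ ?_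
    · rw [← Φ.map_lin.proj, (hCl x).1, Φ.base.map_one]
    · rw [← 𝒱.src_lin.proj, (hCl x).2.1, 𝒱.base.src_one]
    · rw [← 𝒱.tgt_lin.proj, (hCl x).2.2, 𝒱.base.tgt_one, hep]
  obtain ⟨c, hc⟩ := VBGroupoid.exists_coreSection (φ := LieGroupoidHom.id 𝒱.base) C hCp
    (fun x => hΦ.contMDiffAt_of_eq (c'.2.1 x) (𝒱.E.contMDiffAt_zero contMDiffAt_id)
      (F.smooth_obj x) (Filter.Eventually.of_forall hCl)) (fun x => (hCl x).2.1)
  have hcomp : ∀ g, 𝒱.total.src (C (𝒱.base.tgt g)) = 𝒱.total.tgt (𝒱.V.pt g 0) := fun g => by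
    rw [(hCl _).2.1, 𝒱.tgt_lin.map_zero]
  have hcomp' : ∀ g, 𝒱.total.src (𝒱.total.mul (C (𝒱.base.tgt g)) (𝒱.V.pt g 0)) =
      𝒱.total.tgt (𝒱.total.inv (C (𝒱.base.src g))) := fun g => by
    rw [𝒱.total.src_mul _ _ (hcomp g), 𝒱.total.tgt_inv, (hCl _).2.1, 𝒱.src_lin.map_zero]
  refine ⟨c, ⟨?_, ?_⟩, ?_⟩
  · refine VBGroupoid.d_eq_iff.2 fun g => ?_
    rw [hc, hc]
    change 𝒱.V.pt g (σ.1 g) = 𝒱.total.mul (𝒱.total.mul (C (𝒱.base.tgt g)) (𝒱.V.pt g 0))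
      (𝒱.total.inv (C (𝒱.base.src g)))
    refine hΦ.faithful _ _ ?_ ?_ ?_
    · rw [hd, Φ.total.map_mul _ _ (hcomp' g), Φ.total.map_mul _ _ (hcomp g), Φ.total.map_inv,
        (hCl _).1, (hCl _).1, Φ.map_lin.map_zero]
    · rw [𝒱.total.src_mul _ _ (hcomp' g), 𝒱.total.src_inv, (hCl _).2.2, ← F.src_map]
      exact congrArg 𝒱.total.src (hF g).symm
    · rw [𝒱.total.tgt_mul _ _ (hcomp' g), 𝒱.total.tgt_mul _ _ (hcomp g), (hCl _).2.2, ← F.tgt_map]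
      exact congrArg 𝒱.total.tgt (hF g).symm
  · refine Subtype.ext (funext fun x => 𝒲.V.pt_inj ((Φ.pt_pushCore c x).trans ?_))
    exact (congrArg Φ.total.map (hc x)).trans (hCl x).1
  · rintro d ⟨hd1, hd2⟩
    refine Subtype.ext (funext fun x => 𝒱.V.pt_inj (Eq.trans ?_ (hc x).symm))
    refine hΦ.faithful _ _ ?_ ?_ ?_
    · rw [(hCl x).1, hC', ← hd2]
      exact (Φ.pt_pushCore d x).symm
    · rw [(hCl x).2.1]
      exact d.2.2 x
    · have h1 := VBGroupoid.delta_tgt d (𝒱.base.one x)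
      rw [𝒱.base.tgt_one] at h1
      have h2 : 𝒱.V.pt (𝒱.base.one x) ((𝒱.multComplex.d d : 𝒱.multSections _).1 (𝒱.base.one x)) =
        F.map (𝒱.base.one x) := by rw [hd1, hF]; rfl
      rw [(hCl x).2.2]
      refine h1.symm.trans ((congrArg 𝒱.total.tgt h2).trans ?_)
      rw [F.tgt_map, 𝒱.base.tgt_one]

end VBGroupoidHom

namespace VBGroupoidHom

variable {𝒱 𝒲 : VBGroupoid.{u}} {Φ : VBGroupoidHom 𝒱 𝒲}

/-- Locally, every vector `e' x` over `φ x` is isomorphic in `𝒲`, by an arrow `u x` over a unit, to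
the image of a vector `e x` over `x`. -/
theorem exists_local_arrow (hΦ : Φ.total.IsSmoothEquivalence.{u}) {e' : 𝒱.M → 𝒲.E.Tot}
    (he' : ∀ x, ContMDiffAt (𝓡 𝒱.M.dim) 𝒲.E.model ∞ e' x)
    (hp : ∀ x, (e' x).proj = Φ.base.obj x) (x₀ : 𝒱.M) :
    ∃ (e : 𝒱.M → 𝒱.E.Tot) (u : 𝒱.M → 𝒲.V.Tot), ∀ᶠ x in 𝓝 x₀,
      (ContMDiffAt (𝓡 𝒱.M.dim) 𝒱.E.model ∞ e x ∧ ContMDiffAt (𝓡 𝒱.M.dim) 𝒲.V.model ∞ u x) ∧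
      (e x).proj = x ∧ (u x).proj = 𝒲.base.one (Φ.base.obj x) ∧
      𝒲.total.src (u x) = Φ.total.obj (e x) ∧ 𝒲.total.tgt (u x) = e' x := by
  have hφ := isSmoothEquivalence_base hΦ
  obtain ⟨l, hl⟩ := hφ.exists_lift
  obtain ⟨γ, ξ, h⟩ := hΦ.local_section (e' x₀)
  have h1 := (he' x₀).continuousAt.eventually h
  set w : 𝒱.M → 𝒲.V.Tot := fun x => γ (e' x) with hw
  set v : 𝒱.M → 𝒱.E.Tot := fun x => ξ (e' x) with hv
  have hws : ∀ᶠ x in 𝓝 x₀, ContMDiffAt (𝓡 𝒱.M.dim) 𝒲.V.model ∞ w x :=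
    h1.mono fun x hx => hx.1.comp x (he' x)
  have hvs : ∀ᶠ x in 𝓝 x₀, ContMDiffAt (𝓡 𝒱.M.dim) 𝒱.E.model ∞ v x :=
    h1.mono fun x hx => hx.2.1.comp x (he' x)
  -- the arrow underlying `w x` comes from an arrow `g x` of the base, ending at `x`
  set g : 𝒱.M → 𝒱.G := fun x => l (w x).proj (v x).proj x with hg
  have hgl : ∀ᶠ x in 𝓝 x₀, Φ.base.map (g x) = (w x).proj ∧ 𝒱.base.src (g x) = (v x).proj ∧
      𝒱.base.tgt (g x) = x := h1.mono fun x hx => hl _ _ _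
    (by rw [← 𝒲.src_lin.proj, ← Φ.obj_lin.proj, hx.2.2.1])
    (by rw [← 𝒲.tgt_lin.proj, hx.2.2.2, hp])
  have hgs : ∀ᶠ x in 𝓝 x₀, ContMDiffAt (𝓡 𝒱.M.dim) (𝓡 𝒱.G.dim) ∞ g x := by
    filter_upwards [hws, hvs, hgl.eventually_nhds] with x h2 h3 h4
    exact hφ.contMDiffAt_of_eq (𝒲.V.contMDiffAt_proj h2) (𝒱.E.contMDiffAt_proj h3)
      contMDiffAt_id h4
  obtain ⟨ν, hν⟩ := 𝒱.exists_lift hgs hvs (hgl.mono fun x hx => hx.2.1)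
  have hcomp : ∀ᶠ x in 𝓝 x₀, 𝒲.total.src (w x) =
      𝒲.total.tgt (𝒲.total.inv (Φ.total.map (ν x))) := by
    filter_upwards [h1, hν] with x h2 h3
    rw [𝒲.total.tgt_inv, Φ.total.src_map, h3.2.2]
    exact h2.2.2.1
  refine ⟨fun x => 𝒱.total.tgt (ν x),
    fun x => 𝒲.total.mul (w x) (𝒲.total.inv (Φ.total.map (ν x))), ?_⟩
  filter_upwards [h1, hws, hgl, hν, hcomp.eventually_nhds] with x h2 h3 h4 h5 h6
  have h7 := h6.self_of_nhds
  refine ⟨⟨𝒱.total.contMDiffAt_tgt h5.1, ?_⟩, ?_, ?_, ?_, ?_⟩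
  · exact 𝒲.total.contMDiffAt_mul h3 (𝒲.total.contMDiffAt_inv
      ((Φ.total.smooth_map _).comp x h5.1)) h6
  · rw [𝒱.tgt_lin.proj, h5.2.1, h4.2.2]
  · rw [𝒲.mul_proj h7, 𝒲.inv_lin.proj, Φ.map_lin.proj, h5.2.1, h4.1, 𝒲.base.mul_inv, ← h4.1,
      Φ.base.tgt_map, h4.2.2]
  · rw [𝒲.total.src_mul _ _ h7, 𝒲.total.src_inv, Φ.total.tgt_map]
  · rw [𝒲.total.tgt_mul _ _ h7]
    exact h2.2.2.2

/-- The arrows of `exists_local_arrow` can be chosen globally: a weighted sum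
of pairs `(e x, u x)` with the required endpoints has them again, by linearity of the structure maps. -/
theorem exists_arrow (hΦ : Φ.total.IsSmoothEquivalence.{u}) {e' : 𝒱.M → 𝒲.E.Tot}
    (he' : ∀ x, ContMDiffAt (𝓡 𝒱.M.dim) 𝒲.E.model ∞ e' x)
    (hp : ∀ x, (e' x).proj = Φ.base.obj x) :
    ∃ (e : 𝒱.M → 𝒱.E.Tot) (u : 𝒱.M → 𝒲.V.Tot), ∀ x,
      (ContMDiffAt (𝓡 𝒱.M.dim) 𝒱.E.model ∞ e x ∧ ContMDiffAt (𝓡 𝒱.M.dim) 𝒲.V.model ∞ u x) ∧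
      (e x).proj = x ∧ (u x).proj = 𝒲.base.one (Φ.base.obj x) ∧
      𝒲.total.src (u x) = Φ.total.obj (e x) ∧ 𝒲.total.tgt (u x) = e' x := by
  choose e u h using exists_local_arrow hΦ he' hp
  obtain ⟨ρ, hρ1, hρ2⟩ := 𝒱.M.exists_partition h
  refine ⟨fun x => 𝒱.E.comb ρ x (fun i => e i x) x,
    fun x => 𝒲.V.comb ρ x (fun i => u i x) (𝒲.base.one (Φ.base.obj x)), fun x =>
    ⟨⟨?_, ?_⟩, rfl, rfl, ?_, ?_⟩⟩
  · exact SmoothVB.contMDiffAt_comb contMDiffAt_id contMDiffAt_id fun i hi =>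
      ⟨(hρ1 i x hi).self_of_nhds.1.1, (hρ1 i x hi).mono fun z hz => hz.2.1⟩
  · exact SmoothVB.contMDiffAt_comb (𝒲.base.contMDiffAt_one (Φ.base.smooth_obj x)) contMDiffAt_id
      fun i hi => ⟨(hρ1 i x hi).self_of_nhds.1.2, (hρ1 i x hi).mono fun z hz => hz.2.2.1⟩
  · rw [SmoothVB.map_comb 𝒲.src_lin fun i hi => (hρ2 i x hi).2.2.1, 𝒲.base.src_one,
      SmoothVB.map_comb Φ.obj_lin fun i hi => (hρ2 i x hi).2.1]
    exact SmoothVB.comb_congr (fun i hi => (hρ2 i x hi).2.2.2.1) _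
  · rw [SmoothVB.map_comb 𝒲.tgt_lin fun i hi => (hρ2 i x hi).2.2.1, 𝒲.base.tgt_one]
    exact SmoothVB.comb_eq (fun i hi => (hρ2 i x hi).2.2.2.2) (hp x)

/-- A multiplicative section along the base map is conjugate, by the arrows of `exists_arrow`, to one
with objects in the image of `Φ`, which lifts by full faithfulness. -/
theorem push_exact_right (hΦ : Φ.total.IsSmoothEquivalence.{u}) (τ : 𝒲.multSections Φ.base) :
    ∃ (σ : 𝒱.multSections (LieGroupoidHom.id 𝒱.base)) (c : 𝒲.coreSections Φ.base),
      τ = @HAdd.hAdd (𝒲.multSections Φ.base) (𝒲.multSections Φ.base) (𝒲.multSections Φ.base) _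
        (Φ.pushMult σ) ((𝒲.multComplexAlong Φ.base).d c) := by
  have hφ := isSmoothEquivalence_base hΦ
  obtain ⟨F, hF⟩ := τ.2
  have hFp : ∀ x, (F.obj x).proj = Φ.base.obj x := fun x => by
    have h1 := F.tgt_map (𝒱.base.one x)
    rw [𝒱.base.tgt_one] at h1
    rw [← h1, hF, 𝒲.tgt_lin.proj]
    change 𝒲.base.tgt (Φ.base.map (𝒱.base.one x)) = _
    rw [Φ.base.tgt_map, 𝒱.base.tgt_one]
  obtain ⟨e, u, h⟩ := exists_arrow hΦ F.smooth_obj hFp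
  choose hs hep hup hus hut using h
  obtain ⟨l, hl⟩ := hΦ.exists_lift
  -- conjugating `τ` with `u` gives a morphism with objects in the image of `Φ`
  set X : 𝒱.G → 𝒲.V.Tot := fun g => 𝒲.total.mul
    (𝒲.total.mul (𝒲.total.inv (u (𝒱.base.tgt g))) (F.map g)) (u (𝒱.base.src g)) with hX
  have c1 : ∀ g, 𝒲.total.src (𝒲.total.inv (u (𝒱.base.tgt g))) = 𝒲.total.tgt (F.map g) := fun g => by
    rw [𝒲.total.src_inv, hut, F.tgt_map]
  have c2 : ∀ g, 𝒲.total.src (F.map g) = 𝒲.total.tgt (u (𝒱.base.src g)) := fun g => by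
    rw [F.src_map, hut]
  have c3 : ∀ g, 𝒲.total.src (𝒲.total.mul (𝒲.total.inv (u (𝒱.base.tgt g))) (F.map g)) =
      𝒲.total.tgt (u (𝒱.base.src g)) := fun g => by rw [𝒲.total.src_mul _ _ (c1 g), c2]
  have hXs : ∀ g, 𝒲.total.src (X g) = Φ.total.obj (e (𝒱.base.src g)) := fun g => by
    rw [𝒲.total.src_mul _ _ (c3 g), hus]
  have hXt : ∀ g, 𝒲.total.tgt (X g) = Φ.total.obj (e (𝒱.base.tgt g)) := fun g => by
    rw [𝒲.total.tgt_mul _ _ (c3 g), 𝒲.total.tgt_mul _ _ (c1 g), 𝒲.total.tgt_inv, hus]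
  have hXm : ∀ g, 𝒲.total.mul (u (𝒱.base.tgt g)) (X g) =
      𝒲.total.mul (F.map g) (u (𝒱.base.src g)) := fun g => by
    simp only [hX]
    rw [𝒲.total.mul_assoc _ _ _ (c1 g) (c2 g)]
    exact 𝒲.total.mul_inv_cancel_left (by rw [𝒲.total.tgt_mul _ _ (c2 g), hut, F.tgt_map])
  have c4 : ∀ g, 𝒲.total.src (u (𝒱.base.tgt g)) = 𝒲.total.tgt (X g) := fun g => by rw [hus, hXt]
  have hXX : ∀ g h, 𝒱.base.src g = 𝒱.base.tgt h →
      X (𝒱.base.mul g h) = 𝒲.total.mul (X g) (X h) := fun g h hgh => by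
    have c5 : 𝒲.total.src (X g) = 𝒲.total.tgt (X h) := by rw [hXs, hXt, hgh]
    have c6 : 𝒲.total.src (F.map g) = 𝒲.total.tgt (F.map h) := by rw [F.src_map, F.tgt_map, hgh]
    have e1 := hXm (𝒱.base.mul g h)
    rw [𝒱.base.tgt_mul _ _ hgh, 𝒱.base.src_mul _ _ hgh, F.map_mul _ _ hgh,
      𝒲.total.mul_assoc _ _ _ c6 (c2 h), ← hXm h, ← hgh,
      ← 𝒲.total.mul_assoc _ _ _ (c2 g) (by rw [hus, hXt, hgh]), ← hXm g,
      𝒲.total.mul_assoc _ _ _ (c4 g) c5] at e1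
    refine 𝒲.total.mul_left_cancel ?_ ?_ e1
    · rw [hus, hXt, 𝒱.base.tgt_mul _ _ hgh]
    · rw [𝒲.total.tgt_mul _ _ c5, hus, hXt]
  have hXsm : ∀ g, ContMDiffAt (𝓡 𝒱.G.dim) 𝒲.V.model ∞ X g := fun g => by
    have s1 : ContMDiffAt (𝓡 𝒱.G.dim) 𝒲.V.model ∞ (fun g => u (𝒱.base.tgt g)) g :=
      (hs _).2.comp g (𝒱.base.submersion_tgt.contMDiff g)
    have s2 : ContMDiffAt (𝓡 𝒱.G.dim) 𝒲.V.model ∞ (fun g => u (𝒱.base.src g)) g :=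
      (hs _).2.comp g (𝒱.base.submersion_src.contMDiff g)
    exact 𝒲.total.contMDiffAt_mul (𝒲.total.contMDiffAt_mul (𝒲.total.contMDiffAt_inv s1)
      (F.smooth_map g) (Filter.Eventually.of_forall c1)) s2 (Filter.Eventually.of_forall c3)
  have hXp : ∀ g, (X g).proj = Φ.base.map g := fun g => by
    rw [𝒲.mul_proj (c3 g), 𝒲.mul_proj (c1 g), 𝒲.inv_lin.proj, hup, hup, 𝒲.base.inv_one,
      show (F.map g).proj = Φ.base.map g by rw [hF],
      𝒲.base.one_mul' (Φ.base.tgt_map g), 𝒲.base.mul_one' (Φ.base.src_map g)]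
  set S : 𝒱.G → 𝒱.V.Tot := fun g => l (X g) (e (𝒱.base.src g)) (e (𝒱.base.tgt g)) with hS
  have hSl : ∀ g, Φ.total.map (S g) = X g ∧ 𝒱.total.src (S g) = e (𝒱.base.src g) ∧
      𝒱.total.tgt (S g) = e (𝒱.base.tgt g) := fun g => hl _ _ _ (hXs g) (hXt g)
  obtain ⟨σ, hσ⟩ := VBGroupoid.exists_multSection (φ := LieGroupoidHom.id 𝒱.base) S e
    (fun g => hφ.faithful _ _ (by rw [← Φ.map_lin.proj, (hSl g).1, hXp]; rfl)
      (by rw [← 𝒱.src_lin.proj, (hSl g).2.1, hep]; rfl)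
      (by rw [← 𝒱.tgt_lin.proj, (hSl g).2.2, hep]; rfl))
    (fun g => hΦ.contMDiffAt_of_eq (hXsm g)
      ((hs _).1.comp g (𝒱.base.submersion_src.contMDiff g))
      ((hs _).1.comp g (𝒱.base.submersion_tgt.contMDiff g)) (Filter.Eventually.of_forall hSl))
    (fun g => (hSl g).2.1) (fun g => (hSl g).2.2)
    (fun g h hgh => by
      have c5 : 𝒱.total.src (S g) = 𝒱.total.tgt (S h) := by rw [(hSl g).2.1, (hSl h).2.2, hgh]
      refine hΦ.faithful _ _ ?_ ?_ ?_
      · rw [Φ.total.map_mul _ _ c5, (hSl _).1, (hSl _).1, (hSl _).1, hXX g h hgh]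
      · rw [𝒱.total.src_mul _ _ c5, (hSl _).2.1, (hSl _).2.1, 𝒱.base.src_mul _ _ hgh]
      · rw [𝒱.total.tgt_mul _ _ c5, (hSl _).2.2, (hSl _).2.2, 𝒱.base.tgt_mul _ _ hgh])
  obtain ⟨c, hc⟩ := VBGroupoid.exists_core_of_arrows (φ := Φ.base) u (fun x => Φ.total.obj (e x))
    (fun x => (hs x).2) hup hus
  have hpush : ∀ g, 𝒲.V.pt (Φ.base.map g) ((Φ.pushMult σ).1 g) = X g := fun g =>
    (Φ.pt_pushMult σ g).trans ((congrArg Φ.total.map (hσ g)).trans (hSl g).1)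
  refine ⟨σ, c, VBGroupoid.eq_add_delta (u := u) (f := fun x => Φ.total.obj (e x))
    (fun g => by rw [hpush, hXs]) (fun g => by rw [hpush, hXt]) hc fun g => ?_⟩
  rw [hpush, hXm, 𝒲.total.mul_inv_cancel_right (c2 g), hF]

theorem push_bijective (hΦ : Φ.total.IsSmoothEquivalence.{u}) :
    Function.Bijective Φ.push.mapH0 ∧ Function.Bijective Φ.push.mapH1 := by
  refine Φ.push.bijective_of_exact_cone (push_exact_left hΦ) fun τ => ?_
  obtain ⟨σ, c, h⟩ : ∃ (σ : 𝒱.multComplex.X1) (c : (𝒲.multComplexAlong Φ.base).X0),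
      τ = Φ.push.f1 σ + (𝒲.multComplexAlong Φ.base).d c := push_exact_right hΦ τ
  exact ⟨σ, -c, by rw [h, map_neg, add_neg_cancel_right]⟩

end VBGroupoidHom

/-! ### Pulling back along an equivalence of the bases -/

namespace VBGroupoid

variable {A B : SmoothMfd.{u}} {K : LieGroupoid (𝓡 A.dim) (𝓡 B.dim) A B} {𝒲 : VBGroupoid.{u}}
  {φ : LieGroupoidHom K 𝒲.base}

/-- Two arrows `φ x → y` and `φ x' → y` differ by the image of an arrow `x → x'`. -/
theorem exists_arrow_of_tgt_eq (hφ : φ.IsSmoothEquivalence.{u}) {k k' : 𝒲.G} {x x' : B}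
    (hk : 𝒲.base.src k = φ.obj x) (hk' : 𝒲.base.src k' = φ.obj x')
    (h : 𝒲.base.tgt k = 𝒲.base.tgt k') :
    ∃ a : A, K.src a = x ∧ K.tgt a = x' ∧ 𝒲.base.mul k' (φ.map a) = k := by
  have hc : 𝒲.base.src (𝒲.base.inv k') = 𝒲.base.tgt k := by rw [𝒲.base.src_inv, h]
  obtain ⟨a, h1, h2, h3⟩ := hφ.full (𝒲.base.mul (𝒲.base.inv k') k) x x'
    (by rw [𝒲.base.src_mul _ _ hc, hk]) (by rw [𝒲.base.tgt_mul _ _ hc, 𝒲.base.tgt_inv, hk'])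
  exact ⟨a, h2, h3, by rw [h1, 𝒲.base.mul_inv_cancel_left h.symm]⟩

theorem exists_arrow_to (hφ : φ.IsSmoothEquivalence.{u}) (y : 𝒲.M) :
    ∃ (k : 𝒲.G) (x : B), 𝒲.base.src k = φ.obj x ∧ 𝒲.base.tgt k = y := by
  obtain ⟨γ, ξ, h⟩ := hφ.local_section y
  exact ⟨γ y, ξ y, h.self_of_nhds.2.2⟩

/-- The core section over the target of `φ` is forced to have the value `σ k · c x · 0_{k⁻¹}` at
`tgt k`, for any arrow `k` with source `φ x`. -/
theorem pull_exact_left (hφ : φ.IsSmoothEquivalence.{u})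
    (σ : 𝒲.multSections (LieGroupoidHom.id 𝒲.base)) (c : 𝒲.coreSections φ)
    (h : 𝒲.pullMult φ σ = (𝒲.multComplexAlong φ).d c) :
    ∃! d : 𝒲.coreSections (LieGroupoidHom.id 𝒲.base),
      𝒲.multComplex.d d = σ ∧ 𝒲.pullCore φ d = c := by
  obtain ⟨F, hF⟩ := σ.2
  replace hF : ∀ g : 𝒲.G, F.map g = 𝒲.V.pt g (σ.1 g) := hF
  set C : B → 𝒲.V.Tot := fun x => 𝒲.V.pt (𝒲.base.one (φ.obj x)) (c.1 x) with hC
  have hCs : ∀ x, 𝒲.total.src (C x) = 𝒲.E.pt (φ.obj x) 0 := c.2.2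
  have hFC : ∀ g, F.map (φ.map g) = 𝒲.total.mul (𝒲.total.mul (C (K.tgt g))
      (𝒲.V.pt (φ.map g) 0)) (𝒲.total.inv (C (K.src g))) := fun g =>
    (hF _).trans (d_eq_iff.1 h.symm g)
  have hFp : ∀ g, (F.map g).proj = g := fun g => by rw [hF]
  have hFs : ∀ g, 𝒲.total.src (F.map (φ.map g)) = 𝒲.total.tgt (C (K.src g)) := fun g => by
    have := delta_src c g
    rwa [pt_delta, ← hFC] at this
  have hCt : ∀ x, 𝒲.total.tgt (C x) = F.obj (φ.obj x) := fun x => by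
    have := hFs (K.one x)
    rw [F.src_map, φ.src_map, K.src_one] at this
    exact this.symm
  have hFCm : ∀ g, 𝒲.total.mul (F.map (φ.map g)) (C (K.src g)) =
      𝒲.total.mul (C (K.tgt g)) (𝒲.V.pt (φ.map g) 0) := fun g => by
    rw [hFC]
    refine 𝒲.total.inv_mul_cancel_right ?_
    rw [𝒲.total.src_mul _ _ (right_comp c g), 𝒲.src_lin.map_zero, hCs, φ.src_map]
  -- the value at `tgt k` of the section to be constructed, in terms of an arrow `k` from `φ x`
  set D : 𝒲.G → B → 𝒲.V.Tot := fun k x =>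
    𝒲.total.mul (𝒲.total.mul (F.map k) (C x)) (𝒲.V.pt (𝒲.base.inv k) 0) with hD
  have c1 : ∀ k x, 𝒲.base.src k = φ.obj x → 𝒲.total.src (F.map k) = 𝒲.total.tgt (C x) :=
    fun k x hk => by rw [F.src_map, hCt, hk]
  have c0 : ∀ k x, 𝒲.base.src k = φ.obj x →
      𝒲.total.src (C x) = 𝒲.total.tgt (𝒲.V.pt (𝒲.base.inv k) 0) := fun k x hk => by
    rw [hCs, 𝒲.tgt_lin.map_zero, 𝒲.base.tgt_inv, hk]
  have c2 : ∀ k x, 𝒲.base.src k = φ.obj x → 𝒲.total.src (𝒲.total.mul (F.map k) (C x)) =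
      𝒲.total.tgt (𝒲.V.pt (𝒲.base.inv k) 0) := fun k x hk => by
    rw [𝒲.total.src_mul _ _ (c1 k x hk), c0 k x hk]
  have hDs : ∀ k x, 𝒲.base.src k = φ.obj x → 𝒲.total.src (D k x) = 𝒲.E.pt (𝒲.base.tgt k) 0 :=
    fun k x hk => by rw [𝒲.total.src_mul _ _ (c2 k x hk), 𝒲.src_lin.map_zero, 𝒲.base.src_inv]
  have hDt : ∀ k x, 𝒲.base.src k = φ.obj x → 𝒲.total.tgt (D k x) = F.obj (𝒲.base.tgt k) :=
    fun k x hk => by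
      rw [𝒲.total.tgt_mul _ _ (c2 k x hk), 𝒲.total.tgt_mul _ _ (c1 k x hk), F.tgt_map]
  have hDp : ∀ k x, 𝒲.base.src k = φ.obj x → (D k x).proj = 𝒲.base.one (𝒲.base.tgt k) :=
    fun k x hk => by
      rw [𝒲.mul_proj (c2 k x hk), 𝒲.mul_proj (c1 k x hk), hFp]
      change 𝒲.base.mul (𝒲.base.mul k (𝒲.base.one (φ.obj x))) (𝒲.base.inv k) = _
      rw [𝒲.base.mul_one' hk, 𝒲.base.mul_inv]
  have hDmul : ∀ h k x, 𝒲.base.src k = φ.obj x → 𝒲.base.src h = 𝒲.base.tgt k →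
      𝒲.total.mul (D (𝒲.base.mul h k) x) (𝒲.V.pt h 0) = 𝒲.total.mul (F.map h) (D k x) :=
    fun h k x hk hhk => by
      have hk' : 𝒲.base.src (𝒲.base.mul h k) = φ.obj x := by rw [𝒲.base.src_mul _ _ hhk, hk]
      have hz : 𝒲.base.src (𝒲.base.inv (𝒲.base.mul h k)) = 𝒲.base.tgt h := by
        rw [𝒲.base.src_inv, 𝒲.base.tgt_mul _ _ hhk]
      have hz' : 𝒲.base.mul (𝒲.base.inv (𝒲.base.mul h k)) h = 𝒲.base.inv k := by
        rw [𝒲.base.mul_inv_rev hhk]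
        exact 𝒲.base.inv_mul_cancel_right (by rw [𝒲.base.src_inv, hhk])
      have hFF : 𝒲.total.src (F.map h) = 𝒲.total.tgt (F.map k) := by
        rw [F.src_map, F.tgt_map, hhk]
      simp only [hD]
      rw [𝒲.total.mul_assoc _ _ _ (c2 _ x hk') (by
          rw [𝒲.src_lin.map_zero, 𝒲.tgt_lin.map_zero, hz]), 𝒲.mul_zero hz, hz',
        F.map_mul _ _ hhk, 𝒲.total.mul_assoc _ _ _ hFF (c1 k x hk),
        𝒲.total.mul_assoc _ _ _ (by rw [hFF, 𝒲.total.tgt_mul _ _ (c1 k x hk)]) (c2 k x hk)]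
  have hDeq : ∀ k x k' x', 𝒲.base.src k = φ.obj x → 𝒲.base.src k' = φ.obj x' →
      𝒲.base.tgt k = 𝒲.base.tgt k' → D k x = D k' x' := fun k x k' x' hk hk' hkk => by
    obtain ⟨a, rfl, rfl, rfl⟩ := exists_arrow_of_tgt_eq hφ hk hk' hkk
    have hka : 𝒲.base.src k' = 𝒲.base.tgt (φ.map a) := by rw [hk', φ.tgt_map]
    have hFF : 𝒲.total.src (F.map k') = 𝒲.total.tgt (F.map (φ.map a)) := by
      rw [F.src_map, F.tgt_map, hka]
    have hz : 𝒲.base.src (φ.map a) = 𝒲.base.tgt (𝒲.base.inv (𝒲.base.mul k' (φ.map a))) := by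
      rw [𝒲.base.tgt_inv, 𝒲.base.src_mul _ _ hka]
    have hz' : 𝒲.base.mul (φ.map a) (𝒲.base.inv (𝒲.base.mul k' (φ.map a))) = 𝒲.base.inv k' := by
      rw [𝒲.base.mul_inv_rev hka]
      exact 𝒲.base.mul_inv_cancel_left (by rw [𝒲.base.tgt_inv, hka])
    have hCz : 𝒲.total.src (C (K.tgt a)) = 𝒲.total.tgt (𝒲.V.pt (φ.map a) 0) := right_comp c a
    have hzz : 𝒲.total.src (𝒲.V.pt (φ.map a) 0) =
        𝒲.total.tgt (𝒲.V.pt (𝒲.base.inv (𝒲.base.mul k' (φ.map a))) 0) := by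
      rw [𝒲.src_lin.map_zero, 𝒲.tgt_lin.map_zero, hz]
    simp only [hD]
    rw [F.map_mul _ _ hka, 𝒲.total.mul_assoc _ _ _ hFF (hFs a), hFCm,
      ← 𝒲.total.mul_assoc _ _ _ (c1 k' _ hk') hCz,
      𝒲.total.mul_assoc _ _ _ (by rw [𝒲.total.src_mul _ _ (c1 k' _ hk'), hCz]) hzz,
      𝒲.mul_zero hz, hz']
  choose κ χ hκ hκt using exists_arrow_to hφ
  have hone : ∀ x, D (𝒲.base.one (φ.obj x)) x = C x := fun x => by
    simp only [hD]
    rw [F.map_one, 𝒲.total.one_mul' (hCt x), 𝒲.base.inv_one, ← 𝒲.one_lin.map_zero,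
      𝒲.total.mul_one' (hCs x)]
  obtain ⟨d, hd⟩ := exists_coreSection (φ := LieGroupoidHom.id 𝒲.base) (fun y => D (κ y) (χ y))
    (fun y => by rw [hDp _ _ (hκ y), hκt]; rfl) (fun y₀ => by
      obtain ⟨γ, ξ, hγ⟩ := hφ.local_section y₀
      have hy := hγ.self_of_nhds
      have s1 : ContMDiffAt (𝓡 𝒲.M.dim) 𝒲.V.model ∞ (fun y => C (ξ y)) y₀ :=
        (c.2.1 _).comp y₀ hy.2.1
      have s2 : ContMDiffAt (𝓡 𝒲.M.dim) 𝒲.V.model ∞ (fun y => F.map (γ y)) y₀ :=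
        (F.smooth_map _).comp y₀ hy.1
      refine (𝒲.total.contMDiffAt_mul (𝒲.total.contMDiffAt_mul s2 s1
        (hγ.mono fun y hy => c1 _ _ hy.2.2.1))
        (𝒲.V.contMDiffAt_zero (𝒲.base.contMDiffAt_inv hy.1))
        (hγ.mono fun y hy => c2 _ _ hy.2.2.1)).congr_of_eventuallyEq ?_
      filter_upwards [hγ] with y hy
      exact hDeq _ _ _ _ (hκ y) hy.2.2.1 (by rw [hκt, hy.2.2.2]))
    (fun y => by rw [hDs _ _ (hκ y), hκt]; rfl)
  have hdD : ∀ k x, 𝒲.base.src k = φ.obj x →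
      𝒲.V.pt (𝒲.base.one (𝒲.base.tgt k)) (d.1 (𝒲.base.tgt k)) = D k x := fun k x hk =>
    (hd (𝒲.base.tgt k)).trans (hDeq _ _ _ _ (hκ _) hk (hκt _))
  refine ⟨d, ⟨?_, ?_⟩, ?_⟩
  · refine d_eq_iff.2 fun (h : 𝒲.G) => ?_
    obtain ⟨k, x, hk, hkh⟩ := exists_arrow_to hφ (𝒲.base.src h)
    have e1 : 𝒲.V.pt (𝒲.base.one (𝒲.base.src h)) (d.1 (𝒲.base.src h)) = D k x := by
      rw [← hkh]
      exact hdD k x hk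
    have e2 : 𝒲.V.pt (𝒲.base.one (𝒲.base.tgt h)) (d.1 (𝒲.base.tgt h)) =
        D (𝒲.base.mul h k) x := by
      rw [← 𝒲.base.tgt_mul _ _ hkh.symm]
      exact hdD _ x (by rw [𝒲.base.src_mul _ _ hkh.symm, hk])
    change 𝒲.V.pt h (σ.1 h) = 𝒲.total.mul (𝒲.total.mul
      (𝒲.V.pt (𝒲.base.one (𝒲.base.tgt h)) (d.1 (𝒲.base.tgt h))) (𝒲.V.pt h 0))
      (𝒲.total.inv (𝒲.V.pt (𝒲.base.one (𝒲.base.src h)) (d.1 (𝒲.base.src h))))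
    rw [e1, e2, hDmul h k x hk hkh.symm, 𝒲.total.mul_inv_cancel_right, hF]
    rw [F.src_map, hDt k x hk, hkh]
  · refine Subtype.ext (funext fun x => 𝒲.V.pt_inj (b := 𝒲.base.one (φ.obj x)) ?_)
    have h1 := hdD (𝒲.base.one (φ.obj x)) x (𝒲.base.src_one _)
    rw [hone, 𝒲.base.tgt_one] at h1
    exact h1
  · rintro d' ⟨hd1, hd2⟩
    refine Subtype.ext (funext fun (y : 𝒲.M) => 𝒲.V.pt_inj (b := 𝒲.base.one y) ?_)
    obtain ⟨k, x, hk, rfl⟩ := exists_arrow_to hφ y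
    refine Eq.trans ?_ (hdD k x hk).symm
    have h1 : F.map k = _ := (hF k).trans (d_eq_iff.1 hd1 k)
    have h2 : 𝒲.V.pt (𝒲.base.one (φ.obj x)) (d'.1 (φ.obj x)) = C x := by
      rw [hC, ← hd2]
      rfl
    have h3 : 𝒲.V.pt (𝒲.base.one (𝒲.base.src k)) (d'.1 (𝒲.base.src k)) = C x := by
      rw [hk]
      exact h2
    have c3 : 𝒲.total.src (𝒲.V.pt (𝒲.base.one (𝒲.base.tgt k)) (d'.1 (𝒲.base.tgt k))) =
        𝒲.total.tgt (𝒲.V.pt k 0) := right_comp d' k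
    replace h1 : F.map k = 𝒲.total.mul (𝒲.total.mul
      (𝒲.V.pt (𝒲.base.one (𝒲.base.tgt k)) (d'.1 (𝒲.base.tgt k))) (𝒲.V.pt k 0))
      (𝒲.total.inv (𝒲.V.pt (𝒲.base.one (𝒲.base.src k)) (d'.1 (𝒲.base.src k)))) := h1
    have hz : 𝒲.base.src k = 𝒲.base.tgt (𝒲.base.inv k) := (𝒲.base.tgt_inv k).symm
    simp only [hD]
    rw [h1, h3, 𝒲.total.inv_mul_cancel_right (by
        rw [𝒲.total.src_mul _ _ c3, 𝒲.src_lin.map_zero, hCs, hk]),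
      𝒲.total.mul_assoc _ _ _ c3 (by rw [𝒲.src_lin.map_zero, 𝒲.tgt_lin.map_zero, hz]),
      𝒲.mul_zero hz, 𝒲.base.mul_inv, ← 𝒲.one_lin.map_zero, 𝒲.total.mul_one']
    exact d'.2.2 _

end VBGroupoid

namespace VBGroupoid

variable {A B : SmoothMfd.{u}} {K : LieGroupoid (𝓡 A.dim) (𝓡 B.dim) A B} {𝒲 : VBGroupoid.{u}}
  {φ : LieGroupoidHom K 𝒲.base}

/-- A multiplicative section `F` along an equivalence `φ` extends, compatibly with right translation
by the vectors `F a`, to a map `Ω` which assigns to an arrow `k` with source `φ x` a vector over `k`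
with source `F x`.  Such maps exist locally, by lifting of vectors through the source map, and the
conditions on them are preserved by weighted sums, as the multiplication is linear. -/
theorem exists_equivariant (hφ : φ.IsSmoothEquivalence.{u}) (F : LieGroupoidHom K 𝒲.total)
    (hF : ∀ g, (F.map g).proj = φ.map g) :
    ∃ Ω : 𝒲.G → B → 𝒲.V.Tot,
      (∀ k x, 𝒲.base.src k = φ.obj x → (Ω k x).proj = k ∧ 𝒲.total.src (Ω k x) = F.obj x) ∧
      (∀ k a, 𝒲.base.src k = φ.obj (K.tgt a) →
        Ω (𝒲.base.mul k (φ.map a)) (K.src a) = 𝒲.total.mul (Ω k (K.tgt a)) (F.map a)) ∧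
      ∀ (P : SmoothMfd.{u}) (k : P → 𝒲.G) (x : P → B) (z : P),
        ContMDiffAt (𝓡 P.dim) (𝓡 𝒲.G.dim) ∞ k z → ContMDiffAt (𝓡 P.dim) (𝓡 B.dim) ∞ x z →
        (∀ᶠ q in 𝓝 z, 𝒲.base.src (k q) = φ.obj (x q)) →
        ContMDiffAt (𝓡 P.dim) 𝒲.V.model ∞ (fun q => Ω (k q) (x q)) z := by
  have hFo : ∀ x, (F.obj x).proj = φ.obj x := fun x => by
    have h1 := F.src_map (K.one x)
    rw [K.src_one] at h1
    rw [← h1, 𝒲.src_lin.proj, hF, φ.src_map, K.src_one]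
  have hloc : ∀ y₀ : 𝒲.M, ∃ (γ : 𝒲.M → 𝒲.G) (ξ : 𝒲.M → B) (w : 𝒲.M → 𝒲.V.Tot), ∀ᶠ y in 𝓝 y₀,
      (ContMDiffAt (𝓡 𝒲.M.dim) (𝓡 𝒲.G.dim) ∞ γ y ∧ ContMDiffAt (𝓡 𝒲.M.dim) (𝓡 B.dim) ∞ ξ y ∧
        ContMDiffAt (𝓡 𝒲.M.dim) 𝒲.V.model ∞ w y) ∧
      (𝒲.base.src (γ y) = φ.obj (ξ y) ∧ 𝒲.base.tgt (γ y) = y) ∧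
      (w y).proj = γ y ∧ 𝒲.total.src (w y) = F.obj (ξ y) := fun y₀ => by
    obtain ⟨γ, ξ, h⟩ := hφ.local_section y₀
    obtain ⟨w, hw⟩ := 𝒲.exists_lift (γ := γ) (v := fun y => F.obj (ξ y))
      (h.mono fun y hy => hy.1) (h.mono fun y hy => (F.smooth_obj _).comp y hy.2.1)
      (h.mono fun y hy => by rw [hFo, hy.2.2.1])
    refine ⟨γ, ξ, w, ?_⟩
    filter_upwards [h, hw] with y h1 h2
    exact ⟨⟨h1.1, h1.2.1, h2.1⟩, h1.2.2, h2.2⟩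
  choose γ ξ w hw using hloc
  obtain ⟨ρ, hρ1, hρ2⟩ := 𝒲.M.exists_partition hw
  obtain ⟨l, hl⟩ := hφ.exists_lift
  -- `γ i` sends `k` to the arrow `b i k x` of `K` with image `(γ i)⁻¹ k`
  set b : 𝒲.M → 𝒲.G → B → A := fun i k x =>
    l (𝒲.base.mul (𝒲.base.inv (γ i (𝒲.base.tgt k))) k) x (ξ i (𝒲.base.tgt k)) with hb
  set θ : 𝒲.M → 𝒲.G → B → 𝒲.V.Tot := fun i k x =>
    𝒲.total.mul (w i (𝒲.base.tgt k)) (F.map (b i k x)) with hθ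
  have hbl : ∀ i k x, 𝒲.base.src (γ i (𝒲.base.tgt k)) = φ.obj (ξ i (𝒲.base.tgt k)) ∧
      𝒲.base.tgt (γ i (𝒲.base.tgt k)) = 𝒲.base.tgt k → 𝒲.base.src k = φ.obj x →
      φ.map (b i k x) = 𝒲.base.mul (𝒲.base.inv (γ i (𝒲.base.tgt k))) k ∧ K.src (b i k x) = x ∧
        K.tgt (b i k x) = ξ i (𝒲.base.tgt k) := fun i k x hi hk => by
    have hc : 𝒲.base.src (𝒲.base.inv (γ i (𝒲.base.tgt k))) = 𝒲.base.tgt k := by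
      rw [𝒲.base.src_inv, hi.2]
    exact hl _ _ _ (by rw [𝒲.base.src_mul _ _ hc, hk])
      (by rw [𝒲.base.tgt_mul _ _ hc, 𝒲.base.tgt_inv, hi.1])
  have hcomp : ∀ i k x, 𝒲.base.src (γ i (𝒲.base.tgt k)) = φ.obj (ξ i (𝒲.base.tgt k)) ∧
      𝒲.base.tgt (γ i (𝒲.base.tgt k)) = 𝒲.base.tgt k →
      𝒲.total.src (w i (𝒲.base.tgt k)) = F.obj (ξ i (𝒲.base.tgt k)) → 𝒲.base.src k = φ.obj x →
      𝒲.total.src (w i (𝒲.base.tgt k)) = 𝒲.total.tgt (F.map (b i k x)) := fun i k x hi hs hk => by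
    rw [hs, F.tgt_map, (hbl i k x hi hk).2.2]
  have hθp : ∀ i k x, ρ i (𝒲.base.tgt k) ≠ 0 → 𝒲.base.src k = φ.obj x →
      (θ i k x).proj = k := fun i k x hi hk => by
    obtain ⟨-, h1, h2, h3⟩ := hρ2 i _ hi
    rw [𝒲.mul_proj (hcomp i k x h1 h3 hk), h2, hF, (hbl i k x h1 hk).1]
    exact 𝒲.base.mul_inv_cancel_left h1.2
  have hθs : ∀ i k x, ρ i (𝒲.base.tgt k) ≠ 0 → 𝒲.base.src k = φ.obj x →
      𝒲.total.src (θ i k x) = F.obj x := fun i k x hi hk => by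
    obtain ⟨-, h1, h2, h3⟩ := hρ2 i _ hi
    rw [𝒲.total.src_mul _ _ (hcomp i k x h1 h3 hk), F.src_map, (hbl i k x h1 hk).2.1]
  refine ⟨fun k x => 𝒲.V.comb ρ (𝒲.base.tgt k) (fun i => θ i k x) k,
    fun k x hk => ⟨rfl, ?_⟩, fun k a hk => ?_, fun P k x z hks hxs hkx => ?_⟩
  · rw [SmoothVB.map_comb 𝒲.src_lin fun i hi => hθp i k x hi hk]
    exact SmoothVB.comb_eq (fun i hi => hθs i k x hi hk) (by rw [hFo, hk])
  · have hka : 𝒲.base.src k = 𝒲.base.tgt (φ.map a) := by rw [hk, φ.tgt_map]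
    have ht : 𝒲.base.tgt (𝒲.base.mul k (φ.map a)) = 𝒲.base.tgt k := 𝒲.base.tgt_mul _ _ hka
    have hs : 𝒲.base.src (𝒲.base.mul k (φ.map a)) = φ.obj (K.src a) := by
      rw [𝒲.base.src_mul _ _ hka, φ.src_map]
    have hFa : F.map a = 𝒲.V.comb ρ (𝒲.base.tgt k) (fun _ => F.map a) (φ.map a) :=
      (SmoothVB.comb_eq (fun _ _ => rfl) (hF a)).symm
    beta_reduce
    rw [hFa, SmoothVB.mul_comb (fun i hi => hθp i k _ hi hk) (fun _ _ => hF a) hka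
      (fun i hi => by rw [hθs i k _ hi hk, F.tgt_map]), ht]
    refine SmoothVB.comb_congr (fun i hi => ?_) _
    obtain ⟨-, h1, h2, h3⟩ := hρ2 i _ hi
    have hb1 := hbl i k _ h1 hk
    have hb2 := hbl i (𝒲.base.mul k (φ.map a)) (K.src a) (by rw [ht]; exact h1) hs
    rw [ht] at hb2
    have hba : b i (𝒲.base.mul k (φ.map a)) (K.src a) = K.mul (b i k (K.tgt a)) a := by
      refine hφ.faithful _ _ ?_ ?_ ?_
      · rw [hb2.1, φ.map_mul _ _ hb1.2.1, hb1.1, 𝒲.base.mul_assoc _ _ _ _ hka]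
        rw [𝒲.base.src_inv, h1.2]
      · rw [hb2.2.1, K.src_mul _ _ hb1.2.1]
      · rw [hb2.2.2, K.tgt_mul _ _ hb1.2.1, hb1.2.2]
    simp only [hθ]
    rw [ht, hba, F.map_mul _ _ hb1.2.1, 𝒲.total.mul_assoc _ _ _ (hcomp i k _ h1 h3 hk)]
    rw [F.src_map, F.tgt_map, hb1.2.1]
  · have hts := 𝒲.base.contMDiffAt_tgt hks
    refine SmoothVB.contMDiffAt_comb hks hts fun i hi => ?_
    have h1 := hρ1 i _ hi
    obtain ⟨s1, s2, s3⟩ := h1.self_of_nhds.1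
    have h2 := hts.continuousAt.eventually h1
    have s4 : ContMDiffAt (𝓡 P.dim) (𝓡 𝒲.G.dim) ∞ (fun q => γ i (𝒲.base.tgt (k q))) z :=
      s1.comp z hts
    have s5 : ContMDiffAt (𝓡 P.dim) (𝓡 B.dim) ∞ (fun q => ξ i (𝒲.base.tgt (k q))) z :=
      s2.comp z hts
    have s6 : ContMDiffAt (𝓡 P.dim) 𝒲.V.model ∞ (fun q => w i (𝒲.base.tgt (k q))) z :=
      s3.comp z hts
    have s7 : ContMDiffAt (𝓡 P.dim) (𝓡 A.dim) ∞ (fun q => b i (k q) (x q)) z :=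
      hφ.contMDiffAt_of_eq (𝒲.base.contMDiffAt_mul (𝒲.base.contMDiffAt_inv s4) hks
        (h2.mono fun q hq => by rw [𝒲.base.src_inv, hq.2.1.2])) hxs s5 (by
        filter_upwards [h2, hkx] with q h3 h4
        exact hbl i _ _ h3.2.1 h4)
    have h5 : ∀ᶠ q in 𝓝 z, 𝒲.total.src (w i (𝒲.base.tgt (k q))) =
        𝒲.total.tgt (F.map (b i (k q) (x q))) := by
      filter_upwards [h2, hkx] with q h3 h4
      exact hcomp i _ _ h3.2.1 h3.2.2.2 h4
    refine ⟨𝒲.total.contMDiffAt_mul s6 ((F.smooth_map _).comp z s7) h5, ?_⟩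
    filter_upwards [h2, hkx, h5] with q h3 h4 h6
    rw [𝒲.mul_proj h6, h3.2.2.1, hF, (hbl i _ _ h3.2.1 h4).1]
    exact 𝒲.base.mul_inv_cancel_left h3.2.1.2

/-- The maps `Ω k x` of `exists_equivariant` are arrows over `k`.  Conjugating `h` by them, that is,
taking `Ω (h k) x · (Ω k x)⁻¹` for any `k : φ x → src h`, defines a multiplicative section over the
target of `φ`, the pullback of which is conjugate to the given one by the arrows `Ω 1 x`. -/
theorem pull_exact_right (hφ : φ.IsSmoothEquivalence.{u}) (τ : 𝒲.multSections φ) :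
    ∃ (σ : 𝒲.multSections (LieGroupoidHom.id 𝒲.base)) (c : 𝒲.coreSections φ),
      𝒲.pullMult φ σ = @HAdd.hAdd (𝒲.multSections φ) (𝒲.multSections φ) (𝒲.multSections φ) _
        τ ((𝒲.multComplexAlong φ).d c) := by
  obtain ⟨F, hF⟩ := τ.2
  obtain ⟨Ω, h1, hΩm, hΩs⟩ := exists_equivariant hφ F fun g => by rw [hF]
  have hΩp : ∀ k x, 𝒲.base.src k = φ.obj x → (Ω k x).proj = k := fun k x hk => (h1 k x hk).1
  have hΩf : ∀ k x, 𝒲.base.src k = φ.obj x → 𝒲.total.src (Ω k x) = F.obj x :=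
    fun k x hk => (h1 k x hk).2
  choose κ χ hκ hκt using exists_arrow_to hφ
  set T : 𝒲.G → 𝒲.G → B → 𝒲.V.Tot := fun h k x =>
    𝒲.total.mul (Ω (𝒲.base.mul h k) x) (𝒲.total.inv (Ω k x)) with hT
  have hmk : ∀ h k x, 𝒲.base.src k = φ.obj x → 𝒲.base.src h = 𝒲.base.tgt k →
      𝒲.base.src (𝒲.base.mul h k) = φ.obj x := fun h k x hk hh => by
    rw [𝒲.base.src_mul _ _ hh, hk]
  have c1 : ∀ h k x, 𝒲.base.src k = φ.obj x → 𝒲.base.src h = 𝒲.base.tgt k →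
      𝒲.total.src (Ω (𝒲.base.mul h k) x) = 𝒲.total.tgt (𝒲.total.inv (Ω k x)) :=
    fun h k x hk hh => by
      rw [hΩf _ _ (hmk h k x hk hh), 𝒲.total.tgt_inv, hΩf _ _ hk]
  have hΩa : ∀ k x k' x', 𝒲.base.src k = φ.obj x → 𝒲.base.src k' = φ.obj x' →
      𝒲.base.tgt k = 𝒲.base.tgt k' → ∃ a, 𝒲.base.mul k' (φ.map a) = k ∧ K.src a = x ∧
        K.tgt a = x' ∧ 𝒲.base.src k' = 𝒲.base.tgt (φ.map a) ∧
        𝒲.total.src (Ω k' x') = 𝒲.total.tgt (F.map a) ∧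
        Ω k x = 𝒲.total.mul (Ω k' x') (F.map a) := fun k x k' x' hk hk' hkk => by
    obtain ⟨a, rfl, rfl, rfl⟩ := exists_arrow_of_tgt_eq hφ hk hk' hkk
    exact ⟨a, rfl, rfl, rfl, by rw [hk', φ.tgt_map], by rw [hΩf _ _ hk', F.tgt_map],
      hΩm k' a hk'⟩
  -- the target of `Ω k x` only depends on the target of `k`
  have hΩt : ∀ k x k' x', 𝒲.base.src k = φ.obj x → 𝒲.base.src k' = φ.obj x' →
      𝒲.base.tgt k = 𝒲.base.tgt k' → 𝒲.total.tgt (Ω k x) = 𝒲.total.tgt (Ω k' x') :=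
    fun k x k' x' hk hk' hkk => by
      obtain ⟨a, -, -, -, -, h2, h3⟩ := hΩa k x k' x' hk hk' hkk
      rw [h3, 𝒲.total.tgt_mul _ _ h2]
  have hTeq : ∀ h k x k' x', 𝒲.base.src k = φ.obj x → 𝒲.base.src k' = φ.obj x' →
      𝒲.base.src h = 𝒲.base.tgt k → 𝒲.base.src h = 𝒲.base.tgt k' → T h k x = T h k' x' :=
    fun h k x k' x' hk hk' hh hh' => by
      obtain ⟨a, rfl, rfl, rfl, h2, h3, h4⟩ := hΩa k x k' x' hk hk' (hh.symm.trans hh')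
      have h5 := hΩm (𝒲.base.mul h k') a (hmk h k' _ hk' hh')
      have h6 : 𝒲.total.src (Ω (𝒲.base.mul h k') (K.tgt a)) = 𝒲.total.tgt (F.map a) := by
        rw [hΩf _ _ (hmk h k' _ hk' hh'), F.tgt_map]
      have h7 : 𝒲.total.src (F.map a) = 𝒲.total.tgt (𝒲.total.inv (F.map a)) :=
        (𝒲.total.tgt_inv _).symm
      have h8 : 𝒲.total.src (𝒲.total.inv (F.map a)) =
          𝒲.total.tgt (𝒲.total.inv (Ω k' (K.tgt a))) := by
        rw [𝒲.total.src_inv, 𝒲.total.tgt_inv, h3]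
      simp only [hT]
      rw [h4, ← 𝒲.base.mul_assoc _ _ _ hh' h2, h5, 𝒲.total.mul_inv_rev h3,
        ← 𝒲.total.mul_assoc _ _ _ (by rw [𝒲.total.src_mul _ _ h6, h7]) h8,
        𝒲.total.mul_inv_cancel_right h6]
  have hTp : ∀ h k x, 𝒲.base.src k = φ.obj x → 𝒲.base.src h = 𝒲.base.tgt k →
      (T h k x).proj = h := fun h k x hk hh => by
    rw [𝒲.mul_proj (c1 h k x hk hh), 𝒲.inv_lin.proj, hΩp _ _ hk, hΩp _ _ (hmk h k x hk hh)]
    exact 𝒲.base.mul_inv_cancel_right hh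
  have hTs : ∀ h k x, 𝒲.base.src k = φ.obj x → 𝒲.base.src h = 𝒲.base.tgt k →
      𝒲.total.src (T h k x) = 𝒲.total.tgt (Ω k x) := fun h k x hk hh => by
    rw [𝒲.total.src_mul _ _ (c1 h k x hk hh), 𝒲.total.src_inv]
  have hTt : ∀ h k x, 𝒲.base.src k = φ.obj x → 𝒲.base.src h = 𝒲.base.tgt k →
      𝒲.total.tgt (T h k x) = 𝒲.total.tgt (Ω (𝒲.base.mul h k) x) := fun h k x hk hh =>
    𝒲.total.tgt_mul _ _ (c1 h k x hk hh)
  set S : 𝒲.G → 𝒲.V.Tot := fun h => T h (κ (𝒲.base.src h)) (χ (𝒲.base.src h)) with hS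
  have hST : ∀ h k x, 𝒲.base.src k = φ.obj x → 𝒲.base.src h = 𝒲.base.tgt k → S h = T h k x :=
    fun h k x hk hh => hTeq _ _ _ _ _ (hκ _) hk (hκt _).symm hh
  obtain ⟨σ, hσ⟩ := exists_multSection (φ := LieGroupoidHom.id 𝒲.base) S
    (fun y => 𝒲.total.tgt (Ω (κ y) (χ y)))
    (fun h => hTp h _ _ (hκ _) (hκt _).symm)
    (fun h₀ => by
      obtain ⟨γ, ξ, hγ⟩ := hφ.local_section (𝒲.base.src h₀)
      have hsc := 𝒲.base.submersion_src.contMDiff h₀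
      have hev := hsc.continuousAt.eventually hγ
      have s1 : ContMDiffAt (𝓡 𝒲.G.dim) (𝓡 𝒲.G.dim) ∞ (fun h => γ (𝒲.base.src h)) h₀ :=
        hγ.self_of_nhds.1.comp h₀ hsc
      have s2 : ContMDiffAt (𝓡 𝒲.G.dim) (𝓡 B.dim) ∞ (fun h => ξ (𝒲.base.src h)) h₀ :=
        hγ.self_of_nhds.2.1.comp h₀ hsc
      have s3 := 𝒲.base.contMDiffAt_mul (contMDiffAt_id (x := h₀)) s1
        (hev.mono fun h hh => hh.2.2.2.symm)
      refine (𝒲.total.contMDiffAt_mul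
        (hΩs 𝒲.G (fun h => 𝒲.base.mul h (γ (𝒲.base.src h))) (fun h => ξ (𝒲.base.src h)) h₀ s3 s2
          (hev.mono fun h hh => hmk _ _ _ hh.2.2.1 hh.2.2.2.symm))
        (𝒲.total.contMDiffAt_inv (hΩs 𝒲.G _ _ h₀ s1 s2 (hev.mono fun h hh => hh.2.2.1)))
        (hev.mono fun h hh => c1 _ _ _ hh.2.2.1 hh.2.2.2.symm)).congr_of_eventuallyEq ?_
      filter_upwards [hev] with h hh
      exact hST h _ _ hh.2.2.1 hh.2.2.2.symm)
    (fun h => hTs h _ _ (hκ _) (hκt _).symm)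
    (fun h => (hTt h _ _ (hκ _) (hκt _).symm).trans
      (hΩt _ _ _ _ (hmk h _ _ (hκ _) (hκt _).symm) (hκ _)
        (by rw [𝒲.base.tgt_mul _ _ (hκt _).symm, hκt])))
    (fun h' h hh => by
      obtain ⟨k, x, hk, hkh⟩ := exists_arrow_to hφ (𝒲.base.src h)
      have c2 := hmk h k x hk hkh.symm
      have c3 : 𝒲.base.src h' = 𝒲.base.tgt (𝒲.base.mul h k) := by
        rw [𝒲.base.tgt_mul _ _ hkh.symm, hh]
      have c4 := c1 h k x hk hkh.symm
      rw [hST _ k x hk (by rw [𝒲.base.src_mul _ _ hh, hkh]), hST h k x hk hkh.symm,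
        hST h' _ x c2 c3]
      simp only [hT]
      rw [𝒲.base.mul_assoc _ _ _ hh hkh.symm,
        ← 𝒲.total.mul_assoc _ _ _ (by
          rw [𝒲.total.src_mul _ _ (c1 h' _ x c2 c3), 𝒲.total.src_inv]) c4,
        𝒲.total.inv_mul_cancel_right]
      rw [hΩf _ _ c2, hΩf _ _ (hmk h' _ x c2 c3)])
  have hu : ∀ x, 𝒲.base.src (𝒲.base.one (φ.obj x)) = φ.obj x := fun x => 𝒲.base.src_one _
  obtain ⟨c, hc⟩ := exists_core_of_arrows (φ := φ) (fun x => Ω (𝒲.base.one (φ.obj x)) x) F.obj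
    (fun x => hΩs B (fun x => 𝒲.base.one (φ.obj x)) (fun x => x) x
      (𝒲.base.contMDiffAt_one (φ.smooth_obj x)) contMDiffAt_id (Filter.Eventually.of_forall hu))
    (fun x => hΩp _ _ (hu x)) (fun x => hΩf _ _ (hu x))
  refine ⟨σ, c, eq_add_delta (fun g => by rw [← hF, F.src_map]) (fun g => by rw [← hF, F.tgt_map])
    hc fun g => ?_⟩
  refine (hσ (φ.map g)).trans ((hST _ (𝒲.base.one (φ.obj (K.src g))) (K.src g) (hu _)
    (by rw [𝒲.base.tgt_one, φ.src_map])).trans ?_)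
  have h2 := hΩm (𝒲.base.one (φ.obj (K.tgt g))) g (hu _)
  rw [𝒲.base.one_mul' (φ.tgt_map g)] at h2
  simp only [hT]
  rw [𝒲.base.mul_one' (φ.src_map g), h2, hF]

theorem pull_bijective (hφ : φ.IsSmoothEquivalence.{u}) :
    Function.Bijective (𝒲.pull φ).mapH0 ∧ Function.Bijective (𝒲.pull φ).mapH1 := by
  refine (𝒲.pull φ).bijective_of_exact_cone (pull_exact_left hφ) fun τ => ?_
  obtain ⟨σ, c, h⟩ : ∃ (σ : 𝒲.multComplex.X1) (c : (𝒲.multComplexAlong φ).X0),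
      (𝒲.pull φ).f1 σ = τ + (𝒲.multComplexAlong φ).d c := pull_exact_right hφ τ
  exact ⟨σ, c, h⟩

end VBGroupoid

/-! ### Morita invariance -/

theorem VBGroupoidHom.IsVBMorita.exists_equiv {𝒱 𝒲 : VBGroupoid.{u}} {Φ : VBGroupoidHom 𝒱 𝒲}
    (hΦ : Φ.IsVBMorita) :
    (∃ e₀ : 𝒱.multComplex.H0 ≃ₗ[ℝ] 𝒲.multComplex.H0,
      ∀ a, (𝒲.pull Φ.base).mapH0 (e₀ a) = Φ.push.mapH0 a) ∧
    ∃ e₁ : 𝒱.multComplex.H1 ≃ₗ[ℝ] 𝒲.multComplex.H1,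
      ∀ a, (𝒲.pull Φ.base).mapH1 (e₁ a) = Φ.push.mapH1 a := by
  have hs := hΦ.isSmoothEquivalence
  obtain ⟨p0, p1⟩ := VBGroupoidHom.push_bijective hs
  obtain ⟨q0, q1⟩ := VBGroupoid.pull_bijective (VBGroupoidHom.isSmoothEquivalence_base hs)
  exact ⟨⟨(LinearEquiv.ofBijective _ p0).trans (LinearEquiv.ofBijective _ q0).symm, fun a =>
      (LinearEquiv.ofBijective _ q0).apply_symm_apply (Φ.push.mapH0 a)⟩,
    ⟨(LinearEquiv.ofBijective _ p1).trans (LinearEquiv.ofBijective _ q1).symm, fun a =>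
      (LinearEquiv.ofBijective _ q1).apply_symm_apply (Φ.push.mapH1 a)⟩⟩

end

theorem theorem3p13 :
    (∀ (𝒱 𝒲 : VBGroupoid.{u}) (Φ : VBGroupoidHom 𝒱 𝒲), Φ.IsVBMorita →
      Function.Bijective (𝒲.pull Φ.base).mapH0 ∧ Function.Bijective (𝒲.pull Φ.base).mapH1 ∧
      (∃ e₀ : 𝒱.multComplex.H0 ≃ₗ[ℝ] 𝒲.multComplex.H0,
        ∀ a, (𝒲.pull Φ.base).mapH0 (e₀ a) = Φ.push.mapH0 a) ∧
      (∃ e₁ : 𝒱.multComplex.H1 ≃ₗ[ℝ] 𝒲.multComplex.H1,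
        ∀ a, (𝒲.pull Φ.base).mapH1 (e₁ a) = Φ.push.mapH1 a)) ∧
    (∀ 𝒱 𝒱' : VBGroupoid.{u}, 𝒱.MoritaEquivalent 𝒱' →
      Nonempty (𝒱.multComplex.H0 ≃ₗ[ℝ] 𝒱'.multComplex.H0) ∧
      Nonempty (𝒱.multComplex.H1 ≃ₗ[ℝ] 𝒱'.multComplex.H1)) := by
  refine ⟨fun 𝒱 𝒲 Φ hΦ => ?_, ?_⟩
  · obtain ⟨q0, q1⟩ := VBGroupoid.pull_bijective
      (VBGroupoidHom.isSmoothEquivalence_base hΦ.isSmoothEquivalence)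
    exact ⟨q0, q1, hΦ.exists_equiv⟩
  · rintro 𝒱 𝒱' ⟨𝒲, Φ, Φ', hΦ, hΦ'⟩
    obtain ⟨⟨e₀, -⟩, e₁, -⟩ := hΦ.exists_equiv
    obtain ⟨⟨e₀', -⟩, e₁', -⟩ := hΦ'.exists_equiv
    exact ⟨⟨e₀.symm.trans e₀'⟩, ⟨e₁.symm.trans e₁'⟩⟩
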